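/- **Setting.** Let $\Bbbk$ be a field of characteristic $0$, $q:=\exp(\hbar)\in\Bbbk[[\hbar]]$, and $[x,y]_a:=xy-a\,yx$. Let $U_\hbar(\mathfrak{gl}_3)$ be the $\hbar$-adically complete unital $\Bbbk[[\hbar]]$-algebra topologically generated by $f_1,f_2,\ell_1,\ell_2,\ell_3,e_1,e_2$ with relations $$\ell_jf_i-f_i\ell_j=(\delta_{i+1,j}-\delta_{i,j})f_i,\qquad \ell_j\ell_m=\ell_m\ell_j,\qquad \ell_je_i-e_i\ell_j=(\delta_{i,j}-\delta_{i+1,j})e_i,\qquad e_if_j-f_je_i=\delta_{i,j}\frac{t_i-t_i^{-1}}{q-q^{-1}},$$ $$e_i^2e_j-(q+q^{-1})e_ie_je_i+e_je_i^2=0,\qquad f_i^2f_j-(q+q^{-1})f_if_jf_i+f_jf_i^2=0\qquad(i\neq j),$$ where $t_i:=q^{h_i}$, $h_i:=\ell_i-\ell_{i+1}$ and $q^x:=\exp(\hbar x)$. There are a unique algebra homomorphism $\Delta\colon U_\hbar(\mathfrak{gl}_3)\to U_\hbar(\mathfrak{gl}_3)\,\widehat\otimes\,U_\hbar(\mathfrak{gl}_3)$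 (where $\widehat\otimes$ is the $\hbar$-adically completed tensor product) and a unique algebra homomorphism $\epsilon\colon U_\hbar(\mathfrak{gl}_3)\to\Bbbk[[\hbar]]$ (both $\Bbbk[[\hbar]]$-linear) such that $$\Delta(f_i)=f_i\otimes t_i^{-1}+1\otimes f_i,\quad \Delta(\ell_j)=\ell_j\otimes1+1\otimes\ell_j,\quad \Delta(e_i)=e_i\otimes1+t_i\otimes e_i,\quad \epsilon(f_i)=\epsilon(\ell_j)=\epsilon(e_i)=0 .$$ Put $\delta_n:=(\mathrm{id}-\epsilon)^{\otimes n}\circ\Delta^{n}$, where $\Delta^n$ is the iterated coproduct with $n$ tensor factors. Let $U_\hbar(\mathfrak{sl}_3)$ be the $\hbar$-adically closed subalgebra generated by the $f_i,h_i,e_i$, and let $U_\hbar(\mathfrak{so}_3)$ be the $\hbar$-adically closed subalgebra generated by $$K_{i,j}:=\sum_{s=i}^{j}q^{3-s}(q-q^{-1})^{-1}L^-_{s,i}L^+_{s,j}\qquad(1\le i<j\le3),$$ where $L^{\pm}_{i,i}=q^{\pm\ell_i}$, $L^+_{i,j}=(q-q^{-1})q^{\ell_i}F_{j,i}$ for $i<j$,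 $L^-_{i,j}=-(q-q^{-1})E_{j,i}q^{-\ell_j}$ for $i>j$, with $E_{i,i+1}=e_i$, $F_{i+1,i}=f_i$, $E_{1,3}=[e_1,e_2]_q$, $F_{3,1}=[f_2,f_1]_{q^{-1}}$. (So $K_{1,2}=q^2(f_1-q\,t_1^{-1}e_1)$, $K_{2,3}=q(f_2-q\,t_2^{-1}e_2)$ and $K_{1,3}=q^2\big(F_{3,1}-(q-q^{-1})f_2t_1^{-1}e_1-t_1^{-1}t_2^{-1}E_{1,3}\big)$.) Finally let $$F_\hbar[[U_3^+]]:=U_\hbar(\mathfrak{so}_3)^{\Lsh}:=\big\{x\in U_\hbar(\mathfrak{so}_3)\ :\ \delta_n(x)\in\hbar^n\,U_\hbar(\mathfrak{so}_3)\,\widehat\otimes\,U_\hbar(\mathfrak{sl}_3)^{\widehat\otimes(n-1)}\ \text{ for all } n\ge1\big\},$$ endowed with the topology induced by the $\hbar$-adic topology of $U_\hbar(\mathfrak{gl}_3)$, and let $U_\hbar(\mathfrak{sl}_3)':=\{x\in U_\hbar(\mathfrak{sl}_3):\delta_n(x)\in\hbar^nU_\hbar(\mathfrak{sl}_3)^{\widehat\otimes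 n}\ \text{for all } n\ge1\}$. **Theorem 6.10.** 1. $F_\hbar[[U_3^+]]$ is a unital $\Bbbk[[\hbar]]$-subalgebra, $\hbar$-adically complete as a $\Bbbk[[\hbar]]$-module, and it is the complete topological unital $\Bbbk[[\hbar]]$-algebra with generators $$k_{1,2}:=q^{-2}(q-q^{-1})K_{1,2},\qquad k_{2,3}:=q^{-1}(q-q^{-1})K_{2,3},\qquad k_{1,3}:=q^{-2}(q-q^{-1})K_{1,3}$$ and relations $$k_{1,2}k_{2,3}=q\,k_{2,3}k_{1,2}-q(q-q^{-1})k_{1,3},\quad k_{2,3}k_{1,3}=q\,k_{1,3}k_{2,3}-(q-q^{-1})k_{1,2},\quad k_{1,3}k_{1,2}=q\,k_{1,2}k_{1,3}-(q-q^{-1})k_{2,3}.$$ That is: if $A$ is the unital $\Bbbk[[\hbar]]$-algebra with these three generators and relations and $I\subset A$ is the two-sided ideal generated by $\hbar$ and the three generators, then there is an isomorphism of $\Bbbk[[\hbar]]$-algebras $\Phi\colon\varprojlim_m A/I^m\to F_\hbar[[U_3^+]]$ sending generators to generators, and for all $m\in\mathbb{N}$ an element $x$ has zero component in $A/I^m$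 if and only if $\Phi(x)\in\hbar^mU_\hbar(\mathfrak{gl}_3)$. 2. One has $$\Delta(k_{1,2})=1\otimes k_{1,2}+k_{1,2}\otimes t_1^{-1},\qquad \Delta(k_{2,3})=1\otimes k_{2,3}+k_{2,3}\otimes t_2^{-1},$$ $$\Delta(k_{1,3})=1\otimes k_{1,3}+k_{1,3}\otimes t_1^{-1}t_2^{-1}+q^{-1}(q-q^{-1})\,k_{1,2}\otimes f_2t_1^{-1}-(q-q^{-1})\,k_{2,3}\otimes t_1^{-1}t_2^{-1}e_1,$$ and $F_\hbar[[U_3^+]]$ is a right coideal of $U_\hbar(\mathfrak{sl}_3)'$: $\Delta\big(F_\hbar[[U_3^+]]\big)$ lies in the $\hbar$-adic closure, in $U_\hbar(\mathfrak{gl}_3)\widehat\otimes U_\hbar(\mathfrak{gl}_3)$, of the span of the $x\otimes u$ with $x\in F_\hbar[[U_3^+]]$, $u\in U_\hbar(\mathfrak{sl}_3)'$. 3. The ordered monomials $k_{1,2}^a\,k_{1,3}^b\,k_{2,3}^c$ ($a,b,c\in\mathbb{N}$) form a topological $\Bbbk[[\hbar]]$-basis of $F_\hbar[[U_3^+]]$: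 for every family $(\chi_{a,b,c})$ in $\Bbbk[[\hbar]]$ the series $\sum\chi_{a,b,c}\,k_{1,2}^ak_{1,3}^bk_{2,3}^c$ converges $\hbar$-adically in $U_\hbar(\mathfrak{gl}_3)$ to an element of $F_\hbar[[U_3^+]]$, and every element of $F_\hbar[[U_3^+]]$ is the sum of such a series for exactly one family. 4. $F_\hbar[[U_3^+]]$ quantizes the Dubrovin–Ugaglia Poisson structure on the Stokes matrices $\begin{pmatrix}1&x&y\\0&1&z\\0&0&1\end{pmatrix}$: there is a surjective ring homomorphism $\sigma\colon F_\hbar[[U_3^+]]\to\Bbbk[[x,y,z]]$, linear over $\Bbbk[[\hbar]]\to\Bbbk$, $\hbar\mapsto0$, with kernel $\hbar F_\hbar[[U_3^+]]$ and $\sigma(k_{1,2})=z$, $\sigma(k_{1,3})=y$, $\sigma(k_{2,3})=x$, such that $ab-ba=\hbar c$ in $F_\hbar[[U_3^+]]$ implies $\sigma(c)=\{\sigma(a),\sigma(b)\}$, where $\{\,,\}$ is the continuous biderivation with $\{x,y\}=xy-2z$, $\{y,z\}=yz-2x$, $\{z,x\}=zx-2y$. -/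

import Mathlib

open scoped TensorProduct PowerSeries

noncomputable section

namespace QuantumStokes

universe u

/-! ### `ħ`-adic notions. Throughout `k⟦X⟧` is `k[[ħ]]`, the variable `X` being `ħ`. -/

/-- A subset of a `k[[ħ]]`-module is closed in the `ħ`-adic topology. -/
def IsHClosed {k : Type*} [Field k] {M : Type*} [AddCommGroup M] [Module k⟦X⟧ M]
    (S : Set M) : Prop :=
  ∀ x : M, (∀ N : ℕ, ∃ s ∈ S, ∃ y : M, x = s + (PowerSeries.X ^ N : k⟦X⟧) • y) → x ∈ S

/-- The family `g` is summable, with sum `x`, in the `ħ`-adic topology. -/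
def HasHSum {k : Type*} [Field k] {M : Type*} [AddCommGroup M] [Module k⟦X⟧ M]
    {ι : Type*} (g : ι → M) (x : M) : Prop :=
  ∀ N : ℕ, ∃ s₀ : Finset ι, ∀ s : Finset ι, s₀ ⊆ s →
    ∃ y : M, x - ∑ i ∈ s, g i = (PowerSeries.X ^ N : k⟦X⟧) • y

/-- The ideal `ħ^N A` of a `k[[ħ]]`-algebra `A`. -/
def hIdeal (k : Type*) [Field k] (A : Type*) [Ring A] [Algebra k⟦X⟧ A] (N : ℕ) : Ideal A :=
  Ideal.span {algebraMap k⟦X⟧ A (PowerSeries.X ^ N)}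

theorem mem_hIdeal {k : Type*} [Field k] {A : Type*} [Ring A] [Algebra k⟦X⟧ A] {N : ℕ} {x : A} :
    x ∈ hIdeal k A N ↔ ∃ y : A, x = (PowerSeries.X ^ N : k⟦X⟧) • y := by
  rw [hIdeal, Ideal.mem_span_singleton']
  constructor
  · rintro ⟨a, rfl⟩
    exact ⟨a, by rw [Algebra.smul_def, Algebra.commutes]⟩
  · rintro ⟨y, rfl⟩
    exact ⟨y, by rw [Algebra.smul_def, Algebra.commutes]⟩

instance hIdeal_isTwoSided (k : Type*) [Field k] (A : Type*) [Ring A] [Algebra k⟦X⟧ A] (N : ℕ) :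
    (hIdeal k A N).IsTwoSided where
  mul_mem_of_left b ha := by
    obtain ⟨y, rfl⟩ := mem_hIdeal.1 ha
    exact mem_hIdeal.2 ⟨y * b, by rw [smul_mul_assoc]⟩

theorem hIdeal_succ_le (k : Type*) [Field k] (A : Type*) [Ring A] [Algebra k⟦X⟧ A] (N : ℕ) :
    hIdeal k A (N + 1) ≤ hIdeal k A N := by
  intro x hx
  obtain ⟨y, rfl⟩ := mem_hIdeal.1 hx
  exact mem_hIdeal.2 ⟨(PowerSeries.X : k⟦X⟧) • y, by rw [pow_succ, mul_smul]⟩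

/-! ### The free `ħ`-adically complete algebra on the generators of `U_ħ(gl_3)` -/

/-- The generators `f_i`, `ℓ_j`, `e_i` (indices shifted to start from `0`). -/
inductive Gen : Type
  | f (i : Fin 2)
  | l (j : Fin 3)
  | e (i : Fin 2)

/-- `k⟨f_i, ℓ_j, e_i⟩[[ħ]]`, the `ħ`-adic completion of the free `k[[ħ]]`-algebra. -/
def FreeTop (k : Type u) [Field k] : Type u := PowerSeries (FreeAlgebra k Gen)

instance (k : Type u) [Field k] : Ring (FreeTop k) :=
  inferInstanceAs (Ring (PowerSeries (FreeAlgebra k Gen)))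

/-- `k[[ħ]]` acts coefficientwise. -/
instance (k : Type u) [Field k] : Algebra k⟦X⟧ (FreeTop k) :=
  RingHom.toAlgebra' (PowerSeries.map (algebraMap k (FreeAlgebra k Gen))) (by
    intro c x
    change (PowerSeries.map (algebraMap k (FreeAlgebra k Gen)) c) *
        (show PowerSeries (FreeAlgebra k Gen) from x) =
      (show PowerSeries (FreeAlgebra k Gen) from x) *
        (PowerSeries.map (algebraMap k (FreeAlgebra k Gen)) c)
    ext n
    rw [PowerSeries.coeff_mul, PowerSeries.coeff_mul,
      ← Finset.Nat.sum_antidiagonal_swap (n := n)]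
    refine Finset.sum_congr rfl fun p _ => ?_
    rw [PowerSeries.coeff_map]
    exact Algebra.commutes _ _)

/-- An element of the free algebra, seen as a constant series. -/
def FreeTop.const {k : Type u} [Field k] (a : FreeAlgebra k Gen) : FreeTop k :=
  (PowerSeries.C a : PowerSeries (FreeAlgebra k Gen))

/-- `q^a = exp(ħ a) = ∑ ħ^n a^n / n!`. -/
def FreeTop.expH {k : Type u} [Field k] (a : FreeAlgebra k Gen) : FreeTop k :=
  (PowerSeries.mk fun n => ((n.factorial : k)⁻¹) • a ^ n : PowerSeries (FreeAlgebra k Gen))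

/-- `q = exp(ħ)`. -/
def q (k : Type*) [Field k] [CharZero k] : k⟦X⟧ := PowerSeries.exp k

/-- `q - q⁻¹`. -/
def qd (k : Type*) [Field k] [CharZero k] : k⟦X⟧ := q k - (q k)⁻¹

/-- Division by `ħ` (dropping the constant term). -/
def divH {A : Type*} [Semiring A] (p : PowerSeries A) : PowerSeries A :=
  PowerSeries.mk fun n => PowerSeries.coeff (n + 1) p

/-- `(q^a - q^{-a}) / (q - q⁻¹)`, numerator and denominator both divided by `ħ` first. -/
def FreeTop.qnum {k : Type u} [Field k] [CharZero k] (a : FreeAlgebra k Gen) : FreeTop k :=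
  (divH (qd k))⁻¹ • (show FreeTop k from
    divH (A := FreeAlgebra k Gen) (FreeTop.expH a - FreeTop.expH (-a)))

theorem X_mul_divH {A : Type*} [Ring A] (p : PowerSeries A)
    (hp : PowerSeries.constantCoeff p = 0) : PowerSeries.X * divH p = p := by
  ext n
  cases n with
  | zero => simp [hp]
  | succ n => simp [divH, PowerSeries.coeff_succ_X_mul]

theorem q_mul_inv (k : Type*) [Field k] [CharZero k] : q k * (q k)⁻¹ = 1 :=
  PowerSeries.mul_inv_cancel _ (by simp [q])

/-- `qnum a` is the quotient of `q^a - q^{-a}` by `q - q⁻¹`. -/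
theorem qd_smul_qnum {k : Type u} [Field k] [CharZero k] (a : FreeAlgebra k Gen) :
    qd k • FreeTop.qnum a = FreeTop.expH a - FreeTop.expH (-a) := by
  have hinv : (q k)⁻¹ = PowerSeries.evalNegHom (PowerSeries.exp k) := by
    have h := PowerSeries.exp_mul_exp_neg_eq_one (A := k)
    rw [PowerSeries.inv_eq_iff_mul_eq_one (by simp [q]), mul_comm]
    exact h
  have h0 : PowerSeries.constantCoeff (qd k) = 0 := by
    simp [qd, q]
  have h1 : PowerSeries.constantCoeff (divH (qd k)) ≠ 0 := by
    rw [← PowerSeries.coeff_zero_eq_constantCoeff_apply]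
    rw [divH, PowerSeries.coeff_mk, qd, hinv, map_sub, q]
    simp [PowerSeries.evalNegHom, PowerSeries.coeff_exp]
  have h2 : qd k = PowerSeries.X * divH (qd k) := (X_mul_divH _ h0).symm
  have h3 : qd k * (divH (qd k))⁻¹ = PowerSeries.X := by
    calc qd k * (divH (qd k))⁻¹ = PowerSeries.X * (divH (qd k) * (divH (qd k))⁻¹) := by
          rw [← mul_assoc, ← h2]
      _ = PowerSeries.X := by rw [PowerSeries.mul_inv_cancel _ h1, mul_one]
  rw [FreeTop.qnum, smul_smul, h3, Algebra.smul_def]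
  change PowerSeries.map (algebraMap k (FreeAlgebra k Gen)) PowerSeries.X *
    divH (A := FreeAlgebra k Gen) _ = _
  rw [PowerSeries.map_X]
  refine X_mul_divH (A := FreeAlgebra k Gen) _ ?_
  change PowerSeries.constantCoeff ((show PowerSeries (FreeAlgebra k Gen) from FreeTop.expH a) -
    (show PowerSeries (FreeAlgebra k Gen) from FreeTop.expH (-a))) = 0
  rw [map_sub, ← PowerSeries.coeff_zero_eq_constantCoeff_apply,
    ← PowerSeries.coeff_zero_eq_constantCoeff_apply]
  simp [FreeTop.expH]

section Relations

variable (k : Type u) [Field k] [CharZero k]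

/-- `ℓ_i - ℓ_{i+1}` in the free algebra. -/
def hFree (i : Fin 2) : FreeAlgebra k Gen :=
  FreeAlgebra.ι k (Gen.l i.castSucc) - FreeAlgebra.ι k (Gen.l i.succ)

/-- The generators in the free complete algebra. -/
def fT (i : Fin 2) : FreeTop k := FreeTop.const (FreeAlgebra.ι k (Gen.f i))
def lT (j : Fin 3) : FreeTop k := FreeTop.const (FreeAlgebra.ι k (Gen.l j))
def eT (i : Fin 2) : FreeTop k := FreeTop.const (FreeAlgebra.ι k (Gen.e i))

/-- Kronecker delta. -/
def kron {ι : Type*} [DecidableEq ι] (i j : ι) : k⟦X⟧ := if i = j then 1 else 0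

/-- The defining relations of `U_ħ(gl_3)`: each element `x` with `Relator x` is to vanish. -/
inductive Relator : FreeTop k → Prop
  | l_f (i : Fin 2) (j : Fin 3) : Relator
      (lT k j * fT k i - fT k i * lT k j - (kron k i.succ j - kron k i.castSucc j) • fT k i)
  | l_l (i j : Fin 3) : Relator (lT k i * lT k j - lT k j * lT k i)
  | l_e (i : Fin 2) (j : Fin 3) : Relator
      (lT k j * eT k i - eT k i * lT k j - (kron k i.castSucc j - kron k i.succ j) • eT k i)
  | e_f (i j : Fin 2) : Relator
      (eT k i * fT k j - fT k j * eT k i - kron k i j • FreeTop.qnum (hFree k i))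
  | serre_e (i j : Fin 2) (hij : i ≠ j) : Relator
      (eT k i ^ 2 * eT k j - (q k + (q k)⁻¹) • (eT k i * eT k j * eT k i) + eT k j * eT k i ^ 2)
  | serre_f (i j : Fin 2) (hij : i ≠ j) : Relator
      (fT k i ^ 2 * fT k j - (q k + (q k)⁻¹) • (fT k i * fT k j * fT k i) + fT k j * fT k i ^ 2)

/-- The smallest `ħ`-adically closed two-sided ideal containing the relations. -/
def relIdeal : TwoSidedIdeal (FreeTop k) :=
  sInf {I | (∀ x, Relator k x → x ∈ I) ∧ IsHClosed (k := k) (I : Set (FreeTop k))}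

/-- `U_ħ(gl_3)`. -/
def Ugl : Type u := FreeTop k ⧸ (relIdeal k).asIdeal

instance : Ring (Ugl k) := inferInstanceAs (Ring (FreeTop k ⧸ (relIdeal k).asIdeal))

instance : Algebra k⟦X⟧ (Ugl k) :=
  inferInstanceAs (Algebra k⟦X⟧ (FreeTop k ⧸ (relIdeal k).asIdeal))

/-- The projection onto `U_ħ(gl_3)`. -/
def Ugl.proj : FreeTop k →ₐ[k⟦X⟧] Ugl k :=
  Ideal.Quotient.mkₐ k⟦X⟧ (relIdeal k).asIdeal

/-! ### Elements of `U_ħ(gl_3)` -/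

/-- `f_{i+1}` (the index `i` starts from `0`). -/
def f (i : Fin 2) : Ugl k := Ugl.proj k (fT k i)

/-- `ℓ_{j+1}`. -/
def l (j : Fin 3) : Ugl k := Ugl.proj k (lT k j)

/-- `e_{i+1}`. -/
def e (i : Fin 2) : Ugl k := Ugl.proj k (eT k i)

/-- `h_i = ℓ_i - ℓ_{i+1}`. -/
def h (i : Fin 2) : Ugl k := l k i.castSucc - l k i.succ

/-- `t_i = q^{h_i}`. -/
def t (i : Fin 2) : Ugl k := Ugl.proj k (FreeTop.expH (hFree k i))

/-- `t_i⁻¹ = q^{-h_i}`. -/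
def tinv (i : Fin 2) : Ugl k := Ugl.proj k (FreeTop.expH (-hFree k i))

/-- `g_j = q^{ℓ_j}`. -/
def g (j : Fin 3) : Ugl k := Ugl.proj k (FreeTop.expH (FreeAlgebra.ι k (Gen.l j)))

/-- `g_j⁻¹ = q^{-ℓ_j}`. -/
def ginv (j : Fin 3) : Ugl k := Ugl.proj k (FreeTop.expH (-FreeAlgebra.ι k (Gen.l j)))

/-- The quantum root vector `E_{1,3} = [E_{1,2}, E_{2,3}]_q`, with `E_{i,i+1} = e_i`. -/
def E13 : Ugl k := e k 0 * e k 1 - q k • (e k 1 * e k 0)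

/-- The quantum root vector `F_{3,1} = [F_{3,2}, F_{2,1}]_{q⁻¹}`, with `F_{i+1,i} = f_i`. -/
def F31 : Ugl k := f k 1 * f k 0 - (q k)⁻¹ • (f k 0 * f k 1)

/-- The rescaled `L`-operators `L̂⁺_{i,j} = (q - q⁻¹)⁻¹ L⁺_{i,j} = g_i F_{j,i}`, `i < j`. -/
def LP12 : Ugl k := g k 0 * f k 0
def LP23 : Ugl k := g k 1 * f k 1
def LP13 : Ugl k := g k 0 * F31 k

/-- The rescaled `L`-operators `L̂⁻_{i,j} = (q - q⁻¹)⁻¹ L⁻_{i,j} = - E_{j,i} g_j⁻¹`, `i > j`. -/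
def LM21 : Ugl k := -(e k 0 * ginv k 0)
def LM32 : Ugl k := -(e k 1 * ginv k 1)
def LM31 : Ugl k := -(E13 k * ginv k 0)

/-- The entries `K_{i,j} = ∑_{i ≤ s ≤ j} q^{3-s} (q - q⁻¹)⁻¹ L⁻_{s,i} L⁺_{s,j}`, `i < j`, of the
matrix `(q - q⁻¹)⁻¹ (L⁻)ᵗ J L⁺`, `J = diag(q², q, 1)`, where `L^±_{i,i} = g_i^{±1}`. -/
def K12 : Ugl k := q k ^ 2 • (ginv k 0 * LP12 k) + q k • (LM21 k * g k 1)
def K23 : Ugl k := q k • (ginv k 1 * LP23 k) + LM32 k * g k 2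
def K13 : Ugl k :=
  q k ^ 2 • (ginv k 0 * LP13 k) + (q k * qd k) • (LM21 k * LP23 k) + LM31 k * g k 2

/-- The generators `k_{1,2}`, `k_{2,3}`, `k_{1,3}`. -/
def k12 : Ugl k := ((q k)⁻¹ ^ 2 * qd k) • K12 k
def k23 : Ugl k := ((q k)⁻¹ * qd k) • K23 k
def k13 : Ugl k := ((q k)⁻¹ ^ 2 * qd k) • K13 k

/-- The ordered monomial `k_{1,2}^a k_{1,3}^b k_{2,3}^c`. -/
def monomial (p : ℕ × ℕ × ℕ) : Ugl k := k12 k ^ p.1 * k13 k ^ p.2.1 * k23 k ^ p.2.2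

/-! ### The subalgebras `U_ħ(sl_3)` and `U_ħ(so_3)` -/

/-- The closed `k[[ħ]]`-subalgebra generated by a subset. -/
def closedAdjoin (S : Set (Ugl k)) : Subalgebra k⟦X⟧ (Ugl k) :=
  sInf {B | S ⊆ (B : Set (Ugl k)) ∧ IsHClosed (k := k) (B : Set (Ugl k))}

/-- `U_ħ(sl_3)`. -/
def Usl : Subalgebra k⟦X⟧ (Ugl k) :=
  closedAdjoin k (Set.range (f k) ∪ Set.range (h k) ∪ Set.range (e k))

/-- `U_ħ(so_3)`, generated by the entries of `K`; the diagonal entries are scalars. -/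
def Uso : Subalgebra k⟦X⟧ (Ugl k) := closedAdjoin k {K12 k, K23 k, K13 k}

/-! ### Coproduct, counit and completed tensor powers

Since `(U / ħ^N U)^{⊗ n} = U^{⊗ n} / ħ^N U^{⊗ n}`, the `ħ`-adically completed tensor power of
`U = U_ħ(gl_3)` is the inverse limit over `N` of the tensor powers of `U / ħ^N U`. Elements of
completed tensor powers and maps between them are given by their components at all levels `N`. -/

/-- `U / ħ^N U` for `U = U_ħ(gl_3)`. -/
abbrev UglMod (N : ℕ) : Type u := Ugl k ⧸ hIdeal k (Ugl k) N

/-- Reduction modulo `ħ^N`. -/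
def red (N : ℕ) : Ugl k →ₐ[k⟦X⟧] UglMod k N := Ideal.Quotient.mkₐ k⟦X⟧ (hIdeal k (Ugl k) N)

/-- The transition map from `U / ħ^(N+1) U` to `U / ħ^N U`. -/
def trans (N : ℕ) : UglMod k (N + 1) →ₐ[k⟦X⟧] UglMod k N :=
  Ideal.Quotient.factorₐ k⟦X⟧ (hIdeal_succ_le k (Ugl k) N)

/-- An algebra homomorphism from `U` to the completed tensor square of `U`
and one from `U` to `k[[ħ]]` with the prescribed values of the coproduct and of the counit on the
generators. -/
structure CoproductCounit where
  comul (N : ℕ) : UglMod k N →ₐ[k⟦X⟧] UglMod k N ⊗[k⟦X⟧] UglMod k N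
  comul_trans (N : ℕ) (x : UglMod k (N + 1)) :
    Algebra.TensorProduct.map (trans k N) (trans k N) (comul (N + 1) x) = comul N (trans k N x)
  comul_f (N : ℕ) (i : Fin 2) : comul N (red k N (f k i)) =
    red k N (f k i) ⊗ₜ red k N (tinv k i) + 1 ⊗ₜ red k N (f k i)
  comul_l (N : ℕ) (j : Fin 3) : comul N (red k N (l k j)) =
    red k N (l k j) ⊗ₜ 1 + 1 ⊗ₜ red k N (l k j)
  comul_e (N : ℕ) (i : Fin 2) : comul N (red k N (e k i)) =
    red k N (e k i) ⊗ₜ 1 + red k N (t k i) ⊗ₜ red k N (e k i)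
  counit : Ugl k →ₐ[k⟦X⟧] k⟦X⟧
  counit_f (i : Fin 2) : counit (f k i) = 0
  counit_l (j : Fin 3) : counit (l k j) = 0
  counit_e (i : Fin 2) : counit (e k i) = 0

/-- The `n`-th tensor power of `U / ħ^N U`. -/
def TPow (N : ℕ) : ℕ → ModuleCat.{u} k⟦X⟧
  | 0 => ModuleCat.of k⟦X⟧ k⟦X⟧
  | n + 1 => ModuleCat.of k⟦X⟧ (UglMod k N ⊗[k⟦X⟧] TPow N n)

variable {k}

/-- `x ↦ ε(x) 1` on `U / ħ^N U`. -/
def CoproductCounit.unitCounit (H : CoproductCounit k) (N : ℕ) :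
    UglMod k N →ₐ[k⟦X⟧] UglMod k N :=
  Ideal.Quotient.liftₐ (hIdeal k (Ugl k) N) ((Algebra.ofId k⟦X⟧ (UglMod k N)).comp H.counit) (by
    intro a ha
    obtain ⟨y, rfl⟩ := mem_hIdeal.1 ha
    have hz : (PowerSeries.X ^ N : k⟦X⟧) • (1 : UglMod k N) = 0 := by
      have h1 : red k N ((PowerSeries.X ^ N : k⟦X⟧) • (1 : Ugl k)) = 0 :=
        Ideal.Quotient.eq_zero_iff_mem.2 (mem_hIdeal.2 ⟨1, rfl⟩)
      rwa [map_smul, map_one] at h1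
    rw [map_smul, AlgHom.comp_apply, Algebra.ofId_apply, Algebra.algebraMap_eq_smul_one,
      smul_comm, hz, smul_zero])

/-- The iterated coproduct with `n + 1` tensor factors. -/
def CoproductCounit.iter (H : CoproductCounit k) (N : ℕ) :
    (n : ℕ) → UglMod k N →ₗ[k⟦X⟧] TPow k N (n + 1)
  | 0 => (TensorProduct.rid k⟦X⟧ (UglMod k N)).symm.toLinearMap
  | n + 1 => (TensorProduct.map LinearMap.id (H.iter N n)) ∘ₗ (H.comul N).toLinearMap

/-- `(id - ε)^{⊗ n}`. -/
def CoproductCounit.augPow (H : CoproductCounit k) (N : ℕ) :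
    (n : ℕ) → TPow k N n →ₗ[k⟦X⟧] TPow k N n
  | 0 => LinearMap.id
  | n + 1 => TensorProduct.map (LinearMap.id - (H.unitCounit N).toLinearMap) (H.augPow N n)

/-- `δ_{n+1} = (id - ε)^{⊗ (n+1)} ∘ Δ^{n+1}`, modulo `ħ^N`. -/
def CoproductCounit.delta (H : CoproductCounit k) (N n : ℕ) :
    UglMod k N →ₗ[k⟦X⟧] TPow k N (n + 1) :=
  H.augPow N (n + 1) ∘ₗ H.iter N n

variable (k)

/-- The image of a submodule of `U` in `U / ħ^N U`. -/
def redSub (N : ℕ) (C : Submodule k⟦X⟧ (Ugl k)) : Submodule k⟦X⟧ (UglMod k N) :=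
  C.map (red k N).toLinearMap

/-- The image of `U_ħ(sl_3)^{⊗ n}` in the `n`-th tensor power of `U / ħ^N U`. -/
def slPow (N : ℕ) : (n : ℕ) → Submodule k⟦X⟧ (TPow k N n)
  | 0 => ⊤
  | n + 1 => Submodule.map₂ (TensorProduct.mk k⟦X⟧ (UglMod k N) (TPow k N n))
      (redSub k N (Usl k).toSubmodule) (slPow N n)

/-- The image of `C ⊗ U_ħ(sl_3)^{⊗ n}` in the `(n+1)`-st tensor power of `U / ħ^N U`. -/
def tensorSl (N n : ℕ) (C : Submodule k⟦X⟧ (Ugl k)) : Submodule k⟦X⟧ (TPow k N (n + 1)) :=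
  Submodule.map₂ (TensorProduct.mk k⟦X⟧ (UglMod k N) (TPow k N n)) (redSub k N C) (slPow k N n)

variable {k}

/-- `C^↰ = {x ∈ C | δ_n(x) ∈ ħ^n C ⊗̂ U_ħ(sl_3)^{⊗̂ (n-1)} for all n ≥ 1}` for a subalgebra
(right coideal) `C` of `U_ħ(sl_3)`. -/
def CoproductCounit.harpoon (H : CoproductCounit k) (C : Subalgebra k⟦X⟧ (Ugl k)) :
    Submodule k⟦X⟧ (Ugl k) :=
  C.toSubmodule ⊓ ⨅ (n : ℕ) (N : ℕ),
    ((tensorSl k N n C.toSubmodule).map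
      (LinearMap.lsmul k⟦X⟧ (TPow k N (n + 1)) (PowerSeries.X ^ (n + 1)))).comap
        (H.delta N n ∘ₗ (red k N).toLinearMap)

/-- Drinfeld's `U_ħ(sl_3)' = {x | δ_n(x) ∈ ħ^n U_ħ(sl_3)^{⊗̂ n} for all n}`. -/
def CoproductCounit.slPrime (H : CoproductCounit k) : Submodule k⟦X⟧ (Ugl k) :=
  H.harpoon (Usl k)

end Relations

/-! ### The presented algebra -/

section Presentation

variable (k : Type u) [Field k] [CharZero k]

/-- Names of the three generators. -/
inductive StokesGen : Type
  | x12
  | x23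
  | x13

/-- The three `q`-commutation relations. -/
inductive StokesRel : FreeAlgebra k⟦X⟧ StokesGen → FreeAlgebra k⟦X⟧ StokesGen → Prop
  | r1 : StokesRel
      (FreeAlgebra.ι k⟦X⟧ .x12 * FreeAlgebra.ι k⟦X⟧ .x23)
      (q k • (FreeAlgebra.ι k⟦X⟧ .x23 * FreeAlgebra.ι k⟦X⟧ .x12)
        - (q k * qd k) • FreeAlgebra.ι k⟦X⟧ .x13)
  | r2 : StokesRel
      (FreeAlgebra.ι k⟦X⟧ .x23 * FreeAlgebra.ι k⟦X⟧ .x13)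
      (q k • (FreeAlgebra.ι k⟦X⟧ .x13 * FreeAlgebra.ι k⟦X⟧ .x23)
        - qd k • FreeAlgebra.ι k⟦X⟧ .x12)
  | r3 : StokesRel
      (FreeAlgebra.ι k⟦X⟧ .x13 * FreeAlgebra.ι k⟦X⟧ .x12)
      (q k • (FreeAlgebra.ι k⟦X⟧ .x12 * FreeAlgebra.ι k⟦X⟧ .x13)
        - qd k • FreeAlgebra.ι k⟦X⟧ .x23)

/-- The `k[[ħ]]`-algebra with three generators and the three relations. -/
def StokesAlg : Type u := RingQuot (StokesRel k)

instance : Ring (StokesAlg k) := inferInstanceAs (Ring (RingQuot (StokesRel k)))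

instance : Algebra k⟦X⟧ (StokesAlg k) := inferInstanceAs (Algebra k⟦X⟧ (RingQuot (StokesRel k)))

/-- The generators of the presented algebra. -/
def StokesAlg.gen (s : StokesGen) : StokesAlg k :=
  RingQuot.mkAlgHom k⟦X⟧ (StokesRel k) (FreeAlgebra.ι k⟦X⟧ s)

/-- The two-sided ideal generated by `ħ` and the three generators. -/
def StokesAlg.ideal : Ideal (StokesAlg k) :=
  (TwoSidedIdeal.span ({algebraMap k⟦X⟧ (StokesAlg k) PowerSeries.X} ∪
    Set.range (StokesAlg.gen k))).asIdeal

instance : (StokesAlg.ideal k).IsTwoSided :=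
  inferInstanceAs (TwoSidedIdeal.asIdeal _).IsTwoSided

/-- The completion of the presented algebra with respect to the powers of the ideal generated by
`ħ` and the three generators, realized as an inverse limit. -/
def StokesCompl : Subalgebra k⟦X⟧ (∀ m : ℕ, StokesAlg k ⧸ StokesAlg.ideal k ^ m) :=
  ⨅ m : ℕ, AlgHom.equalizer
    ((Ideal.Quotient.factorₐ k⟦X⟧ (Ideal.pow_le_pow_right (I := StokesAlg.ideal k) m.le_succ)).comp
      (Pi.evalAlgHom k⟦X⟧ (fun m : ℕ => StokesAlg k ⧸ StokesAlg.ideal k ^ m) (m + 1)))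
    (Pi.evalAlgHom k⟦X⟧ (fun m : ℕ => StokesAlg k ⧸ StokesAlg.ideal k ^ m) m)

/-- The generators of the completed algebra. -/
def StokesCompl.gen (s : StokesGen) : StokesCompl k :=
  ⟨fun _ => Ideal.Quotient.mk _ (StokesAlg.gen k s), by
    simp only [StokesCompl, Algebra.mem_iInf]
    intro m
    rfl⟩

end Presentation

/-! ### The Dubrovin–Ugaglia bracket -/

section Poisson

variable {k : Type u} [Field k]

/-- The algebra `k[[x, y, z]]` of formal functions on Stokes matrices `[1 x y; 0 1 z; 0 0 1]`,
with coordinates `x`, `y`, `z` numbered `0`, `1`, `2`, and its bracket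
`{x, y} = xy - 2z`, `{y, z} = yz - 2x`, `{z, x} = zx - 2y`. -/
def stokesBracket (a b : MvPowerSeries (Fin 3) k) : MvPowerSeries (Fin 3) k :=
  let x : MvPowerSeries (Fin 3) k := MvPowerSeries.X 0
  let y : MvPowerSeries (Fin 3) k := MvPowerSeries.X 1
  let z : MvPowerSeries (Fin 3) k := MvPowerSeries.X 2
  let d := fun (i : Fin 3) (c : MvPowerSeries (Fin 3) k) => MvPowerSeries.pderiv k i c
  (x * y - 2 * z) * (d 0 a * d 1 b - d 1 a * d 0 b)
    + (y * z - 2 * x) * (d 1 a * d 2 b - d 2 a * d 1 b)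
    + (z * x - 2 * y) * (d 2 a * d 0 b - d 0 a * d 2 b)

end Poisson

end QuantumStokes

end

open QuantumStokes

/-!
# Quantized functions on Stokes matrices inside the coideal subalgebra `U_ħ(so_3)`

Write `y12`, `y13`, `y23` for `ħ⁻¹ k_{1,2}`, `ħ⁻¹ k_{1,3}`, `ħ⁻¹ k_{2,3}`. Up to units these are
`f_1 - q t_1⁻¹ e_1`, their `q`-commutator with `f_2 - q t_2⁻¹ e_2`, and `f_2 - q t_2⁻¹ e_2`. The
quadratic relations among them are the definition of a `q`-commutator together with two Serre
relations with linear right-hand sides (`so_serre_12`, `so_serre_23`). Hence the ordered monomials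
in them span a subalgebra, and its closure is `U_ħ(so_3)` (`exists_sum_yMon`). All identities in
`U_ħ(gl_3)` are checked modulo every `ħ^N`, where homomorphisms out of the algebra, such as the
coproduct and the vector representation, are given by elements satisfying the defining relations
(`IsGLTriple`). No basis of `U_ħ(gl_3)` is needed.

The closed subalgebra generated by the `k_{i,j}` satisfies the divisibility conditions that define
`U_ħ(so_3)^↰`: together with `1`, the `k_{i,j}` span a right coideal over the subalgebra `slLattice`
generated by `t_i^{±1}`, `ħ e_i`, `ħ f_i` and `k_{1,3}`, and all elements involved are scalars
modulo `ħ`, so each of the `n` projections `id - ε` contributes a factor `ħ`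
(`CoproductCounit.le_harpoon`). The same argument puts `slLattice` inside `U_ħ(sl_3)'`, which gives
the right coideal property.

Conversely, the entries below the diagonal of the vector representation are functionals that vanish
at `1` and, at `ħ = 0`, pair with `y12`, `y13`, `y23` by twice the identity matrix. Since these
elements are primitive modulo `ħ`, the convolution product of such functionals along a word counts
the ways to match the letters of the word with those of an ordered monomial whose degree does not
exceed the length of the word (`comul_ordMon`, `convFun_ordMon`). This has two consequences. A
combination of ordered monomials in the `y_{i,j}` is divisible by `ħ^r` only if its coefficients are
(`X_pow_dvd_of_sum_yMon`). And a convolution product of length `n` factors through `δ_n`, so its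
values on an element satisfying the divisibility conditions are divisible by `ħ^n`; therefore a
monomial of degree `n` can only occur with a coefficient divisible by `ħ^n`
(`constantCoeff_eq_zero_of_harpoon`). Thus `U_ħ(so_3)^↰` consists of the convergent sums of ordered
monomials in the `k_{i,j} = ħ y_{i,j}`, with unique coefficients
(`stokesClosure_toSubmodule`, `monomialEquiv`).

The presentation holds because in the presented algebra, too, the ordered monomials span, and
independence identifies `I^m` with the preimage of `ħ^m U_ħ(gl_3)` (`StokesAlg.mem_pow_iff`). The
specialization at `ħ = 0` takes the constant coefficients of the expansion. It is multiplicative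
because it is so on the presented algebra, whose generators commute at `ħ = 0`, and both sides are
continuous (`symbolFun_mul`); the bracket of the symbols is found on generators from the relations
and extends by the Leibniz rule and continuity (`symbol_commutatorDiv`).
-/


noncomputable section

namespace QuantumStokes

universe u

/-! ### Exponential series over a `k[[ħ]]`-algebra and their evaluation at `ħ` -/

section Series

variable (k : Type u) [Field k] {B : Type*} [Ring B] [Algebra k⟦X⟧ B]

/-- The formal exponential `∑ T^n b^n / n!` in `B[[T]]`. The variable `T` of the series is kept
apart from `ħ ∈ k[[ħ]]`, so that `T` is not a zero divisor whatever `B` is. -/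
def formalExp (b : B) : PowerSeries B :=
  PowerSeries.mk fun n => (PowerSeries.C ((n.factorial : k)⁻¹) : k⟦X⟧) • b ^ n

/-- The series `(exp(T b) - exp(-T b)) / T` in `B[[T]]`. -/
def formalDiff (b : B) : PowerSeries B := divH (formalExp k b - formalExp k (-b))

theorem X_mul_formalDiff (b : B) :
    PowerSeries.X * formalDiff k b = formalExp k b - formalExp k (-b) :=
  X_mul_divH _ (by
    rw [map_sub, ← PowerSeries.coeff_zero_eq_constantCoeff_apply,
      ← PowerSeries.coeff_zero_eq_constantCoeff_apply]
    simp [formalExp])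

theorem formalExp_zero : formalExp k (0 : B) = 1 := by
  ext n
  rcases n with _ | n <;> simp [formalExp, PowerSeries.coeff_one]

theorem formalExp_add [CharZero k] {a b : B} (hab : Commute a b) :
    formalExp k (a + b) = formalExp k a * formalExp k b := by
  ext n
  rw [PowerSeries.coeff_mul]
  simp only [formalExp, PowerSeries.coeff_mk]
  rw [hab.add_pow', Finset.smul_sum]
  refine Finset.sum_congr rfl fun p hp => ?_
  rw [smul_mul_smul_comm, ← map_mul, ← Nat.cast_smul_eq_nsmul k⟦X⟧, smul_smul]
  congr 1
  rw [← map_natCast (PowerSeries.C (R := k)), ← map_mul]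
  congr 1
  rw [← Finset.HasAntidiagonal.mem_antidiagonal.1 hp, Nat.cast_add_choose]
  have h1 : ((p.1 + p.2).factorial : k) ≠ 0 := Nat.cast_ne_zero.2 (Nat.factorial_ne_zero _)
  field_simp

theorem formalDiff_add [CharZero k] {a b : B} (hab : Commute a b) :
    formalDiff k (a + b) = formalDiff k a * formalExp k (-b) + formalExp k a * formalDiff k b := by
  apply PowerSeries.X_mul_cancel
  have e1 : formalExp k (-(a + b)) = formalExp k (-a) * formalExp k (-b) := by
    rw [neg_add, formalExp_add k (hab.neg_left.neg_right)]
  have e2 : PowerSeries.X * (formalExp k a * formalDiff k b) =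
      formalExp k a * (PowerSeries.X * formalDiff k b) := by
    rw [← mul_assoc, ← (PowerSeries.commute_X _).eq, mul_assoc]
  rw [mul_add, ← mul_assoc, X_mul_formalDiff, e2, X_mul_formalDiff, X_mul_formalDiff,
    formalExp_add k hab, e1]
  noncomm_ring

theorem formalExp_semiconj {a b x : B} (h : a * x = x * b) :
    formalExp k a * PowerSeries.C x = PowerSeries.C x * formalExp k b := by
  have h' : ∀ n, a ^ n * x = x * b ^ n := fun n => by
    have : SemiconjBy x b a := h.symm
    exact (this.pow_right n).eq.symm
  ext n
  simp [formalExp, h']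

theorem formalDiff_semiconj {a b x : B} (h : a * x = x * b) :
    formalDiff k a * PowerSeries.C x = PowerSeries.C x * formalDiff k b := by
  apply PowerSeries.X_mul_cancel
  have h2 : -a * x = x * -b := by rw [neg_mul, mul_neg, h]
  rw [← mul_assoc, X_mul_formalDiff, ← mul_assoc, PowerSeries.X_mul, mul_assoc, X_mul_formalDiff,
    sub_mul, mul_sub, formalExp_semiconj k h, formalExp_semiconj k h2]

/-- `∑_{n < N} ħ^n b_n`, the value at `ħ` of the series `∑ T^n b_n` when `ħ^N` kills `B`. -/
def seriesEvalAux (N : ℕ) (p : PowerSeries B) : B :=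
  ∑ n ∈ Finset.range N, (PowerSeries.X ^ n : k⟦X⟧) • PowerSeries.coeff n p

variable {k} in
theorem X_pow_smul_eq_zero {N : ℕ} (hB : (PowerSeries.X ^ N : k⟦X⟧) • (1 : B) = 0) {n : ℕ}
    (hn : N ≤ n) (b : B) : (PowerSeries.X ^ n : k⟦X⟧) • b = 0 := by
  obtain ⟨m, rfl⟩ := Nat.exists_eq_add_of_le hn
  rw [← one_mul b, add_comm, pow_add, mul_smul, ← smul_mul_assoc, hB, zero_mul, smul_zero]

variable {k} in
theorem seriesEvalAux_mul {N : ℕ} (hB : (PowerSeries.X ^ N : k⟦X⟧) • (1 : B) = 0)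
    (p p' : PowerSeries B) :
    seriesEvalAux k N (p * p') = seriesEvalAux k N p * seriesEvalAux k N p' := by
  unfold seriesEvalAux
  rw [Finset.sum_mul_sum, ← Finset.sum_product']
  have h1 : ∀ n ∈ Finset.range N,
      (PowerSeries.X ^ n : k⟦X⟧) • PowerSeries.coeff n (p * p') =
        ∑ x ∈ (Finset.range N ×ˢ Finset.range N) with x.1 + x.2 = n,
          ((PowerSeries.X ^ x.1 : k⟦X⟧) • PowerSeries.coeff x.1 p) *
            ((PowerSeries.X ^ x.2 : k⟦X⟧) • PowerSeries.coeff x.2 p') := by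
    intro n hn
    rw [PowerSeries.coeff_mul, Finset.smul_sum]
    have : (Finset.range N ×ˢ Finset.range N).filter (fun x : ℕ × ℕ => x.1 + x.2 = n) =
        Finset.HasAntidiagonal.antidiagonal n := by
      ext ⟨a, b⟩
      simp only [Finset.mem_filter, Finset.mem_product, Finset.mem_range,
        Finset.HasAntidiagonal.mem_antidiagonal] at hn ⊢
      omega
    rw [this]
    refine Finset.sum_congr rfl fun x hx => ?_
    rw [smul_mul_smul_comm, ← pow_add, Finset.HasAntidiagonal.mem_antidiagonal.1 hx]
  rw [Finset.sum_congr rfl h1, Finset.sum_fiberwise_eq_sum_filter, Finset.sum_filter]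
  refine Finset.sum_congr rfl fun x _ => ?_
  split_ifs with h
  · rfl
  · rw [smul_mul_smul_comm, ← pow_add, X_pow_smul_eq_zero hB (by simpa using h)]

variable {k} in
/-- Evaluation at `ħ` of series with coefficients in an algebra killed by `ħ^N`. -/
def seriesEval {N : ℕ} (hB : (PowerSeries.X ^ N : k⟦X⟧) • (1 : B) = 0) : PowerSeries B →+* B where
  toFun := seriesEvalAux k N
  map_one' := by
    unfold seriesEvalAux
    rcases N with _ | N
    · simpa using hB.symm
    · rw [Finset.sum_range_succ']
      simp [PowerSeries.coeff_one]
  map_mul' := seriesEvalAux_mul hB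
  map_zero' := by simp [seriesEvalAux]
  map_add' p p' := by simp [seriesEvalAux, Finset.sum_add_distrib]

variable {k} in
theorem seriesEval_apply {N : ℕ} (hB : (PowerSeries.X ^ N : k⟦X⟧) • (1 : B) = 0)
    (p : PowerSeries B) : seriesEval hB p =
      ∑ n ∈ Finset.range N, (PowerSeries.X ^ n : k⟦X⟧) • PowerSeries.coeff n p := rfl

variable {k} in
theorem seriesEval_C {N : ℕ} (hB : (PowerSeries.X ^ N : k⟦X⟧) • (1 : B) = 0) (b : B) :
    seriesEval hB (PowerSeries.C b) = b := by
  rw [seriesEval_apply]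
  rcases N with _ | N
  · simpa using (X_pow_smul_eq_zero hB le_rfl b).symm
  · rw [Finset.sum_range_succ']
    simp [PowerSeries.coeff_C]

variable {k} in
/-- A series whose coefficients are scalar multiples of `b` evaluates to a scalar multiple. -/
theorem seriesEval_scalar {N : ℕ} (hB : (PowerSeries.X ^ N : k⟦X⟧) • (1 : B) = 0)
    (c : k⟦X⟧) (b : B) :
    seriesEval hB (PowerSeries.mk fun n => PowerSeries.C (PowerSeries.coeff n c) • b) = c • b := by
  rw [seriesEval_apply]
  have h1 := PowerSeries.eq_X_pow_mul_shift_add_trunc N c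
  have h2 : (PowerSeries.trunc N c : k⟦X⟧) =
      ∑ n ∈ Finset.range N, PowerSeries.X ^ n * PowerSeries.C (PowerSeries.coeff n c) := by
    ext m
    simp [PowerSeries.coeff_trunc]
  conv_rhs => rw [h1, add_smul, mul_smul, X_pow_smul_eq_zero hB le_rfl, zero_add, h2,
    Finset.sum_smul]
  simp only [PowerSeries.coeff_mk, smul_smul]

/-- `q^b = exp(ħ b)` in an algebra killed by `ħ^N`. -/
def qpow (N : ℕ) (b : B) : B := seriesEvalAux k N (formalExp k b)

/-- `(q^b - q^{-b}) / ħ` in an algebra killed by `ħ^N`. -/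
def qdiff (N : ℕ) (b : B) : B := seriesEvalAux k N (formalDiff k b)

end Series

section QPow

variable {k : Type u} [Field k] {B : Type*} [Ring B] [Algebra k⟦X⟧ B] {N : ℕ}

theorem qpow_map {B' : Type*} [Ring B'] [Algebra k⟦X⟧ B'] (φ : B →ₐ[k⟦X⟧] B') (a : B) :
    φ (qpow k N a) = qpow k N (φ a) := by
  simp [qpow, seriesEvalAux, formalExp]

theorem qdiff_map {B' : Type*} [Ring B'] [Algebra k⟦X⟧ B'] (φ : B →ₐ[k⟦X⟧] B') (a : B) :
    φ (qdiff k N a) = qdiff k N (φ a) := by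
  simp [qdiff, seriesEvalAux, formalDiff, formalExp, divH]

variable (hB : (PowerSeries.X ^ N : k⟦X⟧) • (1 : B) = 0)
include hB

theorem qpow_zero : qpow k N (0 : B) = 1 := by
  change seriesEval hB _ = 1
  rw [formalExp_zero, map_one]

theorem qpow_add [CharZero k] {a b : B} (hab : Commute a b) :
    qpow k N (a + b) = qpow k N a * qpow k N b := by
  change seriesEval hB _ = seriesEval hB _ * seriesEval hB _
  rw [formalExp_add k hab, map_mul]

theorem qpow_mul_qpow_neg [CharZero k] (a : B) : qpow k N a * qpow k N (-a) = 1 := by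
  rw [← qpow_add hB (Commute.refl a).neg_right, add_neg_cancel, qpow_zero hB]

theorem qpow_neg_mul_qpow [CharZero k] (a : B) : qpow k N (-a) * qpow k N a = 1 := by
  rw [← qpow_add hB (Commute.refl a).neg_left, neg_add_cancel, qpow_zero hB]

theorem qpow_semiconj {a b x : B} (h : a * x = x * b) :
    qpow k N a * x = x * qpow k N b := by
  have := congrArg (seriesEval hB) (formalExp_semiconj k h)
  rwa [map_mul, map_mul, seriesEval_C] at this

theorem qdiff_semiconj {a b x : B} (h : a * x = x * b) :
    qdiff k N a * x = x * qdiff k N b := by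
  have := congrArg (seriesEval hB) (formalDiff_semiconj k h)
  rwa [map_mul, map_mul, seriesEval_C] at this

theorem qdiff_add [CharZero k] {a b : B} (hab : Commute a b) :
    qdiff k N (a + b) = qdiff k N a * qpow k N (-b) + qpow k N a * qdiff k N b := by
  have := congrArg (seriesEval hB) (formalDiff_add k hab)
  rwa [map_add, map_mul, map_mul] at this

end QPow

/-! ### Homomorphisms from `U_ħ(gl_3)` to algebras killed by a power of `ħ` -/

section Evaluation

variable {k : Type u} [Field k] {B : Type*} [Ring B] [Algebra k⟦X⟧ B]

/-- The ring homomorphism from the free `k`-algebra with given values on the generators. -/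
def freeHom (gen : Gen → B) : FreeAlgebra k Gen →+* B :=
  letI : Algebra k B := Algebra.compHom B (PowerSeries.C (R := k))
  (FreeAlgebra.lift k gen).toRingHom

theorem freeHom_ι (gen : Gen → B) (s : Gen) :
    freeHom (k := k) gen (FreeAlgebra.ι k s) = gen s := by
  let _ : Algebra k B := Algebra.compHom B (PowerSeries.C (R := k))
  exact FreeAlgebra.lift_ι_apply gen s

theorem freeHom_smul (gen : Gen → B) (c : k) (a : FreeAlgebra k Gen) :
    freeHom gen (c • a) = (PowerSeries.C c : k⟦X⟧) • freeHom gen a := by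
  let _ : Algebra k B := Algebra.compHom B (PowerSeries.C (R := k))
  exact map_smul (FreeAlgebra.lift k gen) c a

variable {N : ℕ} (hB : (PowerSeries.X ^ N : k⟦X⟧) • (1 : B) = 0)

theorem algebraMap_freeTop (c : k⟦X⟧) : (algebraMap k⟦X⟧ (FreeTop k) c) =
    (PowerSeries.map (algebraMap k (FreeAlgebra k Gen)) c : PowerSeries (FreeAlgebra k Gen)) := rfl

/-- The homomorphism from the free `ħ`-adically complete algebra with given values on the
generators, when `ħ^N` kills the target. -/
def freeTopHom (gen : Gen → B) : FreeTop k →ₐ[k⟦X⟧] B where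
  toRingHom := (seriesEval hB).comp (PowerSeries.map (freeHom (k := k) gen))
  commutes' c := by
    change seriesEval hB (PowerSeries.map (freeHom (k := k) gen)
      (PowerSeries.map (algebraMap k (FreeAlgebra k Gen)) c)) = _
    rw [Algebra.algebraMap_eq_smul_one, ← seriesEval_scalar hB c 1]
    congr 1
    ext n
    rw [PowerSeries.coeff_map, PowerSeries.coeff_map, PowerSeries.coeff_mk,
      Algebra.algebraMap_eq_smul_one, freeHom_smul, map_one]

theorem freeTopHom_const (gen : Gen → B) (a : FreeAlgebra k Gen) :
    freeTopHom hB gen (FreeTop.const a) = freeHom gen a := by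
  change seriesEval hB (PowerSeries.map (freeHom (k := k) gen) (PowerSeries.C a)) = _
  rw [PowerSeries.map_C, seriesEval_C]

theorem map_expH (gen : Gen → B) (a : FreeAlgebra k Gen) :
    PowerSeries.map (freeHom (k := k) gen) (FreeTop.expH a) = formalExp k (freeHom gen a) := by
  ext n
  simp [FreeTop.expH, formalExp, freeHom_smul]

theorem freeTopHom_expH (gen : Gen → B) (a : FreeAlgebra k Gen) :
    freeTopHom hB gen (FreeTop.expH a) = qpow k N (freeHom gen a) := by
  change seriesEval hB (PowerSeries.map (freeHom (k := k) gen) (FreeTop.expH a)) = _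
  rw [map_expH]
  rfl

theorem freeTopHom_qnum [CharZero k] (gen : Gen → B) (a : FreeAlgebra k Gen) :
    freeTopHom hB gen (FreeTop.qnum a) = (divH (qd k))⁻¹ • qdiff k N (freeHom gen a) := by
  rw [FreeTop.qnum, map_smul]
  congr 1
  change seriesEval hB (PowerSeries.map (freeHom (k := k) gen)
    (divH (A := FreeAlgebra k Gen) (FreeTop.expH a - FreeTop.expH (-a)))) = _
  have h : ∀ p p' : PowerSeries (FreeAlgebra k Gen), PowerSeries.map (freeHom (k := k) gen)
      (divH (p - p')) = divH (PowerSeries.map (freeHom (k := k) gen) p -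
        PowerSeries.map (freeHom (k := k) gen) p') := fun p p' => by
    ext n
    simp [divH]
  refine Eq.trans (congrArg (seriesEval hB) (h _ _)) ?_
  rw [map_expH, map_expH, map_neg]
  rfl

theorem powerSeries_decomp {A : Type*} [Ring A] (N : ℕ) (p : PowerSeries A) :
    p = ∑ n ∈ Finset.range N, PowerSeries.X ^ n * PowerSeries.C (PowerSeries.coeff n p) +
      PowerSeries.X ^ N * PowerSeries.mk fun n => PowerSeries.coeff (n + N) p := by
  ext m
  simp only [map_add, map_sum, PowerSeries.coeff_X_pow_mul', PowerSeries.coeff_C,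
    PowerSeries.coeff_mk]
  rcases lt_or_ge m N with h | h
  · rw [Finset.sum_eq_single m]
    · simp [h]
    · intro b _ hb
      rw [ite_eq_right_iff]
      intro hbm
      rw [if_neg (by omega)]
    · intro h'
      simp [h] at h'
  · rw [Finset.sum_eq_zero]
    · simp [h]
    · intro b hb
      have := Finset.mem_range.1 hb
      rw [ite_eq_right_iff]
      intro hbm
      rw [if_neg (by omega)]

theorem freeTop_X_pow_smul (n : ℕ) (r : FreeTop k) : (PowerSeries.X ^ n : k⟦X⟧) • r =
    (PowerSeries.X ^ n * r : PowerSeries (FreeAlgebra k Gen)) := by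
  rw [Algebra.smul_def, algebraMap_freeTop, map_pow, PowerSeries.map_X]
  rfl

/-- Every element of the free complete algebra is, modulo `ħ^N`, a combination of constants. -/
theorem freeTop_decomp (N : ℕ) (p : FreeTop k) : ∃ r : FreeTop k,
    p = ∑ n ∈ Finset.range N, (PowerSeries.X ^ n : k⟦X⟧) •
      FreeTop.const (PowerSeries.coeff (R := FreeAlgebra k Gen) n p) +
        (PowerSeries.X ^ N : k⟦X⟧) • r := by
  refine ⟨(PowerSeries.mk fun n => PowerSeries.coeff (R := FreeAlgebra k Gen) (n + N) p :
      PowerSeries (FreeAlgebra k Gen)), ?_⟩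
  simp only [freeTop_X_pow_smul]
  refine Eq.trans ?_ (congrArg₂ (· + ·) rfl (freeTop_X_pow_smul N _).symm)
  exact powerSeries_decomp (A := FreeAlgebra k Gen) N p

/-- Constants, as a ring homomorphism. -/
def constHom : FreeAlgebra k Gen →+* FreeTop k :=
  (PowerSeries.C : FreeAlgebra k Gen →+* PowerSeries (FreeAlgebra k Gen))

theorem const_smul (c : k) (a : FreeAlgebra k Gen) :
    FreeTop.const (c • a) = (PowerSeries.C c : k⟦X⟧) • FreeTop.const a := by
  rw [Algebra.smul_def, Algebra.smul_def, algebraMap_freeTop, PowerSeries.map_C]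
  exact map_mul constHom _ _

include hB in
/-- Two homomorphisms that agree on the generators agree, when `ħ^N` kills the target. -/
theorem freeTop_algHom_ext (φ ψ : FreeTop k →ₐ[k⟦X⟧] B)
    (h : ∀ s, φ (FreeTop.const (FreeAlgebra.ι k s)) = ψ (FreeTop.const (FreeAlgebra.ι k s))) :
    φ = ψ := by
  have hc : ∀ a : FreeAlgebra k Gen, φ (FreeTop.const a) = ψ (FreeTop.const a) := by
    intro a
    induction a using FreeAlgebra.induction with
    | grade0 r =>
      have : (FreeTop.const (algebraMap k (FreeAlgebra k Gen) r)) =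
          (PowerSeries.C r : k⟦X⟧) • (1 : FreeTop k) := by
        rw [Algebra.algebraMap_eq_smul_one, const_smul]
        rfl
      rw [this, map_smul, map_smul, map_one, map_one]
    | grade1 s => exact h s
    | mul a b ha hb =>
      have : FreeTop.const (a * b) = FreeTop.const a * FreeTop.const b := map_mul constHom a b
      rw [this, map_mul, map_mul, ha, hb]
    | add a b ha hb =>
      have : FreeTop.const (a + b) = FreeTop.const a + FreeTop.const b := map_add constHom a b
      rw [this, map_add, map_add, ha, hb]
  ext p
  obtain ⟨r, hr⟩ := freeTop_decomp N p
  rw [hr]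
  simp only [map_add, map_sum, map_smul, hc, X_pow_smul_eq_zero hB le_rfl]

end Evaluation

section Universal

variable {k : Type u} [Field k] [CharZero k] {B : Type*} [Ring B] [Algebra k⟦X⟧ B]

variable (k) in
/-- `[b]_q = (q^b - q^{-b}) / (q - q⁻¹)` in an algebra killed by `ħ^N`. -/
def qnumber (N : ℕ) (b : B) : B := (divH (qd k))⁻¹ • qdiff k N b

/-- The family of values of the generators. -/
def genValues (f : Fin 2 → B) (l : Fin 3 → B) (e : Fin 2 → B) : Gen → B
  | .f i => f i
  | .l j => l j
  | .e i => e i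

variable (k) in
/-- The elements `f`, `l`, `e` of an algebra killed by `ħ^N` satisfy the relations
of `U_ħ(gl_3)`. -/
structure IsGLTriple (N : ℕ) (f : Fin 2 → B) (l : Fin 3 → B) (e : Fin 2 → B) : Prop where
  X_pow : (PowerSeries.X ^ N : k⟦X⟧) • (1 : B) = 0
  l_f (i : Fin 2) (j : Fin 3) :
      l j * f i - f i * l j = (kron k i.succ j - kron k i.castSucc j) • f i
  l_l (i j : Fin 3) : l i * l j = l j * l i
  l_e (i : Fin 2) (j : Fin 3) :
      l j * e i - e i * l j = (kron k i.castSucc j - kron k i.succ j) • e i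
  e_f (i j : Fin 2) :
      e i * f j - f j * e i = kron k i j • qnumber k N (l i.castSucc - l i.succ)
  serre_e (i j : Fin 2) (hij : i ≠ j) :
      e i ^ 2 * e j - (q k + (q k)⁻¹) • (e i * e j * e i) + e j * e i ^ 2 = 0
  serre_f (i j : Fin 2) (hij : i ≠ j) :
      f i ^ 2 * f j - (q k + (q k)⁻¹) • (f i * f j * f i) + f j * f i ^ 2 = 0

variable {N : ℕ}

/-- The ideal of relations is the closed ideal generated by the relators, so a homomorphism to an
`ħ`-adically separated algebra kills it as soon as it kills the relators. -/
theorem relIdeal_le_ker (φ : FreeTop k →ₐ[k⟦X⟧] B)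
    (hsep : ∀ x : B, (∀ M : ℕ, ∃ y, x = (PowerSeries.X ^ M : k⟦X⟧) • y) → x = 0)
    (h : ∀ x, Relator k x → φ x = 0) {x : FreeTop k} (hx : x ∈ relIdeal k) : φ x = 0 := by
  have : relIdeal k ≤ TwoSidedIdeal.ker φ := by
    refine sInf_le ⟨fun x hx => (TwoSidedIdeal.mem_ker _).2 (h x hx), fun x hx => ?_⟩
    refine (TwoSidedIdeal.mem_ker _).2 (hsep _ fun M => ?_)
    obtain ⟨s, hs, y, rfl⟩ := hx M
    exact ⟨φ y, by rw [map_add, (TwoSidedIdeal.mem_ker _).1 hs, zero_add, map_smul]⟩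
  exact (TwoSidedIdeal.mem_ker _).1 (this hx)

variable {f : Fin 2 → B} {l : Fin 3 → B} {e : Fin 2 → B}

theorem IsGLTriple.freeTopHom_relator (hG : IsGLTriple k N f l e) {x : FreeTop k}
    (hx : Relator k x) : freeTopHom hG.X_pow (genValues f l e) x = 0 := by
  cases hx <;>
    simp only [map_sub, map_add, map_mul, map_smul, map_pow, fT, lT, eT, freeTopHom_const,
      freeHom_ι, genValues, hFree, freeTopHom_qnum]
  · rw [hG.l_f, sub_self]
  · rw [hG.l_l, sub_self]
  · rw [hG.l_e, sub_self]
  · rw [hG.e_f, qnumber, sub_self]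
  · rw [hG.serre_e _ _ ‹_›]
  · rw [hG.serre_f _ _ ‹_›]

/-- The homomorphism from `U_ħ(gl_3)` given by elements satisfying the relations. -/
def IsGLTriple.hom (hG : IsGLTriple k N f l e) : Ugl k →ₐ[k⟦X⟧] B :=
  Ideal.Quotient.liftₐ (relIdeal k).asIdeal (freeTopHom hG.X_pow (genValues f l e)) fun _ hx =>
    relIdeal_le_ker _ (fun x hx => by
      obtain ⟨y, rfl⟩ := hx N
      exact X_pow_smul_eq_zero hG.X_pow le_rfl _) (fun _ => hG.freeTopHom_relator) hx

theorem IsGLTriple.hom_proj (hG : IsGLTriple k N f l e) (x : FreeTop k) :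
    hG.hom (Ugl.proj k x) = freeTopHom hG.X_pow (genValues f l e) x := rfl

theorem IsGLTriple.hom_f (hG : IsGLTriple k N f l e) (i : Fin 2) :
    hG.hom (QuantumStokes.f k i) = f i := by
  rw [QuantumStokes.f, hom_proj, fT, freeTopHom_const, freeHom_ι]
  rfl

theorem IsGLTriple.hom_l (hG : IsGLTriple k N f l e) (i : Fin 3) :
    hG.hom (QuantumStokes.l k i) = l i := by
  rw [QuantumStokes.l, hom_proj, lT, freeTopHom_const, freeHom_ι]
  rfl

theorem IsGLTriple.hom_e (hG : IsGLTriple k N f l e) (i : Fin 2) :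
    hG.hom (QuantumStokes.e k i) = e i := by
  rw [QuantumStokes.e, hom_proj, eT, freeTopHom_const, freeHom_ι]
  rfl

/-- The homomorphism from `U_ħ(gl_3) / ħ^N` given by elements satisfying the relations. -/
def IsGLTriple.homMod (hG : IsGLTriple k N f l e) : UglMod k N →ₐ[k⟦X⟧] B :=
  Ideal.Quotient.liftₐ (hIdeal k (Ugl k) N) hG.hom fun a ha => by
    obtain ⟨y, rfl⟩ := mem_hIdeal.1 ha
    rw [map_smul, X_pow_smul_eq_zero hG.X_pow le_rfl]

theorem IsGLTriple.homMod_red (hG : IsGLTriple k N f l e) (x : Ugl k) :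
    hG.homMod (red k N x) = hG.hom x := rfl

theorem red_surjective (N : ℕ) : Function.Surjective (red k N) :=
  Ideal.Quotient.mkₐ_surjective _ _

theorem proj_surjective : Function.Surjective (Ugl.proj k) :=
  Ideal.Quotient.mkₐ_surjective _ _

theorem red_eq_zero_iff {N : ℕ} {x : Ugl k} :
    red k N x = 0 ↔ ∃ y, x = (PowerSeries.X ^ N : k⟦X⟧) • y :=
  Ideal.Quotient.eq_zero_iff_mem.trans mem_hIdeal

theorem UglMod_X_pow (N : ℕ) : (PowerSeries.X ^ N : k⟦X⟧) • (1 : UglMod k N) = 0 := by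
  rw [← map_one (red k N), ← map_smul]
  exact red_eq_zero_iff.2 ⟨1, rfl⟩

/-- Homomorphisms from `U_ħ(gl_3) / ħ^N` are determined by the values on the generators. -/
theorem UglMod_algHom_ext (φ ψ : UglMod k N →ₐ[k⟦X⟧] B)
    (hf : ∀ i, φ (red k N (QuantumStokes.f k i)) = ψ (red k N (QuantumStokes.f k i)))
    (hl : ∀ i, φ (red k N (QuantumStokes.l k i)) = ψ (red k N (QuantumStokes.l k i)))
    (he : ∀ i, φ (red k N (QuantumStokes.e k i)) = ψ (red k N (QuantumStokes.e k i))) : φ = ψ := by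
  have hB : (PowerSeries.X ^ N : k⟦X⟧) • (1 : B) = 0 := by
    rw [← map_one φ, ← map_smul, UglMod_X_pow, map_zero]
  have := freeTop_algHom_ext hB (φ.comp ((red k N).comp (Ugl.proj k)))
    (ψ.comp ((red k N).comp (Ugl.proj k))) (by
      rintro (i | i | i)
      exacts [hf i, hl i, he i])
  ext x
  obtain ⟨x, rfl⟩ := red_surjective N x
  obtain ⟨x, rfl⟩ := proj_surjective x
  exact DFunLike.congr_fun this x

/-- `U_ħ(gl_3)` is `ħ`-adically separated. -/
theorem Ugl_eq_zero {x : Ugl k} (h : ∀ N, red k N x = 0) : x = 0 := by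
  obtain ⟨x, rfl⟩ := proj_surjective x
  have hx : x ∈ relIdeal k := by
    refine (TwoSidedIdeal.mem_sInf _).2 fun I hI => hI.2 x fun N => ?_
    obtain ⟨y, hy⟩ := red_eq_zero_iff.1 (h N)
    obtain ⟨y, rfl⟩ := proj_surjective y
    rw [← map_smul] at hy
    have h1 : x - (PowerSeries.X ^ N : k⟦X⟧) • y ∈ relIdeal k := by
      exact Ideal.Quotient.eq.1 hy
    exact ⟨_, (TwoSidedIdeal.mem_sInf _).1 h1 _ hI, y, by abel⟩
  exact Ideal.Quotient.eq_zero_iff_mem.2 hx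

theorem Ugl_ext {x y : Ugl k} (h : ∀ N, red k N x = red k N y) : x = y :=
  sub_eq_zero.1 (Ugl_eq_zero fun N => by rw [map_sub, h, sub_self])

/-- `U_ħ(gl_3)` is `ħ`-adically complete: the series `∑ ħ^n y_n` converge. -/
theorem Ugl_series (y : ℕ → Ugl k) : ∃ x : Ugl k, ∀ N,
    ∃ r, x = ∑ n ∈ Finset.range N, (PowerSeries.X ^ n : k⟦X⟧) • y n +
      (PowerSeries.X ^ N : k⟦X⟧) • r := by
  choose p' hp using fun n => proj_surjective (y n)
  let p : ℕ → PowerSeries (FreeAlgebra k Gen) := p'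
  let s : ℕ → PowerSeries (FreeAlgebra k Gen) := fun M => PowerSeries.mk fun n =>
    ∑ i ∈ Finset.range (n + 1), PowerSeries.coeff (R := FreeAlgebra k Gen) (n - i) (p (M + i))
  have hs : ∀ M, s M = p M + PowerSeries.X * s (M + 1) := by
    intro M
    ext n
    rcases n with _ | n
    · simp [s]
    · rw [map_add, PowerSeries.coeff_succ_X_mul, PowerSeries.coeff_mk, PowerSeries.coeff_mk,
        Finset.sum_range_succ', add_comm]
      congr 1
      refine Finset.sum_congr rfl fun i _ => ?_
      rw [Nat.add_sub_add_right, add_assoc, add_comm 1 i]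
  let s' : ℕ → FreeTop k := s
  have hs' : ∀ M, s' M = p' M + (PowerSeries.X : k⟦X⟧) • s' (M + 1) := by
    intro M
    refine (hs M).trans ?_
    have h1 := freeTop_X_pow_smul (k := k) 1 (s' (M + 1))
    have h2 : (PowerSeries.X ^ 1 * s (M + 1) : PowerSeries (FreeAlgebra k Gen)) =
        PowerSeries.X * s (M + 1) := by rw [pow_one]
    rw [pow_one] at h1
    exact congrArg₂ (· + ·) rfl (h1.trans h2).symm
  refine ⟨Ugl.proj k (s' 0), fun N => ⟨Ugl.proj k (s' N), ?_⟩⟩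
  induction N with
  | zero => simp
  | succ N ih =>
    rw [ih, Finset.sum_range_succ, add_assoc, pow_succ, mul_smul, ← smul_add, hs' N, map_add,
      map_smul, hp]

end Universal

/-! ### Quantum Serre relations -/

section Abstract

variable {R : Type*} [CommRing R] {B : Type*} [Ring B] [Algebra R B]

/-- Elements satisfying the quantum Serre relation, and `q`-commuting in the way
`e_i ⊗ 1` and `t_j ⊗ e_j` do, have sums satisfying the quantum Serre relation. -/
theorem serre_add {Q Q' : R} (hQ : Q * Q' = 1) {x y x' y' : B}
    (hx : x ^ 2 * y - (Q + Q') • (x * y * x) + y * x ^ 2 = 0)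
    (hx' : x' ^ 2 * y' - (Q + Q') • (x' * y' * x') + y' * x' ^ 2 = 0)
    (h1 : x' * x = Q ^ 2 • (x * x')) (h2 : x' * y = Q' • (y * x'))
    (h3 : y' * x = Q' • (x * y')) :
    (x + x') ^ 2 * (y + y') - (Q + Q') • ((x + x') * (y + y') * (x + x')) +
      (y + y') * (x + x') ^ 2 = 0 := by
  have a1 : ∀ z, x' * (x * z) = Q ^ 2 • (x * (x' * z)) := fun z => by
    rw [← mul_assoc, h1, smul_mul_assoc, mul_assoc]
  have a2 : ∀ z, x' * (y * z) = Q' • (y * (x' * z)) := fun z => by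
    rw [← mul_assoc, h2, smul_mul_assoc, mul_assoc]
  have a3 : ∀ z, y' * (x * z) = Q' • (x * (y' * z)) := fun z => by
    rw [← mul_assoc, h3, smul_mul_assoc, mul_assoc]
  have b : y * (x * x) = (Q + Q') • (x * (y * x)) - x * (x * y) := by
    simp only [pow_two, mul_assoc] at hx
    linear_combination (norm := module) hx
  have b' : y' * (x' * x') = (Q + Q') • (x' * (y' * x')) - x' * (x' * y') := by
    simp only [pow_two, mul_assoc] at hx'
    linear_combination (norm := module) hx'
  simp only [pow_two, mul_add, add_mul, mul_assoc, h1, h2, h3, a1, a2, a3, b, b',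
    mul_smul_comm, smul_mul_assoc, smul_add, smul_smul]
  clear hx hx' h1 h2 h3 a1 a2 a3 b b'
  match_scalars <;> grind

/-- The inhomogeneous quantum Serre relation between `x + s` and `y + r`, where `x`, `s`, `y`, `r`
behave as `f_i`, `-q t_i⁻¹ e_i`, `f_j`, `-q t_j⁻¹ e_j` and `w` as `t_i⁻¹ [h_i]_q`. -/
theorem inhomogeneous_serre {Q Q' : R} (hQ : Q * Q' = 1) {x y s r w : B}
    (hx : x ^ 2 * y - (Q + Q') • (x * y * x) + y * x ^ 2 = 0)
    (hs : s ^ 2 * r - (Q + Q') • (s * r * s) + r * s ^ 2 = 0)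
    (hsy : s * y = Q' • (y * s)) (hrx : r * x = Q' • (x * r))
    (hsx : s * x = Q ^ 2 • (x * s) - Q • w)
    (hwy : w * y = Q' ^ 2 • (y * w) + Q' • y) (hwr : w * r = Q ^ 2 • (r * w) - Q • r) :
    (x + s) ^ 2 * (y + r) - (Q + Q') • ((x + s) * (y + r) * (x + s)) +
      (y + r) * (x + s) ^ 2 = -(y + r) := by
  have a1 : ∀ z, s * (y * z) = Q' • (y * (s * z)) := fun z => by
    rw [← mul_assoc, hsy, smul_mul_assoc, mul_assoc]
  have a2 : ∀ z, r * (x * z) = Q' • (x * (r * z)) := fun z => by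
    rw [← mul_assoc, hrx, smul_mul_assoc, mul_assoc]
  have a3 : ∀ z, s * (x * z) = Q ^ 2 • (x * (s * z)) - Q • (w * z) := fun z => by
    rw [← mul_assoc, hsx, sub_mul, smul_mul_assoc, smul_mul_assoc, mul_assoc]
  have b : y * (x * x) = (Q + Q') • (x * (y * x)) - x * (x * y) := by
    simp only [pow_two, mul_assoc] at hx
    linear_combination (norm := module) hx
  have b' : r * (s * s) = (Q + Q') • (s * (r * s)) - s * (s * r) := by
    simp only [pow_two, mul_assoc] at hs
    linear_combination (norm := module) hs
  simp only [pow_two (x + s), mul_add, add_mul, mul_assoc, hsy, hrx, hsx, hwy, hwr, a1, a2, a3,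
    b, b', mul_smul_comm, smul_mul_assoc, smul_add, mul_sub, sub_mul, smul_sub, smul_smul]
  clear hx hs hsy hrx hsx hwy hwr a1 a2 a3 b b'
  match_scalars <;> grind

/-- The quantum Serre relation is inherited by multiples of `t_i⁻¹ e_i`. -/
theorem serre_twist {Q Q' : R} (hQ : Q * Q' = 1) {x y a b : B} (c : R)
    (hx : x ^ 2 * y - (Q + Q') • (x * y * x) + y * x ^ 2 = 0)
    (h1 : a * x = Q' ^ 2 • (x * a)) (h2 : a * y = Q • (y * a)) (h3 : b * x = Q • (x * b))
    (h4 : b * y = Q' ^ 2 • (y * b)) (hab : b * a = a * b) :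
    (-(c • (a * x))) ^ 2 * -(c • (b * y)) -
      (Q + Q') • (-(c • (a * x)) * -(c • (b * y)) * -(c • (a * x))) +
      -(c • (b * y)) * (-(c • (a * x))) ^ 2 = 0 := by
  have a1 : ∀ z, a * (x * z) = Q' ^ 2 • (x * (a * z)) := fun z => by
    rw [← mul_assoc, h1, smul_mul_assoc, mul_assoc]
  have a2 : ∀ z, a * (y * z) = Q • (y * (a * z)) := fun z => by
    rw [← mul_assoc, h2, smul_mul_assoc, mul_assoc]
  have a3 : ∀ z, b * (x * z) = Q • (x * (b * z)) := fun z => by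
    rw [← mul_assoc, h3, smul_mul_assoc, mul_assoc]
  have a4 : ∀ z, b * (y * z) = Q' ^ 2 • (y * (b * z)) := fun z => by
    rw [← mul_assoc, h4, smul_mul_assoc, mul_assoc]
  have a5 : ∀ z, b * (a * z) = a * (b * z) := fun z => by
    rw [← mul_assoc, hab, mul_assoc]
  have e1 : (-(c • (a * x))) ^ 2 * -(c • (b * y)) -
      (Q + Q') • (-(c • (a * x)) * -(c • (b * y)) * -(c • (a * x))) +
      -(c • (b * y)) * (-(c • (a * x))) ^ 2 =
      -(c ^ 3 * Q' ^ 6) • ((x ^ 2 * y - (Q + Q') • (x * y * x) + y * x ^ 2) * (a * (a * b))) := by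
    simp only [pow_two, mul_add, add_mul, sub_mul, mul_neg,
      neg_mul, mul_assoc, h1, h4, hab, a1, a2, a3, a5, mul_smul_comm, smul_mul_assoc, smul_add,
      smul_sub, smul_neg, smul_smul]
    clear hx h1 h2 h3 h4 hab a1 a2 a3 a4 a5
    match_scalars <;> grind
  rw [e1, hx, zero_mul, smul_zero]

/-- The `q`-commutator of `f_1 - q t_1⁻¹ e_1` and `f_2 - q t_2⁻¹ e_2`, with `a = t_1⁻¹` and
`b = t_2⁻¹`. -/
theorem coideal_qcommutator {Q Q' : R} (hQ : Q * Q' = 1) {x y d e a b : B}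
    (hdy : d * y = y * d) (hex : e * x = x * e) (hay : a * y = Q' • (y * a))
    (hbx : b * x = Q' • (x * b)) (had : a * d = Q' ^ 2 • (d * a)) (hae : a * e = Q • (e * a))
    (hbd : b * d = Q • (d * b)) (hbe : b * e = Q' ^ 2 • (e * b)) (hab : b * a = a * b) :
    (x + -(Q • (a * d))) * (y + -(Q • (b * e))) - Q • ((y + -(Q • (b * e))) * (x + -(Q • (a * d))))
      = -(Q • (y * x - Q' • (x * y) - (Q' * (Q - Q')) • (d * a * y) -
        Q' ^ 2 • ((d * e - Q • (e * d)) * (a * b)))) := by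
  have a1 : ∀ z, d * (y * z) = y * (d * z) := fun z => by rw [← mul_assoc, hdy, mul_assoc]
  have a2 : ∀ z, e * (x * z) = x * (e * z) := fun z => by rw [← mul_assoc, hex, mul_assoc]
  have a3 : ∀ z, a * (e * z) = Q • (e * (a * z)) := fun z => by
    rw [← mul_assoc, hae, smul_mul_assoc, mul_assoc]
  have a4 : ∀ z, b * (d * z) = Q • (d * (b * z)) := fun z => by
    rw [← mul_assoc, hbd, smul_mul_assoc, mul_assoc]
  simp only [mul_add, add_mul, sub_mul, mul_sub, mul_neg, neg_mul, mul_assoc, hay, hbx,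
    had, hbe, hab, a1, a2, a3, a4, mul_smul_comm, smul_mul_assoc, smul_add, smul_sub,
    smul_neg, smul_smul]
  clear hdy hex hay hbx had hae hbd hbe hab a1 a2 a3 a4
  match_scalars <;> grind

theorem mul_qcommutator {Q Q' : R} (hQ : Q * Q' = 1) {x y : B}
    (h : x ^ 2 * y - (Q + Q') • (x * y * x) + y * x ^ 2 = -y) :
    x * (x * y - Q' • (y * x)) = Q • ((x * y - Q' • (y * x)) * x) - y := by
  have h' : y * x ^ 2 = -y + (Q + Q') • (x * y * x) - x ^ 2 * y := by rw [← h]; abel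
  simp only [pow_two, mul_assoc] at h'
  simp only [sub_mul, mul_sub, mul_assoc, mul_smul_comm, smul_mul_assoc, smul_sub, h',
    smul_smul]
  clear h h'
  match_scalars <;> grind

theorem qcommutator_mul {Q Q' : R} (hQ : Q * Q' = 1) {x y : B}
    (h : x ^ 2 * y - (Q + Q') • (x * y * x) + y * x ^ 2 = -y) :
    (y * x - Q' • (x * y)) * x = Q • (x * (y * x - Q' • (x * y))) - y := by
  have h' : y * x ^ 2 = -y + (Q + Q') • (x * y * x) - x ^ 2 * y := by rw [← h]; abel
  simp only [pow_two, mul_assoc] at h'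
  simp only [sub_mul, mul_sub, mul_assoc, mul_smul_comm, smul_mul_assoc, smul_sub, h',
    smul_smul]
  clear h h'
  match_scalars <;> grind

end Abstract

section Cartan

variable {k : Type u} [Field k] [CharZero k] {B : Type*} [Ring B] [Algebra k⟦X⟧ B]
  {N : ℕ}

theorem inv_q : (q k)⁻¹ = PowerSeries.evalNegHom (PowerSeries.exp k) := by
  rw [PowerSeries.inv_eq_iff_mul_eq_one (by simp [q]), mul_comm]
  exact PowerSeries.exp_mul_exp_neg_eq_one (A := k)

theorem coeff_q (n : ℕ) : PowerSeries.coeff n (q k) = ((n.factorial : k)⁻¹) := by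
  simp [q, PowerSeries.coeff_exp]

theorem coeff_inv_q (n : ℕ) :
    PowerSeries.coeff n (q k)⁻¹ = (-1) ^ n * ((n.factorial : k)⁻¹) := by
  simp [inv_q, PowerSeries.evalNegHom, PowerSeries.coeff_exp]

theorem constantCoeff_divH_qd : PowerSeries.constantCoeff (divH (qd k)) = 2 := by
  rw [← PowerSeries.coeff_zero_eq_constantCoeff_apply, divH, PowerSeries.coeff_mk, qd, map_sub,
    coeff_q, coeff_inv_q]
  norm_num

theorem X_mul_divH_qd : PowerSeries.X * divH (qd k) = qd k :=
  X_mul_divH _ (by simp [qd, q])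

theorem divH_qd_mul_inv : divH (qd k) * (divH (qd k))⁻¹ = 1 :=
  PowerSeries.mul_inv_cancel _ (by rw [constantCoeff_divH_qd]; exact two_ne_zero)

variable (hB : (PowerSeries.X ^ N : k⟦X⟧) • (1 : B) = 0)
include hB

theorem qpow_one : qpow k N (1 : B) = q k • (1 : B) := by
  rw [← seriesEval_scalar hB]
  change seriesEval hB _ = _
  congr 1
  ext n
  simp [formalExp, coeff_q]

theorem qdiff_one : qdiff k N (1 : B) = divH (qd k) • (1 : B) := by
  rw [← seriesEval_scalar hB]
  change seriesEval hB _ = _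
  congr 1
  ext n
  have h : (-1 : B) ^ (n + 1) = (PowerSeries.C ((-1 : k) ^ (n + 1)) : k⟦X⟧) • 1 := by
    rw [map_pow, map_neg, map_one, Algebra.smul_def, map_pow, map_neg, map_one, mul_one]
  simp only [formalDiff, formalExp, divH, PowerSeries.coeff_mk, map_sub, qd, coeff_q, coeff_inv_q,
    one_pow, sub_smul, h, smul_smul, map_mul, mul_comm]

theorem qpow_add_one (b : B) : qpow k N (b + 1) = q k • qpow k N b := by
  rw [qpow_add hB (Commute.one_right b), qpow_one hB, mul_smul_comm, mul_one]

theorem qpow_sub_one (b : B) : qpow k N (b - 1) = (q k)⁻¹ • qpow k N b := by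
  conv_rhs => rw [← sub_add_cancel b 1]
  rw [qpow_add_one hB, smul_smul, mul_comm, q_mul_inv, one_smul]

theorem qnumber_add_one (b : B) :
    qnumber k N (b + 1) = (q k)⁻¹ • qnumber k N b + qpow k N b := by
  rw [qnumber, qdiff_add hB (Commute.one_right b), qdiff_one hB, ← zero_sub (1 : B),
    qpow_sub_one hB, qpow_zero hB, qnumber, mul_smul_comm, mul_one, mul_smul_comm, mul_one,
    smul_add,
    smul_smul _ _ (qpow k N b), mul_comm _ (divH (qd k)), divH_qd_mul_inv, one_smul, smul_comm]

theorem qnumber_sub_one (b : B) :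
    qnumber k N (b - 1) = q k • qnumber k N b - qpow k N b := by
  have h := qnumber_add_one hB (b - 1)
  rw [sub_add_cancel, qpow_sub_one hB] at h
  rw [h, smul_add, smul_smul, smul_smul, q_mul_inv, one_smul, one_smul, add_sub_cancel_right]

theorem qnumber_semiconj {a b x : B} (h : a * x = x * b) :
    qnumber k N a * x = x * qnumber k N b := by
  rw [qnumber, qnumber, smul_mul_assoc, qdiff_semiconj hB h, mul_smul_comm]

end Cartan

section Triple

variable {k : Type u} [Field k] [CharZero k] {B : Type*} [Ring B] [Algebra k⟦X⟧ B]
  {N : ℕ} {f : Fin 2 → B} {l : Fin 3 → B} {e : Fin 2 → B}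

/-- The element `h_i = ℓ_i - ℓ_{i+1}`. -/
def cartanH (l : Fin 3 → B) (i : Fin 2) : B := l i.castSucc - l i.succ

variable (k) in
/-- The scalar `q^{a_{ij}}`, for the Cartan matrix `a_{ij}` of `sl_3`. -/
def qCartan (i j : Fin 2) : k⟦X⟧ := if i = j then q k ^ 2 else (q k)⁻¹

variable (k) in
/-- The scalar `q^{-a_{ij}}`, for the Cartan matrix `a_{ij}` of `sl_3`. -/
def qCartanInv (i j : Fin 2) : k⟦X⟧ := if i = j then (q k)⁻¹ ^ 2 else q k

theorem qCartan_comm (i j : Fin 2) : qCartan k i j = qCartan k j i := by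
  simp [qCartan, eq_comm]

theorem qCartan_mul_inv (i j : Fin 2) : qCartan k i j * qCartanInv k i j = 1 := by
  have := q_mul_inv k
  unfold qCartan qCartanInv
  split_ifs <;> grind

namespace IsGLTriple

variable (hG : IsGLTriple k N f l e)
include hG

theorem commute_l (i j : Fin 3) : Commute (l i) (l j) := hG.l_l i j

theorem commute_h (i j : Fin 2) : Commute (cartanH l i) (cartanH l j) :=
  ((hG.commute_l _ _).sub_left (hG.commute_l _ _)).sub_right
    ((hG.commute_l _ _).sub_left (hG.commute_l _ _))

theorem h_mul_e (i j : Fin 2) : cartanH l i * e j =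
    e j * if i = j then cartanH l i + 1 + 1 else cartanH l i - 1 := by
  have h1 := hG.l_e j i.castSucc
  have h2 := hG.l_e j i.succ
  have h3 : cartanH l i * e j - e j * cartanH l i = (kron k j.castSucc i.castSucc -
      kron k j.succ i.castSucc - (kron k j.castSucc i.succ - kron k j.succ i.succ)) • e j := by
    rw [sub_smul _ _ (e j), ← h1, ← h2, cartanH]
    noncomm_ring
  rw [sub_eq_iff_eq_add] at h3
  rw [h3]
  fin_cases i <;> fin_cases j <;> simp [kron, mul_add, mul_sub, add_smul] <;> abel

theorem h_mul_f (i j : Fin 2) : cartanH l i * f j =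
    f j * if i = j then cartanH l i - 1 - 1 else cartanH l i + 1 := by
  have h1 := hG.l_f j i.castSucc
  have h2 := hG.l_f j i.succ
  have h3 : cartanH l i * f j - f j * cartanH l i = (kron k j.succ i.castSucc -
      kron k j.castSucc i.castSucc - (kron k j.succ i.succ - kron k j.castSucc i.succ)) • f j := by
    rw [sub_smul _ _ (f j), ← h1, ← h2, cartanH]
    noncomm_ring
  rw [sub_eq_iff_eq_add] at h3
  rw [h3]
  fin_cases i <;> fin_cases j <;> simp [kron, mul_add, mul_sub, sub_smul] <;> abel

theorem t_mul_e (i j : Fin 2) : qpow k N (cartanH l i) * e j =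
    qCartan k i j • (e j * qpow k N (cartanH l i)) := by
  rw [qpow_semiconj hG.X_pow (hG.h_mul_e i j), qCartan]
  split_ifs
  · rw [qpow_add_one hG.X_pow, qpow_add_one hG.X_pow, smul_smul, mul_smul_comm, pow_two]
  · rw [qpow_sub_one hG.X_pow, mul_smul_comm]

theorem t_mul_f (i j : Fin 2) : qpow k N (cartanH l i) * f j =
    qCartanInv k i j • (f j * qpow k N (cartanH l i)) := by
  rw [qpow_semiconj hG.X_pow (hG.h_mul_f i j), qCartanInv]
  split_ifs
  · rw [qpow_sub_one hG.X_pow, qpow_sub_one hG.X_pow, smul_smul, mul_smul_comm, pow_two]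
  · rw [qpow_add_one hG.X_pow, mul_smul_comm]

theorem commute_t (i j : Fin 2) : qpow k N (cartanH l i) * qpow k N (cartanH l j) =
    qpow k N (cartanH l j) * qpow k N (cartanH l i) := by
  rw [← qpow_add hG.X_pow (hG.commute_h i j), ← qpow_add hG.X_pow (hG.commute_h j i), add_comm]

theorem commute_tinv (i j : Fin 2) : qpow k N (-cartanH l i) * qpow k N (-cartanH l j) =
    qpow k N (-cartanH l j) * qpow k N (-cartanH l i) := by
  rw [← qpow_add hG.X_pow (hG.commute_h i j).neg_left.neg_right,
    ← qpow_add hG.X_pow (hG.commute_h j i).neg_left.neg_right, add_comm]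

theorem t_mul_tinv (i : Fin 2) : qpow k N (cartanH l i) * qpow k N (-cartanH l i) = 1 :=
  qpow_mul_qpow_neg hG.X_pow _

theorem tinv_mul_t (i : Fin 2) : qpow k N (-cartanH l i) * qpow k N (cartanH l i) = 1 :=
  qpow_neg_mul_qpow hG.X_pow _

theorem tinv_mul_e (i j : Fin 2) : qpow k N (-cartanH l i) * e j =
    qCartanInv k i j • (e j * qpow k N (-cartanH l i)) := by
  have h : e j * qpow k N (-cartanH l i) =
      qCartan k i j • (qpow k N (-cartanH l i) * e j) := by
    calc e j * qpow k N (-cartanH l i)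
        = qpow k N (-cartanH l i) * (qpow k N (cartanH l i) * e j) * qpow k N (-cartanH l i) := by
          rw [← mul_assoc (qpow k N (-cartanH l i)), hG.tinv_mul_t, one_mul]
      _ = _ := by
          rw [hG.t_mul_e, mul_smul_comm, smul_mul_assoc, mul_assoc, mul_assoc, hG.t_mul_tinv,
            mul_one]
  rw [h, smul_smul, mul_comm, qCartan_mul_inv, one_smul]

theorem tinv_mul_f (i j : Fin 2) : qpow k N (-cartanH l i) * f j =
    qCartan k i j • (f j * qpow k N (-cartanH l i)) := by
  have h : f j * qpow k N (-cartanH l i) =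
      qCartanInv k i j • (qpow k N (-cartanH l i) * f j) := by
    calc f j * qpow k N (-cartanH l i)
        = qpow k N (-cartanH l i) * (qpow k N (cartanH l i) * f j) * qpow k N (-cartanH l i) := by
          rw [← mul_assoc (qpow k N (-cartanH l i)), hG.tinv_mul_t, one_mul]
      _ = _ := by
          rw [hG.t_mul_f, mul_smul_comm, smul_mul_assoc, mul_assoc, mul_assoc, hG.t_mul_tinv,
            mul_one]
  rw [h, smul_smul, qCartan_mul_inv, one_smul]

theorem qnumber_mul_f {i j : Fin 2} (hij : i ≠ j) : qnumber k N (cartanH l i) * f j =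
    f j * ((q k)⁻¹ • qnumber k N (cartanH l i) + qpow k N (cartanH l i)) := by
  rw [qnumber_semiconj hG.X_pow (hG.h_mul_f i j), if_neg hij, qnumber_add_one hG.X_pow]

theorem qnumber_mul_e {i j : Fin 2} (hij : i ≠ j) : qnumber k N (cartanH l i) * e j =
    e j * (q k • qnumber k N (cartanH l i) - qpow k N (cartanH l i)) := by
  rw [qnumber_semiconj hG.X_pow (hG.h_mul_e i j), if_neg hij, qnumber_sub_one hG.X_pow]

end IsGLTriple

variable (k) in
/-- The element `-q t_i⁻¹ e_i`. -/
def twistedE (N : ℕ) (l : Fin 3 → B) (e : Fin 2 → B) (i : Fin 2) : B :=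
  -(q k • (qpow k N (-cartanH l i) * e i))

variable (k) in
/-- The generators `f_i - q t_i⁻¹ e_i` of the coideal subalgebra. -/
def coidealGen (N : ℕ) (f : Fin 2 → B) (l : Fin 3 → B) (e : Fin 2 → B) (i : Fin 2) : B :=
  f i + twistedE k N l e i

namespace IsGLTriple

variable (hG : IsGLTriple k N f l e)
include hG

theorem twistedE_mul_f {i j : Fin 2} (hij : i ≠ j) :
    twistedE k N l e i * f j = (q k)⁻¹ • (f j * twistedE k N l e i) := by
  have h1 : e i * f j = f j * e i := by
    have := hG.e_f i j
    rwa [kron, if_neg hij, zero_smul, sub_eq_zero] at this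
  rw [twistedE, neg_mul, smul_mul_assoc, mul_assoc, h1, ← mul_assoc, hG.tinv_mul_f, qCartan,
    if_neg hij, smul_mul_assoc, mul_neg, mul_smul_comm, mul_assoc, smul_neg, smul_comm]

theorem twistedE_mul_f_self (i : Fin 2) :
    twistedE k N l e i * f i = q k ^ 2 • (f i * twistedE k N l e i) -
      q k • (qpow k N (-cartanH l i) * qnumber k N (cartanH l i)) := by
  have h1 : e i * f i = f i * e i + qnumber k N (cartanH l i) := by
    have := hG.e_f i i
    rwa [kron, if_pos rfl, one_smul, sub_eq_iff_eq_add'] at this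
  rw [twistedE, neg_mul, smul_mul_assoc, mul_assoc, h1, mul_add, ← mul_assoc, hG.tinv_mul_f,
    qCartan, if_pos rfl, smul_mul_assoc, mul_neg, mul_smul_comm, mul_assoc, smul_neg, smul_add,
      smul_comm, neg_add, sub_eq_add_neg]

theorem twistedE_serre {i j : Fin 2} (hij : i ≠ j) :
    twistedE k N l e i ^ 2 * twistedE k N l e j - (q k + (q k)⁻¹) •
      (twistedE k N l e i * twistedE k N l e j * twistedE k N l e i) +
        twistedE k N l e j * twistedE k N l e i ^ 2 = 0 := by
  have r1 := hG.tinv_mul_e i i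
  have r2 := hG.tinv_mul_e i j
  have r3 := hG.tinv_mul_e j i
  rw [qCartanInv, if_pos rfl] at r1
  rw [qCartanInv, if_neg hij] at r2
  rw [qCartanInv, if_neg hij.symm] at r3
  have r4 := hG.tinv_mul_e j j
  rw [qCartanInv, if_pos rfl] at r4
  exact serre_twist (q_mul_inv k) _ (hG.serre_e i j hij) r1 r2 r3 r4 (hG.commute_tinv j i)

/-- The element `t_i⁻¹ [h_i]_q` commutes with `f_j` up to a scalar and a multiple of `f_j`. -/
theorem tinv_qnumber_mul_f {i j : Fin 2} (hij : i ≠ j) :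
    qpow k N (-cartanH l i) * qnumber k N (cartanH l i) * f j =
      (q k)⁻¹ ^ 2 • (f j * (qpow k N (-cartanH l i) * qnumber k N (cartanH l i))) +
        (q k)⁻¹ • f j := by
  rw [mul_assoc, hG.qnumber_mul_f hij, ← mul_assoc, hG.tinv_mul_f, qCartan, if_neg hij,
    smul_mul_assoc, mul_assoc, mul_add, mul_smul_comm, hG.tinv_mul_t, mul_add, mul_one,
    mul_smul_comm, smul_add, smul_smul, pow_two]

theorem tinv_qnumber_mul_twistedE {i j : Fin 2} (hij : i ≠ j) :
    qpow k N (-cartanH l i) * qnumber k N (cartanH l i) * twistedE k N l e j =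
      q k ^ 2 • (twistedE k N l e j * (qpow k N (-cartanH l i) * qnumber k N (cartanH l i))) -
        q k • twistedE k N l e j := by
  have h1 : qnumber k N (cartanH l i) * qpow k N (-cartanH l j) =
      qpow k N (-cartanH l j) * qnumber k N (cartanH l i) := by
    have h0 : -cartanH l j * cartanH l i = cartanH l i * -cartanH l j :=
      (hG.commute_h j i).neg_left.eq
    exact qnumber_semiconj hG.X_pow (qpow_semiconj hG.X_pow h0).symm
  have h2 : qpow k N (-cartanH l i) * qnumber k N (cartanH l i) * e j =
      q k ^ 2 • (e j * (qpow k N (-cartanH l i) * qnumber k N (cartanH l i))) - q k • e j := by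
    rw [mul_assoc, hG.qnumber_mul_e hij, ← mul_assoc, hG.tinv_mul_e, qCartanInv, if_neg hij,
      smul_mul_assoc, mul_assoc, mul_sub, mul_smul_comm, hG.tinv_mul_t, mul_sub, mul_one,
      mul_smul_comm, smul_sub, smul_smul, pow_two]
  have h3 : qpow k N (-cartanH l i) * qnumber k N (cartanH l i) * qpow k N (-cartanH l j) =
      qpow k N (-cartanH l j) * (qpow k N (-cartanH l i) * qnumber k N (cartanH l i)) := by
    rw [mul_assoc, h1, ← mul_assoc, hG.commute_tinv, mul_assoc]
  rw [twistedE, mul_neg, mul_smul_comm, ← mul_assoc, h3, mul_assoc, h2, mul_sub, mul_smul_comm,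
    mul_smul_comm, ← mul_assoc, neg_mul, smul_mul_assoc, smul_sub, smul_neg, smul_neg,
    smul_comm (q k) (q k ^ 2), neg_sub, sub_neg_eq_add, neg_add_eq_sub, mul_assoc]

theorem coidealGen_serre {i j : Fin 2} (hij : i ≠ j) :
    coidealGen k N f l e i ^ 2 * coidealGen k N f l e j - (q k + (q k)⁻¹) •
      (coidealGen k N f l e i * coidealGen k N f l e j * coidealGen k N f l e i) +
        coidealGen k N f l e j * coidealGen k N f l e i ^ 2 = -coidealGen k N f l e j :=
  inhomogeneous_serre (q_mul_inv k) (hG.serre_f i j hij) (hG.twistedE_serre hij)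
    (hG.twistedE_mul_f hij) (hG.twistedE_mul_f hij.symm) (hG.twistedE_mul_f_self i)
    (hG.tinv_qnumber_mul_f hij) (hG.tinv_qnumber_mul_twistedE hij)

end IsGLTriple

end Triple

/-! ### The coproduct and the counit -/

section Tensor

variable {k : Type u} [Field k] [CharZero k] {B : Type*} [Ring B] [Algebra k⟦X⟧ B]
  {N : ℕ} {f : Fin 2 → B} {l : Fin 3 → B} {e : Fin 2 → B}

theorem qnumber_add (hB : (PowerSeries.X ^ N : k⟦X⟧) • (1 : B) = 0) {a b : B} (hab : Commute a b) :
    qnumber k N (a + b) = qnumber k N a * qpow k N (-b) + qpow k N a * qnumber k N b := by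
  simp only [qnumber, qdiff_add hB hab, smul_add, smul_mul_assoc, mul_smul_comm]

theorem qnumber_map {B' : Type*} [Ring B'] [Algebra k⟦X⟧ B'] (φ : B →ₐ[k⟦X⟧] B') (a : B) :
    φ (qnumber k N a) = qnumber k N (φ a) := by
  rw [qnumber, map_smul, qdiff_map, qnumber]

namespace IsGLTriple

variable (hG : IsGLTriple k N f l e)
include hG

theorem e_mul_tinv (i j : Fin 2) : e j * qpow k N (-cartanH l i) =
    qCartan k i j • (qpow k N (-cartanH l i) * e j) := by
  rw [hG.tinv_mul_e, smul_smul, qCartan_mul_inv, one_smul]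

theorem l_mul_t (j : Fin 3) (i : Fin 2) :
    l j * qpow k N (cartanH l i) = qpow k N (cartanH l i) * l j :=
  (qpow_semiconj hG.X_pow ((hG.commute_l _ _).sub_left (hG.commute_l _ _)).eq).symm

theorem l_mul_tinv (j : Fin 3) (i : Fin 2) :
    l j * qpow k N (-cartanH l i) = qpow k N (-cartanH l i) * l j :=
  (qpow_semiconj hG.X_pow ((hG.commute_l _ _).sub_left (hG.commute_l _ _)).neg_left.eq).symm

theorem t_mul_f_tmul (i j : Fin 2) :
    (qpow k N (cartanH l i) * f j) ⊗ₜ[k⟦X⟧] (e i * qpow k N (-cartanH l j)) =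
      (f j * qpow k N (cartanH l i)) ⊗ₜ[k⟦X⟧] (qpow k N (-cartanH l j) * e i) := by
  rw [hG.t_mul_f, hG.e_mul_tinv, TensorProduct.smul_tmul_smul, qCartan_comm j i, mul_comm,
    qCartan_mul_inv, one_smul]

theorem tensor_X_pow : (PowerSeries.X ^ N : k⟦X⟧) • (1 : B ⊗[k⟦X⟧] B) = 0 := by
  rw [Algebra.TensorProduct.one_def, TensorProduct.smul_tmul', hG.X_pow, TensorProduct.zero_tmul]

theorem qnumber_tensor (i : Fin 2) :
    qnumber k N (cartanH (fun j => l j ⊗ₜ[k⟦X⟧] (1 : B) + (1 : B) ⊗ₜ[k⟦X⟧] l j) i) =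
      qnumber k N (cartanH l i) ⊗ₜ qpow k N (-cartanH l i) +
        qpow k N (cartanH l i) ⊗ₜ qnumber k N (cartanH l i) := by
  have h1 : cartanH (fun j => l j ⊗ₜ[k⟦X⟧] (1 : B) + (1 : B) ⊗ₜ[k⟦X⟧] l j) i =
      (Algebra.TensorProduct.includeLeft : B →ₐ[k⟦X⟧] B ⊗[k⟦X⟧] B) (cartanH l i) +
        (Algebra.TensorProduct.includeRight : B →ₐ[k⟦X⟧] B ⊗[k⟦X⟧] B) (cartanH l i) := by
    simp [cartanH, TensorProduct.sub_tmul, TensorProduct.tmul_sub]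
    abel
  rw [h1, qnumber_add hG.tensor_X_pow, ← qnumber_map, ← map_neg, ← qpow_map, ← qpow_map,
    ← qnumber_map]
  · simp
  · simp [Commute, SemiconjBy]

/-- The coproduct of the generators satisfies the defining relations. -/
theorem tensor : IsGLTriple k N
    (fun i => f i ⊗ₜ[k⟦X⟧] qpow k N (-cartanH l i) + (1 : B) ⊗ₜ[k⟦X⟧] f i)
    (fun j => l j ⊗ₜ[k⟦X⟧] (1 : B) + (1 : B) ⊗ₜ[k⟦X⟧] l j)
    (fun i => e i ⊗ₜ[k⟦X⟧] (1 : B) + qpow k N (cartanH l i) ⊗ₜ[k⟦X⟧] e i) where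
  X_pow := hG.tensor_X_pow
  l_f i j := by
    have h := hG.l_f i j
    rw [sub_eq_iff_eq_add] at h
    simp only [mul_add, add_mul, Algebra.TensorProduct.tmul_mul_tmul, one_mul, mul_one, h,
      TensorProduct.add_tmul, TensorProduct.tmul_add, hG.l_mul_tinv, smul_add,
      TensorProduct.smul_tmul', TensorProduct.tmul_smul]
    abel
  l_l i j := by
    simp only [mul_add, add_mul, Algebra.TensorProduct.tmul_mul_tmul, one_mul, mul_one, hG.l_l i j]
    abel
  l_e i j := by
    have h := hG.l_e i j
    rw [sub_eq_iff_eq_add] at h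
    simp only [mul_add, add_mul, Algebra.TensorProduct.tmul_mul_tmul, one_mul, mul_one, h,
      TensorProduct.add_tmul, TensorProduct.tmul_add, hG.l_mul_t, smul_add,
      TensorProduct.smul_tmul', TensorProduct.tmul_smul]
    abel
  e_f i j := by
    have h := hG.e_f i j
    have h2 := hG.qnumber_tensor i
    simp only [cartanH] at h2
    rw [sub_eq_iff_eq_add] at h
    rw [h2]
    simp only [mul_add, add_mul, Algebra.TensorProduct.tmul_mul_tmul, one_mul, mul_one, h,
      TensorProduct.add_tmul, TensorProduct.tmul_add, hG.t_mul_f_tmul]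
    by_cases hij : i = j
    · subst hij
      simp only [kron, if_true, one_smul, cartanH]
      abel
    · simp only [kron, if_neg hij, zero_smul, TensorProduct.zero_tmul, TensorProduct.tmul_zero]
      abel
  serre_e i j hij := by
    refine serre_add (q_mul_inv k) ?_ ?_ ?_ ?_ ?_
    · have := congrArg (fun x => x ⊗ₜ[k⟦X⟧] (1 : B)) (hG.serre_e i j hij)
      simpa [TensorProduct.sub_tmul, TensorProduct.add_tmul, pow_two, TensorProduct.smul_tmul']
        using this
    · have := congrArg (fun x => (qpow k N (cartanH l i) * qpow k N (cartanH l i) *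
        qpow k N (cartanH l j)) ⊗ₜ[k⟦X⟧] x) (hG.serre_e i j hij)
      simp only [TensorProduct.tmul_zero, TensorProduct.tmul_sub, TensorProduct.tmul_add,
        TensorProduct.tmul_smul] at this
      rw [← this]
      simp only [pow_two, Algebra.TensorProduct.tmul_mul_tmul]
      have hc : Commute (qpow k N (cartanH l j)) (qpow k N (cartanH l i)) := hG.commute_t j i
      have h1 : qpow k N (cartanH l i) * qpow k N (cartanH l j) * qpow k N (cartanH l i) =
          qpow k N (cartanH l i) * qpow k N (cartanH l i) * qpow k N (cartanH l j) := by
        rw [mul_assoc, hc.eq, mul_assoc]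
      rw [h1, (hc.mul_right hc).eq]
    · simp only [Algebra.TensorProduct.tmul_mul_tmul, one_mul, mul_one, hG.t_mul_e, qCartan,
        if_true, TensorProduct.smul_tmul']
    · simp only [Algebra.TensorProduct.tmul_mul_tmul, one_mul, mul_one, hG.t_mul_e, qCartan,
        if_neg hij, TensorProduct.smul_tmul']
    · simp only [Algebra.TensorProduct.tmul_mul_tmul, one_mul, mul_one, hG.t_mul_e, qCartan,
        if_neg hij.symm, TensorProduct.smul_tmul']
  serre_f i j hij := by
    simp only [add_comm _ ((1 : B) ⊗ₜ[k⟦X⟧] _)]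
    refine serre_add (q_mul_inv k) ?_ ?_ ?_ ?_ ?_
    · have := congrArg (fun x => (1 : B) ⊗ₜ[k⟦X⟧] x) (hG.serre_f i j hij)
      simpa [TensorProduct.tmul_sub, TensorProduct.tmul_add, pow_two] using this
    · have := congrArg (fun x => x ⊗ₜ[k⟦X⟧] (qpow k N (-cartanH l i) * qpow k N (-cartanH l i) *
        qpow k N (-cartanH l j))) (hG.serre_f i j hij)
      simp only [TensorProduct.zero_tmul, TensorProduct.sub_tmul, TensorProduct.add_tmul,
        ← TensorProduct.smul_tmul'] at this
      rw [← this]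
      simp only [pow_two, Algebra.TensorProduct.tmul_mul_tmul]
      have hc : Commute (qpow k N (-cartanH l j)) (qpow k N (-cartanH l i)) := hG.commute_tinv j i
      have h1 : qpow k N (-cartanH l i) * qpow k N (-cartanH l j) * qpow k N (-cartanH l i) =
          qpow k N (-cartanH l i) * qpow k N (-cartanH l i) * qpow k N (-cartanH l j) := by
        rw [mul_assoc, hc.eq, mul_assoc]
      rw [h1, (hc.mul_right hc).eq]
    · simp only [Algebra.TensorProduct.tmul_mul_tmul, one_mul, mul_one, hG.tinv_mul_f, qCartan,
        if_true, TensorProduct.tmul_smul]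
    · simp only [Algebra.TensorProduct.tmul_mul_tmul, one_mul, mul_one, hG.tinv_mul_f, qCartan,
        if_neg hij, TensorProduct.tmul_smul]
    · simp only [Algebra.TensorProduct.tmul_mul_tmul, one_mul, mul_one, hG.tinv_mul_f, qCartan,
        if_neg hij.symm, TensorProduct.tmul_smul]

end IsGLTriple

end Tensor

section Coproduct

variable {k : Type u} [Field k] [CharZero k]

theorem red_proj (N : ℕ) : (red k N).comp (Ugl.proj k) = freeTopHom (UglMod_X_pow N)
    (genValues (fun i => red k N (f k i)) (fun j => red k N (l k j)) fun i => red k N (e k i)) :=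
  freeTop_algHom_ext (UglMod_X_pow N) _ _ (by
    rintro (i | i | i) <;> rw [freeTopHom_const, freeHom_ι] <;> rfl)

theorem red_proj_expH (N : ℕ) (a : FreeAlgebra k Gen) : red k N (Ugl.proj k (FreeTop.expH a)) =
    qpow k N (freeHom (k := k) (genValues (fun i => red k N (f k i)) (fun j => red k N (l k j))
      fun i => red k N (e k i)) a) :=
  (DFunLike.congr_fun (red_proj N) _).trans (freeTopHom_expH _ _ _)

theorem red_t (N : ℕ) (i : Fin 2) :
    red k N (t k i) = qpow k N (cartanH (fun j => red k N (l k j)) i) := by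
  rw [t, red_proj_expH, hFree, map_sub, freeHom_ι, freeHom_ι]
  rfl

theorem red_tinv (N : ℕ) (i : Fin 2) :
    red k N (tinv k i) = qpow k N (-cartanH (fun j => red k N (l k j)) i) := by
  rw [tinv, red_proj_expH, hFree, map_neg, map_sub, freeHom_ι, freeHom_ι]
  rfl

theorem red_g (N : ℕ) (j : Fin 3) : red k N (g k j) = qpow k N (red k N (l k j)) := by
  rw [g, red_proj_expH, freeHom_ι]
  rfl

theorem red_ginv (N : ℕ) (j : Fin 3) : red k N (ginv k j) = qpow k N (-red k N (l k j)) := by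
  rw [ginv, red_proj_expH, map_neg, freeHom_ι]
  rfl

/-- The generators of `U_ħ(gl_3) / ħ^N` satisfy the defining relations. -/
theorem isGLTriple_red (N : ℕ) : IsGLTriple k N (fun i => red k N (f k i))
    (fun j => red k N (l k j)) (fun i => red k N (e k i)) := by
  have key : ∀ x, Relator k x → freeTopHom (UglMod_X_pow N) (genValues (fun i => red k N (f k i))
      (fun j => red k N (l k j)) fun i => red k N (e k i)) x = 0 := fun x hx => by
    rw [← red_proj, AlgHom.comp_apply]
    have : Ugl.proj k x = 0 := Ideal.Quotient.eq_zero_iff_mem.2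
      ((TwoSidedIdeal.mem_sInf _).2 fun I hI => hI.1 x hx)
    rw [this, map_zero]
  constructor
  · exact UglMod_X_pow N
  · intro i j
    have := key _ (.l_f i j)
    simpa only [map_sub, map_mul, map_smul, fT, lT, freeTopHom_const, freeHom_ι, genValues,
      sub_eq_zero] using this
  · intro i j
    have := key _ (.l_l i j)
    simpa only [map_sub, map_mul, lT, freeTopHom_const, freeHom_ι, genValues,
      sub_eq_zero] using this
  · intro i j
    have := key _ (.l_e i j)
    simpa only [map_sub, map_mul, map_smul, eT, lT, freeTopHom_const, freeHom_ι, genValues,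
      sub_eq_zero] using this
  · intro i j
    have := key _ (.e_f i j)
    rw [map_sub, sub_eq_zero] at this
    simpa only [map_sub, map_mul, map_smul, eT, fT, freeTopHom_const, freeHom_ι, genValues,
      freeTopHom_qnum, hFree, qnumber] using this
  · intro i j hij
    have := key _ (.serre_e i j hij)
    simpa only [map_sub, map_add, map_mul, map_pow, map_smul, eT, freeTopHom_const, freeHom_ι,
      genValues] using this
  · intro i j hij
    have := key _ (.serre_f i j hij)
    simpa only [map_sub, map_add, map_mul, map_pow, map_smul, fT, freeTopHom_const, freeHom_ι,
      genValues] using this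

/-- The coproduct modulo `ħ^N`. -/
def comulMod (N : ℕ) : UglMod k N →ₐ[k⟦X⟧] UglMod k N ⊗[k⟦X⟧] UglMod k N :=
  (isGLTriple_red N).tensor.homMod

theorem comulMod_f (N : ℕ) (i : Fin 2) : comulMod N (red k N (f k i)) =
    red k N (f k i) ⊗ₜ red k N (tinv k i) + 1 ⊗ₜ red k N (f k i) := by
  rw [comulMod, IsGLTriple.homMod_red, IsGLTriple.hom_f, red_tinv]

theorem comulMod_l (N : ℕ) (i : Fin 3) : comulMod N (red k N (l k i)) =
    red k N (l k i) ⊗ₜ 1 + 1 ⊗ₜ red k N (l k i) := by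
  rw [comulMod, IsGLTriple.homMod_red, IsGLTriple.hom_l]

theorem comulMod_e (N : ℕ) (i : Fin 2) : comulMod N (red k N (e k i)) =
    red k N (e k i) ⊗ₜ 1 + red k N (t k i) ⊗ₜ red k N (e k i) := by
  rw [comulMod, IsGLTriple.homMod_red, IsGLTriple.hom_e, red_t]

theorem trans_red (N : ℕ) (x : Ugl k) : trans k N (red k (N + 1) x) = red k N x := rfl

/-- The ring homomorphism from the free algebra to `k` killing the generators, applied to
coefficients. -/
def counitFree : FreeTop k →ₐ[k⟦X⟧] k⟦X⟧ where
  toRingHom := (PowerSeries.map (FreeAlgebra.lift k (fun _ : Gen => (0 : k))).toRingHom :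
    PowerSeries (FreeAlgebra k Gen) →+* k⟦X⟧)
  commutes' c := by
    change PowerSeries.map _ (PowerSeries.map (algebraMap k (FreeAlgebra k Gen)) c) = c
    ext n
    simp

omit [CharZero k] in
theorem counitFree_const (a : FreeAlgebra k Gen) : counitFree (FreeTop.const a) =
    PowerSeries.C (FreeAlgebra.lift k (fun _ : Gen => (0 : k)) a) :=
  PowerSeries.map_C _ _

omit [CharZero k] in
theorem counitFree_ι (s : Gen) : counitFree (FreeTop.const (FreeAlgebra.ι k s)) = 0 := by
  rw [counitFree_const, FreeAlgebra.lift_ι_apply, map_zero]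

theorem counitFree_qnum (a : FreeAlgebra k Gen)
    (ha : FreeAlgebra.lift k (fun _ : Gen => (0 : k)) a = 0) :
    counitFree (FreeTop.qnum a) = 0 := by
  rw [FreeTop.qnum, map_smul]
  refine smul_eq_zero_of_right _ ?_
  have h : ∀ p p' : PowerSeries (FreeAlgebra k Gen),
      (∀ n, FreeAlgebra.lift k (fun _ : Gen => (0 : k)) (PowerSeries.coeff n p) =
        FreeAlgebra.lift k (fun _ : Gen => (0 : k)) (PowerSeries.coeff n p')) →
      PowerSeries.map (FreeAlgebra.lift k (fun _ : Gen => (0 : k))).toRingHom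
          (divH (p - p')) = 0 := by
    intro p p' hp
    ext n
    simp [divH, hp]
  exact h _ _ fun n => by simp [FreeTop.expH, ha]

/-- The counit. -/
def counitHom : Ugl k →ₐ[k⟦X⟧] k⟦X⟧ :=
  Ideal.Quotient.liftₐ (relIdeal k).asIdeal counitFree fun _ hx =>
    relIdeal_le_ker _ (fun x hx => by
      ext n
      obtain ⟨y, rfl⟩ := hx (n + 1)
      rw [smul_eq_mul, PowerSeries.coeff_X_pow_mul', if_neg (by omega), map_zero])
      (fun x hx => by
        cases hx <;> simp only [map_sub, map_add, map_mul, map_smul, map_pow, fT, lT, eT,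
          counitFree_ι]
        case e_f => rw [counitFree_qnum _ (by simp [hFree])]; simp
        all_goals simp) hx

theorem counitHom_const (s : Gen) :
    counitHom (Ugl.proj k (FreeTop.const (FreeAlgebra.ι k s))) = 0 := counitFree_ι s

instance : Inhabited (CoproductCounit k) where
  default :=
    { comul := comulMod
      comul_trans := fun N x => by
        refine DFunLike.congr_fun (UglMod_algHom_ext
          ((Algebra.TensorProduct.map (trans k N) (trans k N)).comp (comulMod (N + 1)))
          ((comulMod N).comp (trans k N)) (fun i => ?_) (fun i => ?_) fun i => ?_) x
        · simp only [AlgHom.comp_apply, trans_red, comulMod_f, map_add,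
            Algebra.TensorProduct.map_tmul, map_one]
        · simp only [AlgHom.comp_apply, trans_red, comulMod_l, map_add,
            Algebra.TensorProduct.map_tmul, map_one]
        · simp only [AlgHom.comp_apply, trans_red, comulMod_e, map_add,
            Algebra.TensorProduct.map_tmul, map_one]
      comul_f := comulMod_f
      comul_l := comulMod_l
      comul_e := comulMod_e
      counit := counitHom
      counit_f := fun _ => counitHom_const _
      counit_l := fun _ => counitHom_const _
      counit_e := fun _ => counitHom_const _ }

theorem coproductCounit_ext (H H' : CoproductCounit k) : H = H' := by
  have h1 : H.comul = H'.comul := by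
    funext N
    refine UglMod_algHom_ext _ _ (fun i => ?_) (fun i => ?_) fun i => ?_
    · rw [H.comul_f, H'.comul_f]
    · rw [H.comul_l, H'.comul_l]
    · rw [H.comul_e, H'.comul_e]
  have h2 : H.counit = H'.counit := by
    ext x n
    obtain ⟨x, rfl⟩ := proj_surjective x
    let φ := Ideal.Quotient.mkₐ k⟦X⟧ (Ideal.span {(PowerSeries.X ^ (n + 1) : k⟦X⟧)})
    have h := DFunLike.congr_fun (freeTop_algHom_ext (N := n + 1)
      (by
        rw [← map_one φ, ← map_smul]
        exact Ideal.Quotient.eq_zero_iff_mem.2 (by simp))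
      (φ.comp (H.counit.comp (Ugl.proj k))) (φ.comp (H'.counit.comp (Ugl.proj k))) (by
        rintro (i | i | i)
        · exact congrArg φ ((H.counit_f i).trans (H'.counit_f i).symm)
        · exact congrArg φ ((H.counit_l i).trans (H'.counit_l i).symm)
        · exact congrArg φ ((H.counit_e i).trans (H'.counit_e i).symm))) x
    have h' := Ideal.mem_span_singleton.1 (Ideal.Quotient.eq.1 h)
    have := PowerSeries.X_pow_dvd_iff.1 h' n n.lt_succ_self
    rwa [map_sub, sub_eq_zero] at this
  cases H
  cases H'
  congr

end Coproduct

/-! ### The generators of the coideal subalgebra -/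

section Abstract

variable {R : Type*} [CommRing R] {B : Type*} [Ring B] [Algebra R B]

theorem coidealGen_mul_group {Q Q' : R} (hQ : Q * Q' = 1) {x e a b : B} (hax : a * x = Q' • (x * a))
    (hae : a * e = Q • (e * a)) (hab : a * b = b * a) :
    (x + -(Q • (b * e))) * a = Q' • (a * (x + -(Q • (b * e)))) + (Q' * (Q - Q')) • (x * a) := by
  have a1 : ∀ z, a * (b * z) = b * (a * z) := fun z => by rw [← mul_assoc, hab, mul_assoc]
  simp only [add_mul, mul_add, neg_mul, mul_neg, smul_mul_assoc, mul_smul_comm, mul_assoc, a1,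
    hax, hae, smul_add, smul_neg, smul_smul]
  clear hax hae hab a1
  match_scalars <;> grind

theorem group_mul_coidealGen {Q Q' : R} {x e a b : B} (hbx : b * x = Q' • (x * b))
    (hbe : b * e = Q • (e * b)) (hba : b * a = a * b) :
    b * (x + -(Q • (a * e))) = Q' • ((x + -(Q • (a * e))) * b) - (Q - Q') • (a * b * e) := by
  have a1 : ∀ z, b * (a * z) = a * (b * z) := fun z => by rw [← mul_assoc, hba, mul_assoc]
  simp only [add_mul, mul_add, neg_mul, mul_neg, smul_mul_assoc, mul_smul_comm, mul_assoc, a1,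
    hbx, hbe, smul_add, smul_neg, smul_smul]
  clear hbx hbe hba a1
  match_scalars <;> grind

/-- The coproduct of a `q`-commutator of two elements whose coproducts are of the form
`1 ⊗ y + y ⊗ b`. -/
theorem tensor_qcommutator {Q' c c' : R} {x y a b d d' : B}
    (hya : y * a = Q' • (a * y) + c • d) (hbx : b * x = Q' • (x * b) - c' • d') :
    ((1 : B) ⊗ₜ[R] y + y ⊗ₜ[R] b) * ((1 : B) ⊗ₜ[R] x + x ⊗ₜ[R] a) -
      Q' • (((1 : B) ⊗ₜ[R] x + x ⊗ₜ[R] a) * ((1 : B) ⊗ₜ[R] y + y ⊗ₜ[R] b)) =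
    (1 : B) ⊗ₜ[R] (y * x - Q' • (x * y)) + ((y * x) ⊗ₜ[R] (b * a) - Q' • (x * y) ⊗ₜ[R] (a * b)) +
      c • x ⊗ₜ[R] d - c' • y ⊗ₜ[R] d' := by
  simp only [mul_add, add_mul, Algebra.TensorProduct.tmul_mul_tmul, one_mul, mul_one, hya, hbx,
    TensorProduct.tmul_add, TensorProduct.tmul_sub, TensorProduct.tmul_smul, smul_add]
  abel

end Abstract

section Coideal

variable (k : Type u) [Field k] [CharZero k]

/-- The element `f_1 - q t_1⁻¹ e_1`. -/
def so12 : Ugl k := f k 0 + -(q k • (tinv k 0 * e k 0))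

/-- The element `f_2 - q t_2⁻¹ e_2`. -/
def so23 : Ugl k := f k 1 + -(q k • (tinv k 1 * e k 1))

/-- The `q`-commutator of `so23` and `so12`. -/
def so13 : Ugl k := so23 k * so12 k - (q k)⁻¹ • (so12 k * so23 k)

variable {k}

theorem tinv_mul_e (i j : Fin 2) :
    tinv k i * e k j = qCartanInv k i j • (e k j * tinv k i) := by
  refine Ugl_ext fun N => ?_
  rw [map_mul, map_smul, map_mul, red_tinv]
  exact (isGLTriple_red N).tinv_mul_e i j

theorem tinv_mul_f (i j : Fin 2) :
    tinv k i * f k j = qCartan k i j • (f k j * tinv k i) := by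
  refine Ugl_ext fun N => ?_
  rw [map_mul, map_smul, map_mul, red_tinv]
  exact (isGLTriple_red N).tinv_mul_f i j

theorem tinv_mul_tinv (i j : Fin 2) : tinv k i * tinv k j = tinv k j * tinv k i := by
  refine Ugl_ext fun N => ?_
  rw [map_mul, map_mul, red_tinv, red_tinv]
  exact (isGLTriple_red N).commute_tinv i j

theorem tinv_mul_t (i : Fin 2) : tinv k i * t k i = 1 := by
  refine Ugl_ext fun N => ?_
  rw [map_mul, map_one, red_tinv, red_t]
  exact (isGLTriple_red N).tinv_mul_t i

theorem e_mul_f {i j : Fin 2} (hij : i ≠ j) : e k i * f k j = f k j * e k i := by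
  refine Ugl_ext fun N => ?_
  have := (isGLTriple_red (k := k) N).e_f i j
  rw [map_mul, map_mul]
  rwa [kron, if_neg hij, zero_smul, sub_eq_zero] at this

theorem ginv_mul_g (i : Fin 3) : ginv k i * g k i = 1 := by
  refine Ugl_ext fun N => ?_
  rw [map_mul, map_one, red_ginv, red_g]
  exact qpow_neg_mul_qpow (UglMod_X_pow N) _

theorem ginv_mul_g_succ (i : Fin 2) : ginv k i.castSucc * g k i.succ = tinv k i := by
  refine Ugl_ext fun N => ?_
  rw [map_mul, red_ginv, red_g, red_tinv, ← qpow_add (UglMod_X_pow N)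
    ((isGLTriple_red N).commute_l _ _).neg_left, cartanH, neg_sub, sub_eq_neg_add]

theorem g_mul_ginv (i : Fin 3) : g k i * ginv k i = 1 := by
  refine Ugl_ext fun N => ?_
  rw [map_mul, map_one, red_ginv, red_g]
  exact qpow_mul_qpow_neg (UglMod_X_pow N) _

theorem ginv_zero_mul_g_two : ginv k 0 * g k 2 = tinv k 0 * tinv k 1 := by
  have h0 : ginv k 0 * g k 1 = tinv k 0 := ginv_mul_g_succ 0
  have h1 : ginv k 1 * g k 2 = tinv k 1 := ginv_mul_g_succ 1
  rw [← h0, ← h1, mul_assoc, ← mul_assoc (g k 1), g_mul_ginv, one_mul]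

/-- The coideal version of the Serre relation: its right-hand side is linear instead of zero. -/
theorem so_serre_12 :
    so12 k ^ 2 * so23 k - (q k + (q k)⁻¹) • (so12 k * so23 k * so12 k) + so23 k * so12 k ^ 2 =
      -so23 k := by
  refine Ugl_ext fun N => ?_
  have := (isGLTriple_red (k := k) N).coidealGen_serre (zero_ne_one (α := Fin 2))
  simpa only [so12, so23, coidealGen, twistedE, map_add, map_sub, map_neg, map_smul,
    map_mul, map_pow, red_tinv] using this

theorem so_serre_23 :
    so23 k ^ 2 * so12 k - (q k + (q k)⁻¹) • (so23 k * so12 k * so23 k) + so12 k * so23 k ^ 2 =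
      -so12 k := by
  refine Ugl_ext fun N => ?_
  have := (isGLTriple_red (k := k) N).coidealGen_serre (one_ne_zero (α := Fin 2))
  simpa only [so12, so23, coidealGen, twistedE, map_add, map_sub, map_neg, map_smul,
    map_mul, map_pow, red_tinv] using this

theorem so23_mul_so12 : so23 k * so12 k = (q k)⁻¹ • (so12 k * so23 k) + so13 k := by
  rw [so13, add_sub_cancel]

theorem so23_mul_so13 : so23 k * so13 k = q k • (so13 k * so23 k) - so12 k :=
  mul_qcommutator (q_mul_inv k) so_serre_23

theorem so13_mul_so12 : so13 k * so12 k = q k • (so12 k * so13 k) - so23 k :=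
  qcommutator_mul (q_mul_inv k) so_serre_12

/-- The `q`-commutator of the two generators is, up to a power of `q`, the element `K_{1,3}`. -/
theorem so13_eq : so13 k = F31 k - ((q k)⁻¹ * (q k - (q k)⁻¹)) • (e k 0 * tinv k 0 * f k 1) -
    (q k)⁻¹ ^ 2 • (E13 k * (tinv k 0 * tinv k 1)) := by
  have h := coideal_qcommutator (q_mul_inv k) (x := f k 0) (y := f k 1) (d := e k 0) (e := e k 1)
    (a := tinv k 0) (b := tinv k 1) (e_mul_f (by decide)) (e_mul_f (by decide))
    (tinv_mul_f 0 1) (tinv_mul_f 1 0) (tinv_mul_e 0 0) (tinv_mul_e 0 1) (tinv_mul_e 1 0)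
    (tinv_mul_e 1 1) (tinv_mul_tinv 1 0)
  have h' := congrArg (fun x => -((q k)⁻¹ • x)) h
  simp only [smul_neg, neg_neg, smul_smul _ _ (f k 1 * f k 0 - _ - _ - _), mul_comm _ (q k),
    q_mul_inv, one_smul] at h'
  rw [F31, E13, ← h', so13, so12, so23]
  rw [smul_sub, smul_smul, mul_comm _ (q k), q_mul_inv, one_smul, neg_sub]

theorem K12_eq : K12 k = q k ^ 2 • so12 k := by
  have h1 : ginv k 0 * g k 1 = tinv k 0 := ginv_mul_g_succ 0
  have h2 : e k 0 * tinv k 0 = q k ^ 2 • (tinv k 0 * e k 0) := by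
    rw [tinv_mul_e, smul_smul, show q k ^ 2 = qCartan k 0 0 from rfl, qCartan_mul_inv, one_smul]
  rw [K12, LP12, LM21, ← mul_assoc, ginv_mul_g, one_mul, neg_mul, mul_assoc, h1, h2, so12,
    smul_add, smul_neg, smul_neg, smul_comm]

theorem K23_eq : K23 k = q k • so23 k := by
  have h1 : ginv k 1 * g k 2 = tinv k 1 := ginv_mul_g_succ 1
  have h2 : e k 1 * tinv k 1 = q k ^ 2 • (tinv k 1 * e k 1) := by
    rw [tinv_mul_e, smul_smul, show q k ^ 2 = qCartan k 1 1 from rfl, qCartan_mul_inv, one_smul]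
  rw [K23, LP23, LM32, ← mul_assoc, ginv_mul_g, one_mul, neg_mul, mul_assoc, h1, h2, so23,
    smul_add, smul_neg, smul_smul, pow_two]

theorem K13_eq : K13 k = q k ^ 2 • so13 k := by
  have h1 : ginv k 0 * g k 1 = tinv k 0 := ginv_mul_g_succ 0
  have hq := q_mul_inv k
  have c1 : q k ^ 2 * ((q k)⁻¹ * (q k - (q k)⁻¹)) = q k * qd k := by rw [qd]; grind
  have c2 : q k ^ 2 * (q k)⁻¹ ^ 2 = 1 := by grind
  rw [K13, LP13, LP23, LM21, LM31, ← mul_assoc, ginv_mul_g, one_mul, neg_mul, neg_mul, mul_assoc,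
    ← mul_assoc (ginv k 0), h1, mul_assoc (E13 k), ginv_zero_mul_g_two, so13_eq, smul_sub, smul_sub,
    smul_smul, smul_smul, c1, c2, one_smul, smul_neg, mul_assoc (e k 0)]
  abel

theorem k12_eq : k12 k = qd k • so12 k := by
  have hq := q_mul_inv k
  rw [k12, K12_eq, smul_smul]
  congr 1
  grind

theorem k23_eq : k23 k = qd k • so23 k := by
  have hq := q_mul_inv k
  rw [k23, K23_eq, smul_smul]
  congr 1
  grind

theorem k13_eq : k13 k = qd k • so13 k := by
  have hq := q_mul_inv k
  rw [k13, K13_eq, smul_smul]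
  congr 1
  grind

theorem so23_mul_tinv : so23 k * tinv k 0 =
    (q k)⁻¹ • (tinv k 0 * so23 k) + ((q k)⁻¹ * qd k) • (f k 1 * tinv k 0) :=
  coidealGen_mul_group (q_mul_inv k) (tinv_mul_f 0 1) (tinv_mul_e 0 1) (tinv_mul_tinv 0 1)

theorem tinv_mul_so12 : tinv k 1 * so12 k =
    (q k)⁻¹ • (so12 k * tinv k 1) - qd k • (tinv k 0 * tinv k 1 * e k 0) :=
  group_mul_coidealGen (tinv_mul_f 1 0) (tinv_mul_e 1 0) (tinv_mul_tinv 1 0)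

namespace CoproductCounit

variable (H : CoproductCounit k) (N : ℕ)

theorem comul_qpow {y : UglMod k N}
    (hx : H.comul N y = y ⊗ₜ 1 + 1 ⊗ₜ y) :
    H.comul N (qpow k N y) = qpow k N y ⊗ₜ qpow k N y := by
  rw [qpow_map, hx]
  have h1 : y ⊗ₜ[k⟦X⟧] (1 : UglMod k N) =
      (Algebra.TensorProduct.includeLeft : UglMod k N →ₐ[k⟦X⟧] _) y := rfl
  have h2 : (1 : UglMod k N) ⊗ₜ[k⟦X⟧] y =
      (Algebra.TensorProduct.includeRight : UglMod k N →ₐ[k⟦X⟧] _) y := rfl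
  rw [h1, h2, qpow_add (isGLTriple_red N).tensor_X_pow, ← qpow_map, ← qpow_map]
  · simp
  · simp [Commute, SemiconjBy]

theorem comul_cartanH (i : Fin 2) : H.comul N (cartanH (fun j => red k N (l k j)) i) =
    cartanH (fun j => red k N (l k j)) i ⊗ₜ 1 + 1 ⊗ₜ cartanH (fun j => red k N (l k j)) i := by
  simp only [cartanH, map_sub, comul_l, TensorProduct.sub_tmul, TensorProduct.tmul_sub]
  abel

theorem comul_t (i : Fin 2) :
    H.comul N (red k N (t k i)) = red k N (t k i) ⊗ₜ red k N (t k i) := by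
  rw [red_t]
  exact H.comul_qpow N (H.comul_cartanH N i)

theorem comul_tinv (i : Fin 2) :
    H.comul N (red k N (tinv k i)) = red k N (tinv k i) ⊗ₜ red k N (tinv k i) := by
  rw [red_tinv]
  refine H.comul_qpow N ?_
  rw [map_neg, H.comul_cartanH, TensorProduct.neg_tmul, TensorProduct.tmul_neg, neg_add]

theorem comul_coidealGen (i : Fin 2) :
    H.comul N (red k N (f k i + -(q k • (tinv k i * e k i)))) =
      1 ⊗ₜ red k N (f k i + -(q k • (tinv k i * e k i))) +
        red k N (f k i + -(q k • (tinv k i * e k i))) ⊗ₜ red k N (tinv k i) := by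
  have h : red k N (tinv k i) * red k N (t k i) = 1 := by
    rw [← map_mul, tinv_mul_t, map_one]
  simp only [map_add, map_neg, map_smul, map_mul, comul_f, comul_e, comul_tinv, mul_add,
    Algebra.TensorProduct.tmul_mul_tmul, h, mul_one, TensorProduct.add_tmul, TensorProduct.tmul_add,
    TensorProduct.neg_tmul, TensorProduct.tmul_neg, TensorProduct.tmul_smul, smul_add, neg_add,
    TensorProduct.smul_tmul']
  abel

theorem comul_so12 : H.comul N (red k N (so12 k)) =
    1 ⊗ₜ red k N (so12 k) + red k N (so12 k) ⊗ₜ red k N (tinv k 0) :=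
  H.comul_coidealGen N 0

theorem comul_so23 : H.comul N (red k N (so23 k)) =
    1 ⊗ₜ red k N (so23 k) + red k N (so23 k) ⊗ₜ red k N (tinv k 1) :=
  H.comul_coidealGen N 1

theorem comul_so13 : H.comul N (red k N (so13 k)) =
    1 ⊗ₜ red k N (so13 k) + red k N (so13 k) ⊗ₜ red k N (tinv k 0 * tinv k 1)
      + ((q k)⁻¹ * qd k) • (red k N (so12 k) ⊗ₜ red k N (f k 1 * tinv k 0))
      - qd k • (red k N (so23 k) ⊗ₜ red k N (tinv k 0 * tinv k 1 * e k 0)) := by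
  have h1 := congrArg (red k N) (so23_mul_tinv (k := k))
  have h2 := congrArg (red k N) (tinv_mul_so12 (k := k))
  simp only [map_add, map_sub, map_mul, map_smul] at h1 h2
  have h3 : red k N (tinv k 1) * red k N (tinv k 0) = red k N (tinv k 0) * red k N (tinv k 1) := by
    rw [← map_mul, tinv_mul_tinv, map_mul]
  rw [so13, map_sub, map_smul, map_mul, map_mul, map_sub, map_smul, map_mul, map_mul, comul_so12,
    comul_so23, tensor_qcommutator h1 h2, h3]
  simp only [map_mul, TensorProduct.sub_tmul, TensorProduct.smul_tmul']

end CoproductCounit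

end Coideal

/-! ### Ordered monomials in three elements with quadratic relations -/

section OrderedMonomials

variable {R : Type*} [CommRing R] {A : Type*} [Ring A] [Algebra R A]

/-- The ordered monomial `x^a y^b z^c`. -/
def ordMon (x y z : A) (p : ℕ × ℕ × ℕ) : A := x ^ p.1 * y ^ p.2.1 * z ^ p.2.2

/-- The total degree `a + b + c`. -/
def deg (p : ℕ × ℕ × ℕ) : ℕ := p.1 + p.2.1 + p.2.2

variable (R) in
/-- The span of the ordered monomials of degree less than `m`. -/
def lowSpan (x y z : A) (m : ℕ) : Submodule R A :=
  Submodule.span R (ordMon x y z '' {p | deg p < m})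

variable (R) in
/-- Relations that allow the reordering of products of `x`, `y`, `z`. -/
structure Reorders (x y z : A) : Prop where
  zx : ∃ a b : R, z * x = a • (x * z) + b • y
  zy : ∃ a b : R, z * y = a • (y * z) + b • x
  yx : ∃ a b : R, y * x = a • (x * y) + b • z

variable {x y z : A}

theorem ordMon_zero : ordMon x y z (0, 0, 0) = 1 := by simp [ordMon]

theorem ordMon_succ_x (a b c : ℕ) :
    ordMon x y z (a + 1, b, c) = x * ordMon x y z (a, b, c) := by
  simp [ordMon, pow_succ', mul_assoc]

theorem ordMon_succ_y (b c : ℕ) :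
    ordMon x y z (0, b + 1, c) = y * ordMon x y z (0, b, c) := by
  simp [ordMon, pow_succ', mul_assoc]

theorem ordMon_succ_z (c : ℕ) :
    ordMon x y z (0, 0, c + 1) = z * ordMon x y z (0, 0, c) := by
  simp [ordMon, pow_succ']

theorem ordMon_map {A' : Type*} [Ring A'] [Algebra R A'] (φ : A →ₐ[R] A') (p : ℕ × ℕ × ℕ) :
    φ (ordMon x y z p) = ordMon (φ x) (φ y) (φ z) p := by
  simp [ordMon]

theorem ordMon_mem_lowSpan {p : ℕ × ℕ × ℕ} {m : ℕ} (h : deg p < m) :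
    ordMon x y z p ∈ lowSpan R x y z m :=
  Submodule.subset_span ⟨p, h, rfl⟩

theorem lowSpan_mono {m n : ℕ} (h : m ≤ n) : lowSpan R x y z m ≤ lowSpan R x y z n :=
  Submodule.span_mono (Set.image_mono fun _ hp => lt_of_lt_of_le hp h)

theorem mul_mem_of_ordMon {w : A} {m : ℕ} {S : Submodule R A}
    (h : ∀ p, deg p < m → w * ordMon x y z p ∈ S) {v : A} (hv : v ∈ lowSpan R x y z m) :
    w * v ∈ S := by
  have : lowSpan R x y z m ≤ S.comap (LinearMap.mulLeft R w) := by
    refine Submodule.span_le.2 ?_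
    rintro _ ⟨p, hp, rfl⟩
    exact h p hp
  exact this hv

theorem x_mul_mem_lowSpan {m : ℕ} {v : A} (hv : v ∈ lowSpan R x y z m) :
    x * v ∈ lowSpan R x y z (m + 1) :=
  mul_mem_of_ordMon (fun ⟨a, b, c⟩ hp => by
    rw [← ordMon_succ_x]
    refine ordMon_mem_lowSpan ?_
    simp only [deg] at hp ⊢
    omega) hv

/-- Left multiplication by `y` or `z` raises the degree by at most one. The two claims are proved
together, since reordering one product produces products of the other kind, of lower degree. -/
theorem Reorders.mul_ordMon_mem (hR : Reorders R x y z) (m : ℕ) : ∀ p, deg p < m →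
    y * ordMon x y z p ∈ lowSpan R x y z (m + 1) ∧
      z * ordMon x y z p ∈ lowSpan R x y z (m + 1) := by
  obtain ⟨a1, b1, h1⟩ := hR.zx
  obtain ⟨a2, b2, h2⟩ := hR.zy
  obtain ⟨a3, b3, h3⟩ := hR.yx
  induction m with
  | zero => intro p hp; omega
  | succ m ih =>
    have hy : ∀ p, deg p < m + 1 → y * ordMon x y z p ∈ lowSpan R x y z (m + 2) := by
      rintro ⟨_ | a, b, c⟩ hp
      · rw [← ordMon_succ_y]
        refine ordMon_mem_lowSpan ?_
        simp only [deg] at hp ⊢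
        omega
      · have hp' : deg (a, b, c) < m := by
          simp only [deg] at hp ⊢
          omega
        rw [ordMon_succ_x, ← mul_assoc, h3, add_mul, smul_mul_assoc, smul_mul_assoc, mul_assoc]
        exact add_mem (Submodule.smul_mem _ _ (x_mul_mem_lowSpan (ih _ hp').1))
          (Submodule.smul_mem _ _ (lowSpan_mono (by omega) (ih _ hp').2))
    refine fun p hp => ⟨hy p hp, ?_⟩
    obtain ⟨_ | a, b, c⟩ := p
    · rcases b with _ | b
      · rw [← ordMon_succ_z]
        refine ordMon_mem_lowSpan ?_
        simp only [deg] at hp ⊢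
        omega
      · have hp' : deg (0, b, c) < m := by
          simp only [deg] at hp ⊢
          omega
        rw [ordMon_succ_y, ← mul_assoc, h2, add_mul, smul_mul_assoc, smul_mul_assoc, mul_assoc]
        exact add_mem (Submodule.smul_mem _ _ (mul_mem_of_ordMon hy (ih _ hp').2))
          (Submodule.smul_mem _ _ (lowSpan_mono (by omega)
            (x_mul_mem_lowSpan (ordMon_mem_lowSpan hp'))))
    · have hp' : deg (a, b, c) < m := by
        simp only [deg] at hp ⊢
        omega
      rw [ordMon_succ_x, ← mul_assoc, h1, add_mul, smul_mul_assoc, smul_mul_assoc, mul_assoc]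
      exact add_mem (Submodule.smul_mem _ _ (x_mul_mem_lowSpan (ih _ hp').2))
        (Submodule.smul_mem _ _ (lowSpan_mono (by omega) (ih _ hp').1))

theorem Reorders.y_mul_mem (hR : Reorders R x y z) {m : ℕ} {v : A} (hv : v ∈ lowSpan R x y z m) :
    y * v ∈ lowSpan R x y z (m + 1) :=
  mul_mem_of_ordMon (fun p hp => (hR.mul_ordMon_mem m p hp).1) hv

theorem Reorders.z_mul_mem (hR : Reorders R x y z) {m : ℕ} {v : A} (hv : v ∈ lowSpan R x y z m) :
    z * v ∈ lowSpan R x y z (m + 1) :=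
  mul_mem_of_ordMon (fun p hp => (hR.mul_ordMon_mem m p hp).2) hv

theorem exists_mem_lowSpan {v : A} (hv : v ∈ Submodule.span R (Set.range (ordMon x y z))) :
    ∃ m, v ∈ lowSpan R x y z m := by
  induction hv using Submodule.span_induction with
  | mem v h =>
    obtain ⟨p, rfl⟩ := h
    exact ⟨deg p + 1, ordMon_mem_lowSpan (Nat.lt_succ_self _)⟩
  | zero => exact ⟨0, zero_mem _⟩
  | add v w _ _ hv hw =>
    obtain ⟨m, hm⟩ := hv
    obtain ⟨n, hn⟩ := hw
    exact ⟨max m n, add_mem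
      (lowSpan_mono (le_max_left _ _) hm) (lowSpan_mono (le_max_right _ _) hn)⟩
  | smul a v _ hv => exact hv.imp fun m hm => Submodule.smul_mem _ _ hm

theorem lowSpan_le (m : ℕ) : lowSpan R x y z m ≤ Submodule.span R (Set.range (ordMon x y z)) :=
  Submodule.span_mono (Set.image_subset_range _ _)

/-- The ordered monomials span the subalgebra. -/
theorem Reorders.adjoin_le (hR : Reorders R x y z) :
    (Algebra.adjoin R {x, y, z}).toSubmodule = Submodule.span R (Set.range (ordMon x y z)) := by
  apply le_antisymm
  · have key : ∀ w ∈ Algebra.adjoin R {x, y, z}, ∀ v ∈ Submodule.span R (Set.range (ordMon x y z)),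
        w * v ∈ Submodule.span R (Set.range (ordMon x y z)) := by
      intro w hw
      induction hw using Algebra.adjoin_induction with
      | mem w hw =>
        intro v hv
        obtain ⟨m, hm⟩ := exists_mem_lowSpan hv
        rcases hw with rfl | rfl | rfl
        exacts [lowSpan_le _ (x_mul_mem_lowSpan hm), lowSpan_le _ (hR.y_mul_mem hm),
          lowSpan_le _ (hR.z_mul_mem hm)]
      | algebraMap r =>
        intro v hv
        rw [← Algebra.smul_def]
        exact Submodule.smul_mem _ _ hv
      | add w w' _ _ hw hw' =>
        intro v hv
        rw [add_mul]
        exact add_mem (hw v hv) (hw' v hv)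
      | mul w w' _ _ hw hw' =>
        intro v hv
        rw [mul_assoc]
        exact hw _ (hw' v hv)
    intro w hw
    rw [← mul_one w]
    exact key w hw 1 (Submodule.subset_span ⟨(0, 0, 0), ordMon_zero⟩)
  · refine Submodule.span_le.2 ?_
    rintro _ ⟨p, rfl⟩
    have hx : x ∈ Algebra.adjoin R {x, y, z} := Algebra.subset_adjoin (by simp)
    have hy : y ∈ Algebra.adjoin R {x, y, z} := Algebra.subset_adjoin (by simp)
    have hz : z ∈ Algebra.adjoin R {x, y, z} := Algebra.subset_adjoin (by simp)
    exact Subalgebra.mul_mem _ (Subalgebra.mul_mem _ (Subalgebra.pow_mem _ hx _)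
      (Subalgebra.pow_mem _ hy _)) (Subalgebra.pow_mem _ hz _)

end OrderedMonomials

/-! ### The vector representation -/

section VectorRep

variable (k : Type u) [Field k] [CharZero k]

/-- The algebra `k[[ħ]] / ħ^N`. -/
abbrev TruncSeries (N : ℕ) : Type u := k⟦X⟧ ⧸ Ideal.span {(PowerSeries.X ^ N : k⟦X⟧)}

variable {k}

omit [CharZero k] in
theorem X_pow_smul_truncSeries {N n : ℕ} (h : N ≤ n) (x : TruncSeries k N) :
    (PowerSeries.X ^ n : k⟦X⟧) • x = 0 := by
  obtain ⟨x, rfl⟩ := Ideal.Quotient.mk_surjective x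
  refine Ideal.Quotient.eq_zero_iff_mem.2 (Ideal.mem_span_singleton.2 ?_)
  exact (pow_dvd_pow _ h).mul_right x

/-- If `h ^ 3 = h`, as for the Cartan elements in the vector representation, then
`q^h - q^{-h} = (q - q⁻¹) h`. -/
theorem qdiff_of_cube {B : Type*} [Ring B] [Algebra k⟦X⟧ B] {N : ℕ}
    (hB : (PowerSeries.X ^ N : k⟦X⟧) • (1 : B) = 0) {h : B} (hh : h ^ 3 = h) :
    qdiff k N h = divH (qd k) • h := by
  rw [← seriesEval_scalar hB]
  change seriesEval hB _ = _
  congr 1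
  ext n
  have hodd : ∀ m, h ^ (2 * m + 1) = h := fun m => by
    induction m with
    | zero => simp
    | succ m ih => rw [show 2 * (m + 1) + 1 = 2 * m + 1 + 2 by ring, pow_add, ih, ← pow_succ', hh]
  simp only [formalDiff, formalExp, divH, PowerSeries.coeff_mk, map_sub, qd, coeff_q, coeff_inv_q]
  rcases Nat.even_or_odd' n with ⟨m, rfl | rfl⟩
  · rw [Odd.neg_pow ⟨m, rfl⟩, hodd, Odd.neg_one_pow ⟨m, rfl⟩, smul_neg, map_mul, map_neg, map_one,
      neg_one_mul, sub_neg_eq_add, sub_neg_eq_add, add_smul]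
  · have he : Even (2 * m + 1 + 1) := ⟨m + 1, by ring⟩
    rw [he.neg_pow, he.neg_one_pow, one_mul, sub_self, sub_self, zero_smul]

open Matrix in
/-- The vector representation. -/
theorem isGLTriple_matrix (N : ℕ) : IsGLTriple k N
    (fun i : Fin 2 => (single i.succ i.castSucc 1 : Matrix (Fin 3) (Fin 3) (TruncSeries k N)))
    (fun j => single j j 1) (fun i => single i.castSucc i.succ 1) where
  X_pow := by
    ext i j
    exact X_pow_smul_truncSeries le_rfl _
  l_f i j := by
    fin_cases i <;> fin_cases j <;> simp [kron]
  l_l i j := by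
    fin_cases i <;> fin_cases j <;> simp
  l_e i j := by
    fin_cases i <;> fin_cases j <;> simp [kron]
  e_f i j := by
    have hX : (PowerSeries.X ^ N : k⟦X⟧) • (1 : Matrix (Fin 3) (Fin 3) (TruncSeries k N)) = 0 := by
      ext i j
      exact X_pow_smul_truncSeries le_rfl _
    have h : ∀ i : Fin 2, qnumber k N ((single i.castSucc i.castSucc 1 : Matrix (Fin 3) (Fin 3)
        (TruncSeries k N)) - single i.succ i.succ 1) =
        single i.castSucc i.castSucc 1 - single i.succ i.succ 1 := fun i => by
      rw [qnumber, qdiff_of_cube hX, smul_smul, mul_comm, divH_qd_mul_inv, one_smul]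
      fin_cases i <;> simp [pow_succ, mul_sub, sub_mul, add_mul]
    rw [h]
    fin_cases i <;> fin_cases j <;> simp [kron]
  serre_e i j hij := by
    fin_cases i <;> fin_cases j <;> simp [pow_two] at hij ⊢
  serre_f i j hij := by
    fin_cases i <;> fin_cases j <;> simp [pow_two] at hij ⊢

/-- The matrix of an element in the vector representation. -/
def vectorRep (N : ℕ) : UglMod k N →ₐ[k⟦X⟧] Matrix (Fin 3) (Fin 3) (TruncSeries k N) :=
  (isGLTriple_matrix N).homMod

/-- The constant coefficient modulo `ħ^(N+1)`. -/
def truncConst (N : ℕ) : TruncSeries k (N + 1) →+* k :=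
  Ideal.Quotient.lift _ PowerSeries.constantCoeff fun a ha => by
    obtain ⟨b, rfl⟩ := Ideal.mem_span_singleton.1 ha
    simp

omit [CharZero k] in
theorem truncConst_smul (N : ℕ) (c : k⟦X⟧) (x : TruncSeries k (N + 1)) :
    truncConst N (c • x) = PowerSeries.constantCoeff c * truncConst N x := by
  obtain ⟨x, rfl⟩ := Ideal.Quotient.mk_surjective x
  exact map_mul PowerSeries.constantCoeff c x

omit [CharZero k] in
theorem truncConst_eq_zero {N : ℕ} {x : TruncSeries k (N + 1)}
    (h : (PowerSeries.X ^ N : k⟦X⟧) • x = 0) : truncConst N x = 0 := by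
  obtain ⟨x, rfl⟩ := Ideal.Quotient.mk_surjective x
  change PowerSeries.constantCoeff x = 0
  have h1 : PowerSeries.X ^ (N + 1) ∣ PowerSeries.X ^ N * x :=
    Ideal.mem_span_singleton.1 (Ideal.Quotient.eq_zero_iff_mem.1 h)
  rw [pow_succ, mul_dvd_mul_iff_left (pow_ne_zero _ PowerSeries.X_ne_zero)] at h1
  exact PowerSeries.X_dvd_iff.1 h1

end VectorRep

/-! ### Closed subalgebras -/

section Closed

variable {k : Type u} [Field k] [CharZero k]

theorem isHClosed_closedAdjoin (S : Set (Ugl k)) :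
    IsHClosed (k := k) (closedAdjoin k S : Set (Ugl k)) := by
  intro x hx
  refine Algebra.mem_sInf.2 fun B hB => hB.2 x fun N => ?_
  obtain ⟨s, hs, y, rfl⟩ := hx N
  exact ⟨s, Algebra.mem_sInf.1 hs B hB, y, rfl⟩

theorem subset_closedAdjoin (S : Set (Ugl k)) : S ⊆ closedAdjoin k S := fun _ hx =>
  Algebra.mem_sInf.2 fun _ hB => hB.1 hx

theorem closedAdjoin_le {S : Set (Ugl k)} {B : Subalgebra k⟦X⟧ (Ugl k)} (h : S ⊆ B)
    (hB : IsHClosed (k := k) (B : Set (Ugl k))) : closedAdjoin k S ≤ B :=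
  sInf_le ⟨h, hB⟩

/-- A series whose coefficients lie in a closed subalgebra represents an element of it. -/
theorem proj_mem_of_coeff {B : Subalgebra k⟦X⟧ (Ugl k)} (hB : IsHClosed (k := k) (B : Set (Ugl k)))
    (p : PowerSeries (FreeAlgebra k Gen))
    (h : ∀ n, Ugl.proj k (FreeTop.const (PowerSeries.coeff n p)) ∈ B) :
    Ugl.proj k (show FreeTop k from p) ∈ B := by
  refine hB _ fun N => ?_
  obtain ⟨r, hr⟩ := freeTop_decomp N (show FreeTop k from p)
  refine ⟨∑ n ∈ Finset.range N, (PowerSeries.X ^ n : k⟦X⟧) •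
    Ugl.proj k (FreeTop.const (PowerSeries.coeff n p)),
    sum_mem fun n _ => Subalgebra.smul_mem _ (h n) _, Ugl.proj k r, ?_⟩
  refine (congrArg (Ugl.proj k) hr).trans ?_
  simp only [map_add, map_sum, map_smul]

omit [CharZero k] in
theorem expH_eq_one_add (a : FreeAlgebra k Gen) :
    FreeTop.expH a = 1 + (PowerSeries.X : k⟦X⟧) • (show FreeTop k from
      PowerSeries.mk fun n => (((n + 1).factorial : k)⁻¹) • a ^ (n + 1)) := by
  have hX := freeTop_X_pow_smul 1 (show FreeTop k from
      PowerSeries.mk fun n => (((n + 1).factorial : k)⁻¹) • a ^ (n + 1))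
  rw [pow_one] at hX
  rw [hX]
  have key : PowerSeries.mk (fun n => ((n.factorial : k)⁻¹) • a ^ n) =
      1 + PowerSeries.X ^ 1 *
        PowerSeries.mk fun n => (((n + 1).factorial : k)⁻¹) • a ^ (n + 1) := by
    ext n
    cases n with
    | zero => simp
    | succ n => simp [PowerSeries.coeff_succ_X_mul, PowerSeries.coeff_one]
  exact key

/-- If `a` lies in a closed subalgebra, then so does `(q^a - 1) / ħ`. -/
theorem exists_expH_eq {B : Subalgebra k⟦X⟧ (Ugl k)} (hB : IsHClosed (k := k) (B : Set (Ugl k)))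
    {a : FreeAlgebra k Gen} (ha : Ugl.proj k (FreeTop.const a) ∈ B) :
    ∃ s ∈ B, Ugl.proj k (FreeTop.expH a) = 1 + (PowerSeries.X : k⟦X⟧) • s := by
  refine ⟨_, proj_mem_of_coeff hB
    (PowerSeries.mk fun n => (((n + 1).factorial : k)⁻¹) • a ^ (n + 1)) fun n => ?_, ?_⟩
  · rw [PowerSeries.coeff_mk, const_smul, map_smul]
    refine Subalgebra.smul_mem _ ?_ _
    have : FreeTop.const (a ^ (n + 1)) = FreeTop.const a ^ (n + 1) := map_pow constHom a (n + 1)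
    rw [this, map_pow]
    exact Subalgebra.pow_mem _ ha _
  · refine (congrArg (Ugl.proj k) (expH_eq_one_add a)).trans ((map_add _ _ _).trans ?_)
    rw [map_one]
    exact congrArg (1 + ·) (map_smul (Ugl.proj k) (PowerSeries.X : k⟦X⟧) _)

theorem h_mem_Usl (i : Fin 2) : Ugl.proj k (FreeTop.const (hFree k i)) ∈ Usl k :=
  subset_closedAdjoin _ (Or.inl (Or.inr ⟨i, by
    have : FreeTop.const (hFree k i) = lT k i.castSucc - lT k i.succ := map_sub constHom _ _
    rw [this, map_sub]
    rfl⟩))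

theorem exists_t_eq (i : Fin 2) : ∃ s ∈ Usl k, t k i = 1 + (PowerSeries.X : k⟦X⟧) • s :=
  exists_expH_eq (isHClosed_closedAdjoin _) (h_mem_Usl i)

theorem exists_tinv_eq (i : Fin 2) : ∃ s ∈ Usl k, tinv k i = 1 + (PowerSeries.X : k⟦X⟧) • s := by
  refine exists_expH_eq (isHClosed_closedAdjoin _) ?_
  have : FreeTop.const (-hFree k i) = -FreeTop.const (hFree k i) := map_neg constHom _
  rw [this, map_neg]
  exact neg_mem (h_mem_Usl i)

end Closed

/-! ### Matrix entries of the generators of the coideal subalgebra -/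

section Functionals

variable (k : Type u) [Field k] [CharZero k]

/-- The element `ħ⁻¹ k_{1,2}`. The factor `divH (qd k) = (q - q⁻¹) / ħ` is a unit. -/
def y12 : Ugl k := divH (qd k) • so12 k

/-- The element `ħ⁻¹ k_{1,3}`. -/
def y13 : Ugl k := divH (qd k) • so13 k

/-- The element `ħ⁻¹ k_{2,3}`. -/
def y23 : Ugl k := divH (qd k) • so23 k

variable {k}

theorem k12_eq_X_smul : k12 k = (PowerSeries.X : k⟦X⟧) • y12 k := by
  rw [k12_eq, y12, smul_smul, X_mul_divH_qd]

theorem k13_eq_X_smul : k13 k = (PowerSeries.X : k⟦X⟧) • y13 k := by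
  rw [k13_eq, y13, smul_smul, X_mul_divH_qd]

theorem k23_eq_X_smul : k23 k = (PowerSeries.X : k⟦X⟧) • y23 k := by
  rw [k23_eq, y23, smul_smul, X_mul_divH_qd]

/-- The vector representation at `ħ = 0`. -/
def vectorRepConst (N : ℕ) : Ugl k →+* Matrix (Fin 3) (Fin 3) k :=
  (truncConst (k := k) N).mapMatrix.comp
    ((vectorRep (k := k) (N + 1)).comp (red k (N + 1)) :
      Ugl k →+* Matrix (Fin 3) (Fin 3) (TruncSeries k (N + 1)))

theorem vectorRepConst_smul (N : ℕ) (c : k⟦X⟧) (x : Ugl k) :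
    vectorRepConst N (c • x) = PowerSeries.constantCoeff c • vectorRepConst N x := by
  ext i j
  simp [vectorRepConst, truncConst_smul]

theorem vectorRepConst_tinv (N : ℕ) (i : Fin 2) : vectorRepConst N (tinv k i) = 1 := by
  obtain ⟨s, -, hs⟩ := exists_tinv_eq (k := k) i
  rw [hs, map_add, map_one, vectorRepConst_smul, PowerSeries.constantCoeff_X, zero_smul, add_zero]

theorem vectorRepConst_f (N : ℕ) (i : Fin 2) :
    vectorRepConst N (f k i) = Matrix.single i.succ i.castSucc 1 := by
  have : vectorRep (N + 1) (red k (N + 1) (f k i)) = Matrix.single i.succ i.castSucc 1 :=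
    (isGLTriple_matrix (N + 1)).hom_f i
  simp [vectorRepConst, this]

theorem vectorRepConst_e (N : ℕ) (i : Fin 2) :
    vectorRepConst N (e k i) = Matrix.single i.castSucc i.succ 1 := by
  have : vectorRep (N + 1) (red k (N + 1) (e k i)) = Matrix.single i.castSucc i.succ 1 :=
    (isGLTriple_matrix (N + 1)).hom_e i
  simp [vectorRepConst, this]

theorem constantCoeff_q : PowerSeries.constantCoeff (q k) = 1 := by simp [q]

theorem vectorRepConst_so12 (N : ℕ) : vectorRepConst N (so12 k) =
    Matrix.single 1 0 1 - Matrix.single 0 1 1 := by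
  simp [so12, vectorRepConst_smul, vectorRepConst_tinv, vectorRepConst_f, vectorRepConst_e,
    constantCoeff_q, sub_eq_add_neg]

theorem vectorRepConst_so23 (N : ℕ) : vectorRepConst N (so23 k) =
    Matrix.single 2 1 1 - Matrix.single 1 2 1 := by
  simp [so23, vectorRepConst_smul, vectorRepConst_tinv, vectorRepConst_f, vectorRepConst_e,
    constantCoeff_q, sub_eq_add_neg]

theorem vectorRepConst_so13 (N : ℕ) : vectorRepConst N (so13 k) =
    Matrix.single 2 0 1 - Matrix.single 0 2 1 := by
  simp [so13, vectorRepConst_smul, vectorRepConst_so12, vectorRepConst_so23, mul_sub, sub_mul,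
    constantCoeff_q]

/-- The position below the diagonal numbered `i`, in the order `12`, `13`, `23`. -/
def lowerEntry : Fin 3 → Fin 3 × Fin 3 := ![(1, 0), (2, 0), (2, 1)]

/-- The matrix entries below the diagonal of the vector representation. -/
def entryFun (N : ℕ) (i : Fin 3) : UglMod k N →ₗ[k⟦X⟧] TruncSeries k N :=
  Matrix.entryLinearMap k⟦X⟧ (TruncSeries k N) (lowerEntry i).1 (lowerEntry i).2 ∘ₗ
    (vectorRep N).toLinearMap

theorem entryFun_one (N : ℕ) (i : Fin 3) : entryFun N i (1 : UglMod k N) = 0 := by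
  fin_cases i <;> simp [entryFun, lowerEntry]

theorem truncConst_entryFun (N : ℕ) (i : Fin 3) (x : Ugl k) :
    truncConst N (entryFun (N + 1) i (red k (N + 1) x)) =
      vectorRepConst N x (lowerEntry i).1 (lowerEntry i).2 := rfl

variable (k) in
/-- The three elements `y12`, `y13`, `y23`. -/
def yGen : Fin 3 → Ugl k := ![y12 k, y13 k, y23 k]

/-- At `ħ = 0` the entries below the diagonal form, up to the factor two, the dual basis of the
three antisymmetric matrices to which `y12`, `y13`, `y23` specialize. -/
theorem truncConst_entryFun_yGen (N : ℕ) (i j : Fin 3) :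
    truncConst N (entryFun (N + 1) i (red k (N + 1) (yGen k j))) = if i = j then 2 else 0 := by
  rw [truncConst_entryFun]
  fin_cases i <;> fin_cases j <;>
    simp [yGen, y12, y13, y23, vectorRepConst_smul, vectorRepConst_so12, vectorRepConst_so13,
      vectorRepConst_so23, constantCoeff_divH_qd, lowerEntry, Matrix.single]

end Functionals

/-! ### Coproducts of ordered monomials to first order -/

section Expansion

/-- The exponent of the `i`-th generator. -/
def expo (i : Fin 3) (p : ℕ × ℕ × ℕ) : ℕ := ![p.1, p.2.1, p.2.2] i

/-- Lowering the exponent of the `i`-th generator by one. -/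
def lower (i : Fin 3) (p : ℕ × ℕ × ℕ) : ℕ × ℕ × ℕ :=
  ![(p.1 - 1, p.2.1, p.2.2), (p.1, p.2.1 - 1, p.2.2), (p.1, p.2.1, p.2.2 - 1)] i

theorem deg_lower {i : Fin 3} {p : ℕ × ℕ × ℕ} (h : expo i p ≠ 0) :
    deg (lower i p) + 1 = deg p := by
  fin_cases i <;> simp [expo, lower, deg] at h ⊢ <;> omega

/-- The hypotheses exclude zero exponents, where the subtraction in `lower` truncates. -/
theorem lower_injOn {i : Fin 3} {p p' : ℕ × ℕ × ℕ} (h : expo i p ≠ 0) (h' : expo i p' ≠ 0)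
    (hp : lower i p = lower i p') : p = p' := by
  obtain ⟨a, b, c⟩ := p
  obtain ⟨a', b', c'⟩ := p'
  fin_cases i <;> simp [expo, lower] at h h' hp ⊢ <;> omega

theorem exists_expo_ne_zero {p : ℕ × ℕ × ℕ} (h : deg p ≠ 0) : ∃ i, expo i p ≠ 0 := by
  by_contra! hc
  have h0 := hc 0
  have h1 := hc 1
  have h2 := hc 2
  simp [expo] at h0 h1 h2
  simp [deg, h0, h1, h2] at h

/-- The value on the monomial with exponents `p` of the functional attached to the word `L`: the
number of ways to match the letters of the monomial with those of the word, weighted by powers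
of two. -/
def matchCount : List (Fin 3) → ℕ × ℕ × ℕ → ℕ
  | [], p => if deg p = 0 then 1 else 0
  | i :: L, p => 2 * expo i p * matchCount L (lower i p)

theorem matchCount_eq_zero (L : List (Fin 3)) : ∀ {p : ℕ × ℕ × ℕ}, deg p ≠ L.length →
    matchCount L p = 0 := by
  induction L with
  | nil => exact fun h => if_neg h
  | cons i L ih =>
    intro p h
    by_cases h0 : expo i p = 0
    · simp [matchCount, h0]
    · have h1 := deg_lower h0
      rw [matchCount, ih (by rw [List.length_cons] at h; omega), mul_zero]

/-- The functional attached to a suitable word singles out a given monomial. -/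
theorem exists_matchCount (n : ℕ) : ∀ p : ℕ × ℕ × ℕ, deg p = n →
    ∃ L : List (Fin 3), L.length = n ∧ ∀ p', matchCount L p' ≠ 0 ↔ p' = p := by
  induction n with
  | zero =>
    rintro ⟨a, b, c⟩ hp
    refine ⟨[], rfl, ?_⟩
    rintro ⟨a', b', c'⟩
    simp only [deg] at hp
    by_cases h0 : a' + b' + c' = 0
    · simp only [matchCount, deg, h0, if_true, Prod.mk.injEq]
      omega
    · simp only [matchCount, deg, h0, if_false, Prod.mk.injEq]
      omega
  | succ n ih =>
    intro p hp
    obtain ⟨i, hi⟩ := exists_expo_ne_zero (p := p) (by omega)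
    obtain ⟨L, hL, hL'⟩ := ih (lower i p) (by have := deg_lower hi; omega)
    refine ⟨i :: L, by simp [hL], fun p' => ?_⟩
    simp only [matchCount, ne_eq, mul_eq_zero, OfNat.ofNat_ne_zero, false_or, not_or]
    constructor
    · rintro ⟨h1, h2⟩
      exact lower_injOn h1 hi ((hL' _).1 h2)
    · rintro rfl
      exact ⟨hi, (hL' _).2 rfl⟩

variable {R : Type*} [CommRing R] {A : Type*} [Ring A] [Algebra R A]

variable (R) in
/-- The elements of `A ⊗ A` whose second factors are combinations of ordered monomials of degree
less than `m`, up to multiples of `h`. -/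
def errorSub (h : R) (x y z : A) (m : ℕ) : Submodule R (A ⊗[R] A) :=
  Submodule.map₂ (TensorProduct.mk R A A) ⊤ (lowSpan R x y z m) ⊔
    (⊤ : Submodule R (A ⊗[R] A)).map (LinearMap.lsmul R (A ⊗[R] A) h)

variable {h : R} {x y z : A}

theorem smul_mem_errorSub (m : ℕ) (w : A ⊗[R] A) : h • w ∈ errorSub R h x y z m :=
  Submodule.mem_sup_right ⟨w, trivial, rfl⟩

theorem tmul_mem_errorSub {m : ℕ} (u : A) {v : A} (hv : v ∈ lowSpan R x y z m) :
    u ⊗ₜ v ∈ errorSub R h x y z m :=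
  Submodule.mem_sup_left (Submodule.apply_mem_map₂ _ trivial hv)

theorem errorSub_mono {m n : ℕ} (hmn : m ≤ n) : errorSub R h x y z m ≤ errorSub R h x y z n :=
  sup_le_sup_right (Submodule.map₂_le_map₂_right (lowSpan_mono hmn)) _

theorem errorSub_le {m : ℕ} {S : Submodule R (A ⊗[R] A)}
    (h1 : ∀ u, ∀ v ∈ lowSpan R x y z m, u ⊗ₜ v ∈ S) (h2 : ∀ w, h • w ∈ S) :
    errorSub R h x y z m ≤ S := by
  refine sup_le (Submodule.map₂_le.2 fun u _ v hv => h1 u v hv) ?_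
  rintro _ ⟨w, -, rfl⟩
  exact h2 w

theorem tmul_one_mul_mem_errorSub {m : ℕ} (w : A) {s : A ⊗[R] A}
    (hs : s ∈ errorSub R h x y z m) : (w ⊗ₜ 1 : A ⊗[R] A) * s ∈ errorSub R h x y z m := by
  have : errorSub R h x y z m ≤ (errorSub R h x y z m).comap
      (LinearMap.mulLeft R (w ⊗ₜ 1 : A ⊗[R] A)) := by
    refine errorSub_le (fun u v hv => ?_) fun w => ?_
    · simpa using tmul_mem_errorSub _ hv
    · simpa using smul_mem_errorSub m _
  exact this hs

theorem one_tmul_mul_mem_errorSub {m : ℕ} {w : A}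
    (hw : ∀ {m} {v : A}, v ∈ lowSpan R x y z m → w * v ∈ lowSpan R x y z (m + 1)) {s : A ⊗[R] A}
    (hs : s ∈ errorSub R h x y z (m - 1)) : (1 ⊗ₜ w : A ⊗[R] A) * s ∈ errorSub R h x y z m := by
  have : errorSub R h x y z (m - 1) ≤ (errorSub R h x y z m).comap
      (LinearMap.mulLeft R (1 ⊗ₜ w : A ⊗[R] A)) := by
    refine errorSub_le (fun u v hv => ?_) fun w => ?_
    · have : w * v ∈ lowSpan R x y z m := by
        rcases m with _ | m
        · have : v = 0 := by simpa [lowSpan] using hv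
          rw [this, mul_zero]
          exact zero_mem _
        · exact hw hv
      simpa using tmul_mem_errorSub _ this
    · simpa using smul_mem_errorSub m _
  exact this hs

/-- The terms of the coproduct of an ordered monomial whose first factor is `1` or, with all but one
of the letters moved to the second factor, a single generator. -/
def mainPart (x y z : A) (p : ℕ × ℕ × ℕ) : A ⊗[R] A :=
  1 ⊗ₜ ordMon x y z p + ∑ s, expo s p • (![x, y, z] s ⊗ₜ[R] ordMon x y z (lower s p))

/-- The inductive step: the generator that begins the monomial is split off. -/
theorem comul_ordMon_step {Δ : A →ₐ[R] A ⊗[R] A} {i : Fin 3} {w : A ⊗[R] A}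
    (hΔ : Δ (![x, y, z] i) = 1 ⊗ₜ ![x, y, z] i + ![x, y, z] i ⊗ₜ 1 + h • w)
    (hi : ∀ {m} {v : A}, v ∈ lowSpan R x y z m → ![x, y, z] i * v ∈ lowSpan R x y z (m + 1))
    {p' p : ℕ × ℕ × ℕ} (hp : lower i p = p')
    (hexp : ∀ s, expo s p = expo s p' + if s = i then 1 else 0)
    (hmul : ordMon x y z p = ![x, y, z] i * ordMon x y z p')
    (hlow : ∀ s, expo s p' ≠ 0 →
      ordMon x y z (lower s p) = ![x, y, z] i * ordMon x y z (lower s p'))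
    (ih : Δ (ordMon x y z p') - mainPart x y z p' ∈ errorSub R h x y z (deg p' - 1)) :
    Δ (ordMon x y z p) - mainPart x y z p ∈ errorSub R h x y z (deg p - 1) := by
  set v := ![x, y, z] i with hv
  have hdeg : deg p = deg p' + 1 := by
    have := deg_lower (i := i) (p := p) (by simp [hexp])
    rw [← this, hp]
  rw [hdeg, Nat.add_sub_cancel]
  have hmain : mainPart (R := R) x y z p = (1 ⊗ₜ v) * mainPart x y z p' +
      v ⊗ₜ ordMon x y z p' := by
    simp only [mainPart, mul_add, Finset.mul_sum, Algebra.TensorProduct.tmul_mul_tmul, one_mul,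
      mul_smul_comm, hexp, add_smul, Finset.sum_add_distrib, ← hmul]
    rw [add_assoc]
    congr 2
    · refine Finset.sum_congr rfl fun s _ => ?_
      by_cases hs : expo s p' = 0
      · simp [hs]
      · rw [hlow s hs]
    · rw [Finset.sum_eq_single i (fun s _ hs => by simp [hs]) (by simp)]
      simp [hp, hv]
  have hsum : (v ⊗ₜ 1 : A ⊗[R] A) * ∑ s, expo s p' • (![x, y, z] s ⊗ₜ[R]
      ordMon x y z (lower s p')) ∈ errorSub R h x y z (deg p') := by
    rw [Finset.mul_sum]
    refine sum_mem fun s _ => ?_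
    rw [mul_smul_comm, Algebra.TensorProduct.tmul_mul_tmul, one_mul]
    by_cases hs : expo s p' = 0
    · rw [hs, zero_smul]
      exact zero_mem _
    · exact nsmul_mem (tmul_mem_errorSub _ (ordMon_mem_lowSpan (by
        have := deg_lower hs
        omega))) _
  have key : Δ (ordMon x y z p) - mainPart x y z p =
      (1 ⊗ₜ v) * (Δ (ordMon x y z p') - mainPart x y z p') +
      (v ⊗ₜ 1) * (Δ (ordMon x y z p') - mainPart x y z p') +
      (v ⊗ₜ 1) * ∑ s, expo s p' • (![x, y, z] s ⊗ₜ[R] ordMon x y z (lower s p')) +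
      h • (w * Δ (ordMon x y z p')) := by
    rw [hmul, map_mul, hΔ, hmain, add_mul, add_mul, smul_mul_assoc, mul_sub, mul_sub]
    have : (v ⊗ₜ 1 : A ⊗[R] A) * mainPart x y z p' = v ⊗ₜ ordMon x y z p' +
        (v ⊗ₜ 1) * ∑ s, expo s p' • (![x, y, z] s ⊗ₜ[R] ordMon x y z (lower s p')) := by
      rw [mainPart, mul_add, Algebra.TensorProduct.tmul_mul_tmul, one_mul, mul_one]
    rw [this]
    abel
  rw [key]
  exact add_mem (add_mem (add_mem (one_tmul_mul_mem_errorSub hi ih)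
    (errorSub_mono (Nat.sub_le _ _) (tmul_one_mul_mem_errorSub _ ih))) hsum)
    (smul_mem_errorSub _ _)

/-- For generators that are primitive modulo `h`, the coproduct of an ordered monomial agrees
with its main part up to terms of lower degree in the second factor. -/
theorem comul_ordMon {Δ : A →ₐ[R] A ⊗[R] A} (hR : Reorders R x y z)
    (hΔ : ∀ i, ∃ w, Δ (![x, y, z] i) = 1 ⊗ₜ ![x, y, z] i + ![x, y, z] i ⊗ₜ 1 + h • w)
    (p : ℕ × ℕ × ℕ) :
    Δ (ordMon x y z p) - mainPart x y z p ∈ errorSub R h x y z (deg p - 1) := by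
  obtain ⟨a, b, c⟩ := p
  induction a with
  | zero =>
    induction b with
    | zero =>
      induction c with
      | zero => simp [ordMon_zero, mainPart, expo, Fin.sum_univ_three,
          Algebra.TensorProduct.one_def]
      | succ c ih =>
        obtain ⟨w, hw⟩ := hΔ 2
        refine comul_ordMon_step hw (hR.z_mul_mem) (p' := (0, 0, c)) ?_ ?_ ?_ ?_ ih
        · simp [lower]
        · intro s
          fin_cases s <;> simp [expo]
        · exact ordMon_succ_z c
        · intro s hs
          fin_cases s <;> simp [expo] at hs
          obtain ⟨c, rfl⟩ := Nat.exists_eq_succ_of_ne_zero hs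
          exact ordMon_succ_z c
    | succ b ih =>
      obtain ⟨w, hw⟩ := hΔ 1
      refine comul_ordMon_step hw (hR.y_mul_mem) (p' := (0, b, c)) ?_ ?_ ?_ ?_ ih
      · simp [lower]
      · intro s
        fin_cases s <;> simp [expo]
      · exact ordMon_succ_y b c
      · intro s hs
        fin_cases s <;> simp [expo] at hs
        · obtain ⟨b, rfl⟩ := Nat.exists_eq_succ_of_ne_zero hs
          exact ordMon_succ_y b c
        · exact ordMon_succ_y b (c - 1)
  | succ a ih =>
    obtain ⟨w, hw⟩ := hΔ 0
    refine comul_ordMon_step hw (x_mul_mem_lowSpan) (p' := (a, b, c)) ?_ ?_ ?_ ?_ ih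
    · simp [lower]
    · intro s
      fin_cases s <;> simp [expo]
    · exact ordMon_succ_x a b c
    · intro s hs
      fin_cases s <;> simp [expo] at hs
      · obtain ⟨a, rfl⟩ := Nat.exists_eq_succ_of_ne_zero hs
        exact ordMon_succ_x a b c
      · exact ordMon_succ_x a (b - 1) c
      · exact ordMon_succ_x a b (c - 1)

variable {T : Type*} [CommRing T] [Algebra R T]

/-- The convolution product of the functionals `φ i`, `φ j`, … attached to a nonempty word. -/
def convFun (Δ : A →ₐ[R] A ⊗[R] A) (φ : Fin 3 → A →ₗ[R] T) : Fin 3 → List (Fin 3) → A →ₗ[R] T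
  | i, [] => φ i
  | i, j :: L => LinearMap.mul' R T ∘ₗ TensorProduct.map (φ i) (convFun Δ φ j L) ∘ₗ Δ.toLinearMap

/-- Only the part of the coproduct with one letter in the first factor contributes to a convolution
product of functionals that vanish at `1`, as long as the degree does not exceed the length of the
word: the remaining terms have second factors of too low a degree. -/
theorem convFun_ordMon {Δ : A →ₐ[R] A ⊗[R] A} (hR : Reorders R x y z)
    (hΔ : ∀ i, ∃ w, Δ (![x, y, z] i) = 1 ⊗ₜ ![x, y, z] i + ![x, y, z] i ⊗ₜ 1 + h • w)
    {φ : Fin 3 → A →ₗ[R] T} {K : Type*} [CommRing K] {τ : T →+* K} (hτ : ∀ t, τ (h • t) = 0)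
    (h1 : ∀ i, φ i 1 = 0) (hφ : ∀ i j, τ (φ i (![x, y, z] j)) = if i = j then 2 else 0)
    (L : List (Fin 3)) : ∀ (i : Fin 3) (p : ℕ × ℕ × ℕ), deg p ≤ L.length + 1 →
      τ (convFun Δ φ i L (ordMon x y z p)) = (matchCount (i :: L) p : ℕ) := by
  induction L with
  | nil =>
    intro i p hp
    by_cases h0 : deg p = 0
    · obtain ⟨a, b, c⟩ := p
      have : a = 0 ∧ b = 0 ∧ c = 0 := by simp only [deg] at h0; omega
      obtain ⟨rfl, rfl, rfl⟩ := this
      rw [ordMon_zero, matchCount_eq_zero _ (by simp [deg]), convFun, h1]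
      simp
    · obtain ⟨j, hj⟩ := exists_expo_ne_zero h0
      have hp1 : deg (lower j p) = 0 := by
        have := deg_lower hj
        simp only [List.length_nil] at hp
        omega
      have hv : ordMon x y z p = ![x, y, z] j := by
        obtain ⟨a, b, c⟩ := p
        fin_cases j <;> simp [expo, lower, deg] at hp1 hj
        · obtain ⟨rfl, rfl, rfl⟩ : a = 1 ∧ b = 0 ∧ c = 0 := by omega
          simp [ordMon]
        · obtain ⟨rfl, rfl, rfl⟩ : a = 0 ∧ b = 1 ∧ c = 0 := by omega
          simp [ordMon]
        · obtain ⟨rfl, rfl, rfl⟩ : a = 0 ∧ b = 0 ∧ c = 1 := by omega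
          simp [ordMon]
      rw [hv, convFun, hφ]
      obtain ⟨a, b, c⟩ := p
      fin_cases j <;> simp [expo, lower, deg] at hp1 hj
      · obtain ⟨rfl, rfl, rfl⟩ : a = 1 ∧ b = 0 ∧ c = 0 := by omega
        fin_cases i <;> simp [matchCount, expo, lower, deg]
      · obtain ⟨rfl, rfl, rfl⟩ : a = 0 ∧ b = 1 ∧ c = 0 := by omega
        fin_cases i <;> simp [matchCount, expo, lower, deg]
      · obtain ⟨rfl, rfl, rfl⟩ : a = 0 ∧ b = 0 ∧ c = 1 := by omega
        fin_cases i <;> simp [matchCount, expo, lower, deg]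
  | cons j L ih =>
    intro i p hp
    rw [List.length_cons] at hp
    have hvan : ∀ v ∈ lowSpan R x y z (L.length + 1), τ (convFun Δ φ j L v) = 0 := by
      intro v hv
      induction hv using Submodule.span_induction with
      | mem v hv =>
        obtain ⟨r, hr, rfl⟩ := hv
        rw [ih j r (le_of_lt hr), matchCount_eq_zero _ (by exact ne_of_lt hr), Nat.cast_zero]
      | zero => simp
      | add v w _ _ hv hw => rw [map_add, map_add, hv, hw, add_zero]
      | smul a v _ hv => rw [map_smul, ← one_mul (convFun Δ φ j L v), ← smul_mul_assoc, map_mul,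
          hv, mul_zero]
    let B : A ⊗[R] A →ₗ[R] T := LinearMap.mul' R T ∘ₗ TensorProduct.map (φ i) (convFun Δ φ j L)
    have hB : ∀ u v, B (u ⊗ₜ v) = φ i u * convFun Δ φ j L v := fun u v => by simp [B]
    have herr : ∀ s ∈ errorSub R h x y z (deg p - 1), τ (B s) = 0 := by
      intro s hs
      have : errorSub R h x y z (deg p - 1) ≤
          ((RingHom.ker τ).restrictScalars R).comap B := by
        refine errorSub_le (fun u v hv => ?_) fun w => ?_
        · change τ (B (u ⊗ₜ v)) = 0
          rw [hB, map_mul, hvan v (lowSpan_mono (by omega) hv), mul_zero]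
        · change τ (B (h • w)) = 0
          rw [map_smul, hτ]
      exact this hs
    have hsub := herr _ (comul_ordMon hR hΔ p)
    rw [map_sub, map_sub, sub_eq_zero] at hsub
    change τ (B (Δ (ordMon x y z p))) = _
    rw [hsub, mainPart, map_add, map_add, hB, h1, zero_mul, map_zero, zero_add, map_sum, map_sum,
      Finset.sum_eq_single i]
    · rw [map_nsmul, map_nsmul, hB, map_mul, hφ, if_pos rfl, matchCount]
      by_cases h0 : expo i p = 0
      · simp [h0]
      · rw [ih j _ (by have := deg_lower h0; omega)]
        push_cast
        rw [nsmul_eq_mul]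
        ring
    · intro s _ hs
      rw [map_nsmul, map_nsmul, hB, map_mul, hφ, if_neg hs.symm, zero_mul, smul_zero]
    · simp

end Expansion

/-! ### Independence of ordered monomials -/

section Independence

theorem Reorders.map {R : Type*} [CommRing R] {A B : Type*} [Ring A] [Algebra R A] [Ring B]
    [Algebra R B] {x y z : A} (hR : Reorders R x y z) (φ : A →ₐ[R] B) :
    Reorders R (φ x) (φ y) (φ z) := by
  obtain ⟨⟨a1, b1, h1⟩, ⟨a2, b2, h2⟩, ⟨a3, b3, h3⟩⟩ := hR
  refine ⟨⟨a1, b1, ?_⟩, ⟨a2, b2, ?_⟩, ⟨a3, b3, ?_⟩⟩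
  · simpa using congrArg φ h1
  · simpa using congrArg φ h2
  · simpa using congrArg φ h3

theorem smul_comul_expand {R : Type*} [CommRing R] {A : Type*} [Ring A] [Algebra R A]
    {u h d q' : R} (hd : d = h * u) (v s : A) (a b : A ⊗[R] A) :
    u • (1 ⊗ₜ v + v ⊗ₜ (1 + h • s) + (q' * d) • a - d • b) = 1 ⊗ₜ (u • v) + (u • v) ⊗ₜ 1 +
      h • ((u • v) ⊗ₜ s + u • ((q' * u) • a - u • b)) := by
  subst hd
  simp only [TensorProduct.tmul_add, TensorProduct.tmul_smul, ← TensorProduct.smul_tmul']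
  module

variable {k : Type u} [Field k] [CharZero k]

theorem reorders_y : Reorders k⟦X⟧ (y12 k) (y13 k) (y23 k) where
  zx := ⟨(q k)⁻¹, divH (qd k), by
    simp only [y12, y13, y23, smul_mul_smul_comm, so23_mul_so12, smul_add, smul_smul]
    rw [mul_comm]⟩
  zy := ⟨q k, -divH (qd k), by
    simp only [y12, y13, y23, smul_mul_smul_comm, so23_mul_so13, smul_sub, smul_smul]
    rw [mul_comm, neg_mul, neg_smul, sub_eq_add_neg]⟩
  yx := ⟨q k, -divH (qd k), by
    simp only [y12, y13, y23, smul_mul_smul_comm, so13_mul_so12, smul_sub, smul_smul]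
    rw [mul_comm, neg_mul, neg_smul, sub_eq_add_neg]⟩

variable (k) in
/-- The ordered monomials in `y12`, `y13`, `y23`. -/
def yMon (p : ℕ × ℕ × ℕ) : Ugl k := ordMon (y12 k) (y13 k) (y23 k) p

theorem monomial_eq (p : ℕ × ℕ × ℕ) :
    monomial k p = (PowerSeries.X ^ deg p : k⟦X⟧) • yMon k p := by
  simp only [monomial, yMon, ordMon, k12_eq_X_smul, k13_eq_X_smul, k23_eq_X_smul, smul_pow,
    smul_mul_smul_comm, deg, pow_add]

namespace CoproductCounit

variable (H : CoproductCounit k) (N : ℕ)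

/-- The elements `y12`, `y13`, `y23` are primitive modulo `ħ`. -/
theorem comul_y (i : Fin 3) : ∃ w, H.comul N (![red k N (y12 k), red k N (y13 k),
    red k N (y23 k)] i) = 1 ⊗ₜ ![red k N (y12 k), red k N (y13 k), red k N (y23 k)] i +
      ![red k N (y12 k), red k N (y13 k), red k N (y23 k)] i ⊗ₜ 1 + (PowerSeries.X : k⟦X⟧) • w := by
  obtain ⟨s0, -, h0⟩ := exists_tinv_eq (k := k) 0
  obtain ⟨s1, -, h1⟩ := exists_tinv_eq (k := k) 1
  have h01 : tinv k 0 * tinv k 1 = 1 + (PowerSeries.X : k⟦X⟧) • (s0 * tinv k 1 + s1) := by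
    nth_rewrite 1 [h0]
    rw [add_mul, one_mul, smul_mul_assoc, smul_add]
    nth_rewrite 1 [h1]
    abel
  fin_cases i
  · refine ⟨red k N (y12 k) ⊗ₜ red k N s0, ?_⟩
    simp [y12, comul_so12, h0, TensorProduct.tmul_add, TensorProduct.smul_tmul', smul_add,
      smul_comm (PowerSeries.X : k⟦X⟧), add_assoc]
  · refine ⟨red k N (y13 k) ⊗ₜ red k N (s0 * tinv k 1 + s1) +
      divH (qd k) • (((q k)⁻¹ * divH (qd k)) • (red k N (so12 k) ⊗ₜ red k N (f k 1 * tinv k 0))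
      - divH (qd k) • (red k N (so23 k) ⊗ₜ red k N (tinv k 0 * tinv k 1 * e k 0))), ?_⟩
    simp only [Matrix.cons_val_one, Matrix.cons_val_zero, Fin.mk_one]
    have h01' := congrArg (red k N) h01
    rw [map_add, map_one, map_smul] at h01'
    rw [y13, map_smul, map_smul, comul_so13, h01']
    exact smul_comul_expand X_mul_divH_qd.symm _ _ _ _
  · refine ⟨red k N (y23 k) ⊗ₜ red k N s1, ?_⟩
    simp [y23, comul_so23, h1, TensorProduct.tmul_add, TensorProduct.smul_tmul', smul_add,
      smul_comm (PowerSeries.X : k⟦X⟧), add_assoc]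

/-- The functionals separating the ordered monomials in `y12`, `y13`, `y23`. -/
def wordFun (i : Fin 3) (L : List (Fin 3)) : UglMod k N →ₗ[k⟦X⟧] TruncSeries k N :=
  convFun (H.comul N) (entryFun N) i L

theorem truncConst_wordFun_yMon (i : Fin 3) (L : List (Fin 3)) {p : ℕ × ℕ × ℕ}
    (hp : deg p ≤ L.length + 1) :
    truncConst N (H.wordFun (N + 1) i L (red k (N + 1) (yMon k p))) =
      (matchCount (i :: L) p : ℕ) := by
  rw [yMon, ordMon_map]
  refine convFun_ordMon (reorders_y.map _) (H.comul_y (N + 1)) (fun t => ?_)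
    (entryFun_one _) (fun i j => ?_) L i p hp
  · rw [truncConst_smul, PowerSeries.constantCoeff_X, zero_mul]
  · rw [← truncConst_entryFun_yGen N i j]
    fin_cases j <;> rfl

variable {H N}

/-- The functionals of words of length at least `m` detect the coefficients of the monomials of
degree at least `m` of a finite combination, at `ħ = 0`. -/
theorem constantCoeff_eq_zero_of_wordFun {S : Finset (ℕ × ℕ × ℕ)} {c : ℕ × ℕ × ℕ → k⟦X⟧} {m : ℕ}
    (hm : m ≠ 0) (h : ∀ i L, m ≤ L.length + 1 →
      truncConst N (H.wordFun (N + 1) i L (red k (N + 1) (∑ p ∈ S, c p • yMon k p))) = 0)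
    {p : ℕ × ℕ × ℕ} (hp : p ∈ S) (hpm : m ≤ deg p) : PowerSeries.constantCoeff (c p) = 0 := by
  classical
  by_contra hc
  -- a word adapted to a monomial `r` of maximal degree with nonzero constant coefficient vanishes
  -- on all others: those of smaller degree, those of the same degree, and those with
  -- zero coefficient
  obtain ⟨r, hr, hmax⟩ := Finset.exists_max_image
    (S.filter fun p => PowerSeries.constantCoeff (c p) ≠ 0 ∧ m ≤ deg p) deg
    ⟨p, Finset.mem_filter.2 ⟨hp, hc, hpm⟩⟩
  obtain ⟨hrS, hr0, hrm⟩ := Finset.mem_filter.1 hr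
  obtain ⟨L, hL, hL'⟩ := exists_matchCount (deg r) r rfl
  obtain _ | ⟨i, L⟩ := L
  · rw [List.length_nil] at hL
    omega
  rw [List.length_cons] at hL
  have hs := h i L (by omega)
  simp only [map_sum, map_smul, truncConst_smul] at hs
  rw [Finset.sum_eq_single_of_mem r hrS] at hs
  · rw [truncConst_wordFun_yMon _ _ _ _ hL.ge] at hs
    rcases mul_eq_zero.1 hs with h1 | h1
    · exact hr0 h1
    · exact (hL' r).2 rfl (Nat.cast_eq_zero.1 h1)
  · intro s hsS hsr
    by_cases hs0 : PowerSeries.constantCoeff (c s) = 0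
    · rw [hs0, zero_mul]
    · have hle : deg s ≤ deg r := by
        by_cases hsm : m ≤ deg s
        · exact hmax s (Finset.mem_filter.2 ⟨hsS, hs0, hsm⟩)
        · omega
      rw [truncConst_wordFun_yMon _ _ _ _ (by omega)]
      have : matchCount (i :: L) s = 0 := by
        by_contra h0
        exact hsr ((hL' s).1 h0)
      rw [this, Nat.cast_zero, mul_zero]

end CoproductCounit

theorem CoproductCounit.counit_so (H : CoproductCounit k) :
    H.counit (so12 k) = 0 ∧ H.counit (so23 k) = 0 ∧ H.counit (so13 k) = 0 := by
  have h12 : H.counit (so12 k) = 0 := by simp [so12, H.counit_f, H.counit_e]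
  have h23 : H.counit (so23 k) = 0 := by simp [so23, H.counit_f, H.counit_e]
  exact ⟨h12, h23, by simp [so13, h12, h23]⟩

theorem CoproductCounit.counit_yMon (H : CoproductCounit k) (p : ℕ × ℕ × ℕ) :
    H.counit (yMon k p) = if p = (0, 0, 0) then 1 else 0 := by
  obtain ⟨h12, h23, h13⟩ := H.counit_so
  obtain ⟨a, b, c⟩ := p
  rw [yMon, ordMon_map]
  simp only [y12, y13, y23, map_smul, h12, h23, h13, smul_zero, ordMon]
  rcases a with _ | a <;> rcases b with _ | b <;> rcases c with _ | c <;> simp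

/-- A finite combination of ordered monomials in `y12`, `y13`, `y23` is divisible by `ħ^r` only if
its coefficients are. -/
theorem X_pow_dvd_of_sum_yMon (H : CoproductCounit k) {S : Finset (ℕ × ℕ × ℕ)}
    {c : ℕ × ℕ × ℕ → k⟦X⟧} (r : ℕ) {u : Ugl k}
    (h : ∑ p ∈ S, c p • yMon k p = (PowerSeries.X ^ r : k⟦X⟧) • u) :
    ∀ p ∈ S, PowerSeries.X ^ r ∣ c p := by
  classical
  induction r generalizing u with
  | zero => simp
  | succ r ih =>
    have ih' := ih (u := (PowerSeries.X : k⟦X⟧) • u) (by rw [h, smul_smul, pow_succ])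
    choose! d hd using ih'
    have hs : (PowerSeries.X ^ r : k⟦X⟧) • ∑ p ∈ S, d p • yMon k p =
        (PowerSeries.X ^ (r + 1) : k⟦X⟧) • u := by
      rw [← h, Finset.smul_sum]
      refine Finset.sum_congr rfl fun p hp => ?_
      rw [smul_smul, ← hd p hp]
    intro p hp
    rw [hd p hp, pow_succ]
    refine mul_dvd_mul_left _ (PowerSeries.X_dvd_iff.2 ?_)
    -- the word functionals vanish at `1`, whose coefficient is read off by the counit instead
    by_cases h0 : deg p = 0
    · have hp0 : p = (0, 0, 0) := by
        obtain ⟨a, b, c⟩ := p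
        simp only [deg] at h0
        simp only [Prod.mk.injEq]
        omega
      subst hp0
      have hc := congrArg H.counit hs
      simp only [map_smul, map_sum, H.counit_yMon, smul_eq_mul, mul_ite, mul_one, mul_zero,
        Finset.sum_ite_eq', hp, if_true, pow_succ, mul_assoc] at hc
      rw [mul_left_cancel₀ (pow_ne_zero _ PowerSeries.X_ne_zero) hc]
      simp
    · refine CoproductCounit.constantCoeff_eq_zero_of_wordFun (H := H) (N := r) (m := 1)
        one_ne_zero (fun i L _ => ?_) hp (by omega)
      refine truncConst_eq_zero ?_
      rw [← map_smul, ← map_smul, hs, map_smul, map_smul, X_pow_smul_truncSeries le_rfl]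

end Independence

/-! ### Functionals on tensor powers -/

section Harpoon

variable {k : Type u} [Field k] [CharZero k]

section LinearAlgebra

variable {R : Type*} [CommRing R] {U M T : Type*} [AddCommGroup U] [Module R U]
  [AddCommGroup M] [Module R M] [CommRing T] [Algebra R T]

theorem mul_map_comp_rid_symm (a : U →ₗ[R] T) :
    (LinearMap.mul' R T ∘ₗ TensorProduct.map a (Algebra.linearMap R T)) ∘ₗ
      (TensorProduct.rid R U).symm.toLinearMap = a := by
  ext x
  simp

theorem mul_map_comp_map_id (a : U →ₗ[R] T) (b : M →ₗ[R] T) (g : U →ₗ[R] M)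
    (Δ : U →ₗ[R] U ⊗[R] U) :
    (LinearMap.mul' R T ∘ₗ TensorProduct.map a b) ∘ₗ (TensorProduct.map LinearMap.id g ∘ₗ Δ) =
      LinearMap.mul' R T ∘ₗ TensorProduct.map a (b ∘ₗ g) ∘ₗ Δ := by
  rw [LinearMap.comp_assoc, ← LinearMap.comp_assoc _ _ (TensorProduct.map a b),
    ← TensorProduct.map_comp, LinearMap.comp_id]

theorem mul_map_comp_map {a : U →ₗ[R] T} {b : M →ₗ[R] T} {a' : U →ₗ[R] U} {b' : M →ₗ[R] M}
    (ha : a ∘ₗ a' = a) (hb : b ∘ₗ b' = b) :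
    (LinearMap.mul' R T ∘ₗ TensorProduct.map a b) ∘ₗ TensorProduct.map a' b' =
      LinearMap.mul' R T ∘ₗ TensorProduct.map a b := by
  rw [LinearMap.comp_assoc, ← TensorProduct.map_comp, ha, hb]

end LinearAlgebra

/-- The functional on a tensor power attached to a word. -/
def wordEval (N : ℕ) : (L : List (Fin 3)) → TPow k N L.length →ₗ[k⟦X⟧] TruncSeries k N
  | [] => Algebra.linearMap k⟦X⟧ (TruncSeries k N)
  | i :: L => LinearMap.mul' k⟦X⟧ (TruncSeries k N) ∘ₗ
      TensorProduct.map (entryFun N i) (wordEval N L)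

variable (H : CoproductCounit k) (N : ℕ)

/-- The convolution product is the tensor product of the functionals applied to the iterated
coproduct. -/
theorem wordEval_iter (L : List (Fin 3)) : ∀ i,
    wordEval N (i :: L) ∘ₗ H.iter N L.length = H.wordFun N i L := by
  induction L with
  | nil =>
    exact fun i => mul_map_comp_rid_symm _
  | cons j L ih =>
    exact fun i => (mul_map_comp_map_id _ _ _ _).trans (by rw [ih j]; rfl)

theorem entryFun_unitCounit (i : Fin 3) (x : UglMod k N) :
    entryFun N i (H.unitCounit N x) = 0 := by
  obtain ⟨x, rfl⟩ := red_surjective N x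
  have : H.unitCounit N (red k N x) = H.counit x • 1 := by
    rw [← Algebra.algebraMap_eq_smul_one]
    rfl
  rw [this, map_smul, entryFun_one, smul_zero]

/-- The projections `id - ε` do not change the value of functionals that vanish at `1`. -/
theorem wordEval_augPow (L : List (Fin 3)) :
    wordEval N L ∘ₗ H.augPow N L.length = wordEval N L := by
  induction L with
  | nil => rfl
  | cons i L ih =>
    have hi : entryFun N i ∘ₗ (LinearMap.id - (H.unitCounit N).toLinearMap) = entryFun N i := by
      refine LinearMap.ext fun x => ?_
      change entryFun N i (x - H.unitCounit N x) = _
      rw [map_sub, entryFun_unitCounit, sub_zero]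
    exact mul_map_comp_map hi ih

variable {H}

/-- Elements satisfying the divisibility conditions take values divisible by powers of `ħ`. -/
theorem exists_wordFun_eq {C : Subalgebra k⟦X⟧ (Ugl k)} {x : Ugl k} (hx : x ∈ H.harpoon C)
    (i : Fin 3) (L : List (Fin 3)) :
    ∃ y, H.wordFun N i L (red k N x) = (PowerSeries.X ^ (L.length + 1) : k⟦X⟧) • y := by
  have h := (Submodule.mem_iInf _).1 ((Submodule.mem_iInf _).1 hx.2 L.length) N
  obtain ⟨w, -, hw⟩ := h
  refine ⟨wordEval N (i :: L) w, ?_⟩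
  have h1 : wordEval N (i :: L) (H.delta N L.length (red k N x)) =
      H.wordFun N i L (red k N x) := by
    rw [← wordEval_iter]
    exact LinearMap.congr_fun (wordEval_augPow H N (i :: L)) (H.iter N L.length (red k N x))
  rw [← h1, ← map_smul]
  exact congrArg (wordEval N (i :: L)) hw.symm

/-- If an element satisfying the divisibility conditions is, modulo `ħ^(r+1)`, the multiple by
`ħ^r` of a combination of ordered monomials, then those of degree greater than `r` have
coefficients divisible by `ħ`. -/
theorem constantCoeff_eq_zero_of_harpoon {C : Subalgebra k⟦X⟧ (Ugl k)} {x y : Ugl k}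
    (hx : x ∈ H.harpoon C) {r : ℕ} {S : Finset (ℕ × ℕ × ℕ)} {c : ℕ × ℕ × ℕ → k⟦X⟧}
    (h : x = (PowerSeries.X ^ r : k⟦X⟧) • ∑ p ∈ S, c p • yMon k p +
      (PowerSeries.X ^ (r + 1) : k⟦X⟧) • y) {p : ℕ × ℕ × ℕ} (hp : p ∈ S) (hpr : r < deg p) :
    PowerSeries.constantCoeff (c p) = 0 := by
  refine CoproductCounit.constantCoeff_eq_zero_of_wordFun (H := H) (N := r) (m := r + 1)
    (Nat.succ_ne_zero r) (fun i L hL => truncConst_eq_zero ?_) hp hpr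
  obtain ⟨w, hw⟩ := exists_wordFun_eq (r + 1) hx i L
  rw [X_pow_smul_truncSeries hL, h, map_add, map_add, map_smul, map_smul, map_smul, map_smul,
    X_pow_smul_truncSeries le_rfl, add_zero] at hw
  exact hw

end Harpoon

/-! ### Elements satisfying the divisibility conditions -/

section TensorSubmodules

variable {R : Type*} [CommRing R]

theorem map_mem_of_map₂ {U M : Type*} [AddCommGroup U] [Module R U] [AddCommGroup M] [Module R M]
    {a : U →ₗ[R] U} {b : M →ₗ[R] M} {S S' : Submodule R U} {P P' : Submodule R M} {r s : R}
    (ha : S ≤ (S'.map (LinearMap.lsmul R U r)).comap a)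
    (hb : P ≤ (P'.map (LinearMap.lsmul R M s)).comap b) :
    Submodule.map₂ (TensorProduct.mk R U M) S P ≤
      ((Submodule.map₂ (TensorProduct.mk R U M) S' P').map
        (LinearMap.lsmul R (U ⊗[R] M) (r * s))).comap (TensorProduct.map a b) := by
  refine Submodule.map₂_le.2 fun u hu m hm => ?_
  obtain ⟨u', hu', h1⟩ := ha hu
  obtain ⟨m', hm', h2⟩ := hb hm
  refine ⟨u' ⊗ₜ m', Submodule.apply_mem_map₂ _ hu' hm', ?_⟩
  rw [TensorProduct.mk_apply, TensorProduct.map_tmul, ← h1, ← h2]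
  simp only [LinearMap.lsmul_apply, TensorProduct.tmul_smul, ← TensorProduct.smul_tmul', smul_smul]
  rw [mul_comm]

theorem map_id_comp_mem {U M : Type*} [AddCommGroup U] [Module R U] [AddCommGroup M] [Module R M]
    {g : U →ₗ[R] M} {S S' : Submodule R U} {P : Submodule R M} (hg : S' ≤ P.comap g)
    {x : U ⊗[R] U} (hx : x ∈ Submodule.map₂ (TensorProduct.mk R U U) S S') :
    TensorProduct.map LinearMap.id g x ∈ Submodule.map₂ (TensorProduct.mk R U M) S P := by
  have : Submodule.map₂ (TensorProduct.mk R U U) S S' ≤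
      (Submodule.map₂ (TensorProduct.mk R U M) S P).comap (TensorProduct.map LinearMap.id g) :=
    Submodule.map₂_le.2 fun u hu v hv => Submodule.apply_mem_map₂ _ hu (hg hv)
  exact this hx

variable {A : Type*} [Ring A] [Algebra R A]

/-- The image of the tensor product of two subalgebras. -/
def tensorSubalg (S S' : Subalgebra R A) : Subalgebra R (A ⊗[R] A) :=
  (Algebra.TensorProduct.map S.val S'.val).range

theorem tmul_mem_tensorSubalg {S S' : Subalgebra R A} {a b : A} (ha : a ∈ S) (hb : b ∈ S') :
    a ⊗ₜ b ∈ tensorSubalg S S' :=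
  ⟨⟨a, ha⟩ ⊗ₜ ⟨b, hb⟩, rfl⟩

theorem mem_map₂_of_mem_tensorSubalg {S S' : Subalgebra R A} {x : A ⊗[R] A}
    (hx : x ∈ tensorSubalg S S') :
    x ∈ Submodule.map₂ (TensorProduct.mk R A A) S.toSubmodule S'.toSubmodule := by
  obtain ⟨w, rfl⟩ := hx
  induction w using TensorProduct.induction_on with
  | zero => exact zero_mem _
  | tmul a b => exact Submodule.apply_mem_map₂ _ a.2 b.2
  | add v w hv hw => exact (map_add (Algebra.TensorProduct.map S.val S'.val) v w) ▸ add_mem hv hw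

end TensorSubmodules

variable {k : Type u} [Field k] [CharZero k]

/-- Algebra generators that are scalars modulo `ħ C` generate an algebra of such elements. -/
theorem exists_eq_smul_one_add {C : Subalgebra k⟦X⟧ (Ugl k)} {S : Set (Ugl k)}
    (hS : ∀ x ∈ S, ∃ c : k⟦X⟧, ∃ u ∈ C, x = c • 1 + (PowerSeries.X : k⟦X⟧) • u) {x : Ugl k}
    (hx : x ∈ Algebra.adjoin k⟦X⟧ S) :
    ∃ c : k⟦X⟧, ∃ u ∈ C, x = c • 1 + (PowerSeries.X : k⟦X⟧) • u := by
  induction hx using Algebra.adjoin_induction with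
  | mem x hx => exact hS x hx
  | algebraMap r => exact ⟨r, 0, zero_mem _, by
      rw [smul_zero, add_zero, Algebra.algebraMap_eq_smul_one]⟩
  | add x y _ _ hx hy =>
    obtain ⟨c, u, hu, rfl⟩ := hx
    obtain ⟨d, v, hv, rfl⟩ := hy
    exact ⟨c + d, u + v, add_mem hu hv, by rw [add_smul, smul_add]; abel⟩
  | mul x y _ _ hx hy =>
    obtain ⟨c, u, hu, rfl⟩ := hx
    obtain ⟨d, v, hv, rfl⟩ := hy
    refine ⟨c * d, c • v + d • u + (PowerSeries.X : k⟦X⟧) • (u * v), ?_, ?_⟩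
    · exact add_mem (add_mem (C.smul_mem hv c) (C.smul_mem hu d)) (C.smul_mem (C.mul_mem hu hv) _)
    · rw [add_mul, mul_add, mul_add, smul_mul_smul_comm, mul_one, smul_mul_smul_comm,
        smul_mul_smul_comm, smul_mul_smul_comm, one_mul, mul_one, smul_add, smul_add, smul_smul,
        smul_smul, smul_smul, mul_comm PowerSeries.X c, mul_comm PowerSeries.X d]
      abel

namespace CoproductCounit

variable (H : CoproductCounit k)

/-- The divisibility conditions are stated modulo every power of `ħ`, hence define a closed set. -/
theorem isHClosed_harpoon {C : Subalgebra k⟦X⟧ (Ugl k)}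
    (hC : IsHClosed (k := k) (C : Set (Ugl k))) :
    IsHClosed (k := k) (H.harpoon C : Set (Ugl k)) := by
  intro x hx
  refine ⟨hC x fun N => ?_, (Submodule.mem_iInf _).2 fun n => (Submodule.mem_iInf _).2 fun N => ?_⟩
  · obtain ⟨s, hs, y, h⟩ := hx N
    exact ⟨s, hs.1, y, h⟩
  · obtain ⟨s, hs, y, rfl⟩ := hx N
    have h := (Submodule.mem_iInf _).1 ((Submodule.mem_iInf _).1 hs.2 n) N
    have h0 : red k N (s + (PowerSeries.X ^ N : k⟦X⟧) • y) = red k N s := by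
      rw [map_add, red_eq_zero_iff.2 ⟨y, rfl⟩, add_zero]
    rw [Submodule.mem_comap, LinearMap.comp_apply] at h ⊢
    exact (congrArg (H.delta N n) h0).symm ▸ h

/-- The `n`-th tensor power of a submodule. -/
def subPow (N : ℕ) (S : Submodule k⟦X⟧ (UglMod k N)) : (n : ℕ) → Submodule k⟦X⟧ (TPow k N n)
  | 0 => ⊤
  | n + 1 => Submodule.map₂ (TensorProduct.mk k⟦X⟧ (UglMod k N) (TPow k N n)) S (subPow N S n)

/-- The iterated coproduct of an element of a right coideal. -/
theorem iter_mem {N : ℕ} {Q : Submodule k⟦X⟧ (UglMod k N)}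
    (hQ : Q ≤ (Submodule.map₂ (TensorProduct.mk k⟦X⟧ (UglMod k N) (UglMod k N)) Q Q).comap
      (H.comul N).toLinearMap) (n : ℕ) : ∀ {S : Submodule k⟦X⟧ (UglMod k N)},
    S ≤ (Submodule.map₂ (TensorProduct.mk k⟦X⟧ (UglMod k N) (UglMod k N)) S Q).comap
      (H.comul N).toLinearMap →
    S ≤ (Submodule.map₂ (TensorProduct.mk k⟦X⟧ (UglMod k N) (TPow k N n)) S
      (subPow N Q n)).comap (H.iter N n) := by
  induction n with
  | zero => exact fun _ x hx => Submodule.apply_mem_map₂ _ hx trivial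
  | succ n ih => exact fun hS x hx => map_id_comp_mem (ih hQ) (hS hx)

theorem sub_unitCounit_mem {N : ℕ} {S C : Submodule k⟦X⟧ (Ugl k)} (h1 : (1 : Ugl k) ∈ C)
    (hS : ∀ x ∈ S, ∃ c : k⟦X⟧, ∃ u ∈ C, x = c • 1 + (PowerSeries.X : k⟦X⟧) • u) :
    redSub k N S ≤ ((redSub k N C).map (LinearMap.lsmul k⟦X⟧ (UglMod k N) PowerSeries.X)).comap
      (LinearMap.id - (H.unitCounit N).toLinearMap) := by
  rintro _ ⟨x, hx, rfl⟩
  obtain ⟨c, u, hu, rfl⟩ := hS x hx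
  refine ⟨red k N (u - H.counit u • 1), ⟨_, sub_mem hu (C.smul_mem _ h1), rfl⟩, ?_⟩
  have hcounit : ∀ x, H.unitCounit N (red k N x) = H.counit x • 1 := fun x => by
    rw [← Algebra.algebraMap_eq_smul_one]
    rfl
  change _ = red k N (c • 1 + (PowerSeries.X : k⟦X⟧) • u) -
    H.unitCounit N (red k N (c • 1 + (PowerSeries.X : k⟦X⟧) • u))
  rw [hcounit]
  simp only [LinearMap.lsmul_apply, map_add, map_sub, map_smul, map_one, add_smul,
    smul_eq_mul, mul_one, mul_smul, smul_comm PowerSeries.X (H.counit u)]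
  abel

theorem augPow_mem {N : ℕ} {S : Submodule k⟦X⟧ (Ugl k)}
    (hS : ∀ x ∈ S, ∃ c : k⟦X⟧, ∃ u ∈ (Usl k).toSubmodule, x = c • 1 + (PowerSeries.X : k⟦X⟧) • u)
    (n : ℕ) : subPow N (redSub k N S) n ≤
      ((slPow k N n).map (LinearMap.lsmul k⟦X⟧ (TPow k N n) (PowerSeries.X ^ n))).comap
        (H.augPow N n) := by
  induction n with
  | zero => exact fun x _ => ⟨x, trivial, by rw [pow_zero]; exact one_smul _ _⟩
  | succ n ih =>
    rw [pow_succ']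
    exact map_mem_of_map₂ (H.sub_unitCounit_mem (Usl k).one_mem hS) ih

end CoproductCounit

variable (k) in
/-- The subalgebra generated by the group-like elements `t_i^{±1}` and the multiples by `ħ` of the
Chevalley generators, together with `k_{1,3}`, which is only a multiple by `ħ` of a quadratic
expression in the Chevalley generators. -/
def slLattice : Subalgebra k⟦X⟧ (Ugl k) :=
  Algebra.adjoin k⟦X⟧ (Set.range (t k) ∪ Set.range (tinv k) ∪
    Set.range (fun i => (PowerSeries.X : k⟦X⟧) • e k i) ∪
    Set.range (fun i => (PowerSeries.X : k⟦X⟧) • f k i) ∪ {k13 k})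

variable (k) in
/-- The subalgebra generated by `k_{1,2}`, `k_{1,3}`, `k_{2,3}`. -/
def stokesLattice : Subalgebra k⟦X⟧ (Ugl k) := Algebra.adjoin k⟦X⟧ {k12 k, k13 k, k23 k}

theorem t_mem_slLattice (i : Fin 2) : t k i ∈ slLattice k :=
  Algebra.subset_adjoin (by simp)

theorem tinv_mem_slLattice (i : Fin 2) : tinv k i ∈ slLattice k :=
  Algebra.subset_adjoin (by simp)

theorem X_smul_e_mem_slLattice (i : Fin 2) : (PowerSeries.X : k⟦X⟧) • e k i ∈ slLattice k :=
  Algebra.subset_adjoin (by simp)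

theorem X_smul_f_mem_slLattice (i : Fin 2) : (PowerSeries.X : k⟦X⟧) • f k i ∈ slLattice k :=
  Algebra.subset_adjoin (by simp)

theorem k13_mem_slLattice : k13 k ∈ slLattice k :=
  Algebra.subset_adjoin (by simp)

theorem qd_smul_mem_slLattice {a : Ugl k} (ha : (PowerSeries.X : k⟦X⟧) • a ∈ slLattice k) :
    qd k • a ∈ slLattice k := by
  rw [← X_mul_divH_qd, mul_comm, mul_smul]
  exact Subalgebra.smul_mem _ ha _

theorem qd_smul_coidealGen_mem_slLattice (i : Fin 2) :
    qd k • (f k i + -(q k • (tinv k i * e k i))) ∈ slLattice k := by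
  rw [smul_add, smul_neg, smul_comm, ← mul_smul_comm]
  exact add_mem (qd_smul_mem_slLattice (X_smul_f_mem_slLattice i)) (neg_mem (Subalgebra.smul_mem _
    (mul_mem (tinv_mem_slLattice i) (qd_smul_mem_slLattice (X_smul_e_mem_slLattice i))) _))

theorem k12_mem_slLattice : k12 k ∈ slLattice k := by
  rw [k12_eq]
  exact qd_smul_coidealGen_mem_slLattice 0

theorem k23_mem_slLattice : k23 k ∈ slLattice k := by
  rw [k23_eq]
  exact qd_smul_coidealGen_mem_slLattice 1

theorem k12_mem_stokesLattice : k12 k ∈ stokesLattice k := Algebra.subset_adjoin (by simp)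

theorem k13_mem_stokesLattice : k13 k ∈ stokesLattice k := Algebra.subset_adjoin (by simp)

theorem k23_mem_stokesLattice : k23 k ∈ stokesLattice k := Algebra.subset_adjoin (by simp)

theorem so_mem_Uso : so12 k ∈ Uso k ∧ so23 k ∈ Uso k ∧ so13 k ∈ Uso k := by
  have hq : (q k)⁻¹ * q k = 1 := by rw [mul_comm, q_mul_inv]
  have h12 : K12 k ∈ Uso k := subset_closedAdjoin _ (by simp)
  have h23 : K23 k ∈ Uso k := subset_closedAdjoin _ (by simp)
  have h13 : K13 k ∈ Uso k := subset_closedAdjoin _ (by simp)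
  refine ⟨?_, ?_, ?_⟩
  · have := Subalgebra.smul_mem _ h12 ((q k)⁻¹ ^ 2)
    rwa [K12_eq, smul_smul, ← mul_pow, hq, one_pow, one_smul] at this
  · have := Subalgebra.smul_mem _ h23 (q k)⁻¹
    rwa [K23_eq, smul_smul, hq, one_smul] at this
  · have := Subalgebra.smul_mem _ h13 ((q k)⁻¹ ^ 2)
    rwa [K13_eq, smul_smul, ← mul_pow, hq, one_pow, one_smul] at this

theorem y12_mem_Uso : y12 k ∈ Uso k := Subalgebra.smul_mem _ so_mem_Uso.1 _

theorem y13_mem_Uso : y13 k ∈ Uso k := Subalgebra.smul_mem _ so_mem_Uso.2.2 _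

theorem y23_mem_Uso : y23 k ∈ Uso k := Subalgebra.smul_mem _ so_mem_Uso.2.1 _

theorem so13_mem_Usl : so13 k ∈ Usl k := by
  have hf : ∀ i, f k i ∈ Usl k := fun i => subset_closedAdjoin _ (by simp)
  have he : ∀ i, e k i ∈ Usl k := fun i => subset_closedAdjoin _ (by simp)
  have ht : ∀ i, tinv k i ∈ Usl k := fun i => by
    obtain ⟨s, hs, h⟩ := exists_tinv_eq (k := k) i
    rw [h]
    exact add_mem (one_mem _) (Subalgebra.smul_mem _ hs _)
  have h : ∀ i, f k i + -(q k • (tinv k i * e k i)) ∈ Usl k := fun i =>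
    add_mem (hf i) (neg_mem (Subalgebra.smul_mem _ (mul_mem (ht i) (he i)) _))
  exact sub_mem (mul_mem (h 1) (h 0)) (Subalgebra.smul_mem _ (mul_mem (h 0) (h 1)) _)

theorem exists_of_mem_slLattice {x : Ugl k} (hx : x ∈ slLattice k) :
    ∃ c : k⟦X⟧, ∃ u ∈ (Usl k).toSubmodule, x = c • 1 + (PowerSeries.X : k⟦X⟧) • u := by
  refine exists_eq_smul_one_add (C := Usl k) (fun x hx => ?_) hx
  rcases hx with (((⟨i, rfl⟩ | ⟨i, rfl⟩) | ⟨i, rfl⟩) | ⟨i, rfl⟩) | rfl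
  · obtain ⟨s, hs, h⟩ := exists_t_eq (k := k) i
    exact ⟨1, s, hs, by rw [one_smul, h]⟩
  · obtain ⟨s, hs, h⟩ := exists_tinv_eq (k := k) i
    exact ⟨1, s, hs, by rw [one_smul, h]⟩
  · exact ⟨0, e k i, subset_closedAdjoin _ (by simp), by rw [zero_smul, zero_add]⟩
  · exact ⟨0, f k i, subset_closedAdjoin _ (by simp), by rw [zero_smul, zero_add]⟩
  · exact ⟨0, _, Subalgebra.smul_mem _ so13_mem_Usl _, by
      rw [zero_smul, zero_add, k13_eq_X_smul, y13]⟩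

theorem exists_of_mem_stokesLattice {x : Ugl k} (hx : x ∈ stokesLattice k) :
    ∃ c : k⟦X⟧, ∃ u ∈ (Uso k).toSubmodule, x = c • 1 + (PowerSeries.X : k⟦X⟧) • u := by
  refine exists_eq_smul_one_add (C := Uso k) (fun x hx => ?_) hx
  rcases hx with rfl | rfl | rfl
  · exact ⟨0, _, y12_mem_Uso, by rw [zero_smul, zero_add, k12_eq_X_smul]⟩
  · exact ⟨0, _, y13_mem_Uso, by rw [zero_smul, zero_add, k13_eq_X_smul]⟩
  · exact ⟨0, _, y23_mem_Uso, by rw [zero_smul, zero_add, k23_eq_X_smul]⟩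

theorem mem_of_exists {C : Subalgebra k⟦X⟧ (Ugl k)} {x : Ugl k}
    (h : ∃ c : k⟦X⟧, ∃ u ∈ C.toSubmodule, x = c • 1 + (PowerSeries.X : k⟦X⟧) • u) : x ∈ C := by
  obtain ⟨c, u, hu, rfl⟩ := h
  exact add_mem (C.smul_mem C.one_mem c) (C.smul_mem hu _)

namespace CoproductCounit

variable (H : CoproductCounit k) (N : ℕ)

theorem comul_mem_of_adjoin {S : Set (Ugl k)} {B : Subalgebra k⟦X⟧ (Ugl k)}
    (hS : ∀ x ∈ S, H.comul N (red k N x) ∈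
      tensorSubalg ((Algebra.adjoin k⟦X⟧ S).map (red k N)) (B.map (red k N))) :
    redSub k N (Algebra.adjoin k⟦X⟧ S).toSubmodule ≤
      (Submodule.map₂ (TensorProduct.mk k⟦X⟧ (UglMod k N) (UglMod k N))
        (redSub k N (Algebra.adjoin k⟦X⟧ S).toSubmodule) (redSub k N B.toSubmodule)).comap
          (H.comul N).toLinearMap := by
  rintro _ ⟨x, hx, rfl⟩
  have : Algebra.adjoin k⟦X⟧ S ≤ (tensorSubalg ((Algebra.adjoin k⟦X⟧ S).map (red k N))
      (B.map (red k N))).comap ((H.comul N).comp (red k N)) := Algebra.adjoin_le hS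
  have h := mem_map₂_of_mem_tensorSubalg (this hx)
  rw [Subalgebra.map_toSubmodule, Subalgebra.map_toSubmodule] at h
  exact h

theorem comul_k12 : H.comul N (red k N (k12 k)) =
    1 ⊗ₜ red k N (k12 k) + red k N (k12 k) ⊗ₜ red k N (tinv k 0) := by
  rw [k12_eq, map_smul, map_smul, comul_so12]
  simp only [smul_add, TensorProduct.tmul_smul, ← TensorProduct.smul_tmul']

theorem comul_k23 : H.comul N (red k N (k23 k)) =
    1 ⊗ₜ red k N (k23 k) + red k N (k23 k) ⊗ₜ red k N (tinv k 1) := by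
  rw [k23_eq, map_smul, map_smul, comul_so23]
  simp only [smul_add, TensorProduct.tmul_smul, ← TensorProduct.smul_tmul']

theorem comul_k13 : H.comul N (red k N (k13 k)) =
    1 ⊗ₜ red k N (k13 k) + red k N (k13 k) ⊗ₜ red k N (tinv k 0 * tinv k 1)
      + ((q k)⁻¹ * qd k) • (red k N (k12 k) ⊗ₜ red k N (f k 1 * tinv k 0))
      - qd k • (red k N (k23 k) ⊗ₜ red k N (tinv k 0 * tinv k 1 * e k 0)) := by
  rw [k13_eq, k12_eq, k23_eq, map_smul, map_smul, comul_so13, map_smul, map_smul]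
  simp only [smul_add, smul_sub, TensorProduct.tmul_smul, ← TensorProduct.smul_tmul']
  rw [smul_comm (qd k) ((q k)⁻¹ * qd k)]

theorem comul_k13_mem {A B : Subalgebra k⟦X⟧ (UglMod k N)} (h12 : red k N (k12 k) ∈ A)
    (h13 : red k N (k13 k) ∈ A) (h23 : red k N (k23 k) ∈ A) (hB : (slLattice k).map (red k N) ≤ B) :
    H.comul N (red k N (k13 k)) ∈ tensorSubalg A B := by
  have key : ∀ {a b}, a ∈ A → b ∈ slLattice k → a ⊗ₜ red k N b ∈ tensorSubalg A B :=
    fun ha hb => tmul_mem_tensorSubalg ha (hB ⟨_, hb, rfl⟩)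
  have htt := mul_mem (tinv_mem_slLattice (k := k) 0) (tinv_mem_slLattice 1)
  have hf := mul_mem (qd_smul_mem_slLattice (X_smul_f_mem_slLattice (k := k) 1))
    (tinv_mem_slLattice 0)
  have he := mul_mem htt (qd_smul_mem_slLattice (X_smul_e_mem_slLattice (k := k) 0))
  rw [smul_mul_assoc] at hf
  rw [mul_smul_comm] at he
  rw [comul_k13, mul_smul, ← TensorProduct.tmul_smul (qd k), ← TensorProduct.tmul_smul (qd k),
    ← map_smul, ← map_smul]
  exact sub_mem (add_mem (add_mem (key (one_mem _) k13_mem_slLattice) (key h13 htt))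
    (Subalgebra.smul_mem _ (key h12 hf) _)) (key h23 he)

theorem comul_slLattice : redSub k N (slLattice k).toSubmodule ≤
    (Submodule.map₂ (TensorProduct.mk k⟦X⟧ (UglMod k N) (UglMod k N))
      (redSub k N (slLattice k).toSubmodule) (redSub k N (slLattice k).toSubmodule)).comap
        (H.comul N).toLinearMap := by
  have key : ∀ {a b : Ugl k}, a ∈ slLattice k → b ∈ slLattice k →
      red k N a ⊗ₜ red k N b ∈ tensorSubalg ((slLattice k).map (red k N))
        ((slLattice k).map (red k N)) :=
    fun ha hb => tmul_mem_tensorSubalg ⟨_, ha, rfl⟩ ⟨_, hb, rfl⟩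
  refine H.comul_mem_of_adjoin N fun x hx => ?_
  rcases hx with (((⟨i, rfl⟩ | ⟨i, rfl⟩) | ⟨i, rfl⟩) | ⟨i, rfl⟩) | rfl
  · rw [comul_t]
    exact key (t_mem_slLattice i) (t_mem_slLattice i)
  · rw [comul_tinv]
    exact key (tinv_mem_slLattice i) (tinv_mem_slLattice i)
  · rw [map_smul, map_smul, comul_e, smul_add, TensorProduct.smul_tmul', ← TensorProduct.tmul_smul,
      ← map_smul, ← map_one (red k N)]
    exact add_mem (key (X_smul_e_mem_slLattice i) (one_mem _))
      (key (t_mem_slLattice i) (X_smul_e_mem_slLattice i))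
  · rw [map_smul, map_smul, comul_f, smul_add, TensorProduct.smul_tmul', ← TensorProduct.tmul_smul,
      ← map_smul, ← map_one (red k N)]
    exact add_mem (key (X_smul_f_mem_slLattice i) (tinv_mem_slLattice i))
      (key (one_mem _) (X_smul_f_mem_slLattice i))
  · exact H.comul_k13_mem N ⟨_, k12_mem_slLattice, rfl⟩ ⟨_, k13_mem_slLattice, rfl⟩
      ⟨_, k23_mem_slLattice, rfl⟩ le_rfl

/-- `stokesLattice` is a right coideal over `slLattice`. -/
theorem comul_stokesLattice : redSub k N (stokesLattice k).toSubmodule ≤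
    (Submodule.map₂ (TensorProduct.mk k⟦X⟧ (UglMod k N) (UglMod k N))
      (redSub k N (stokesLattice k).toSubmodule) (redSub k N (slLattice k).toSubmodule)).comap
        (H.comul N).toLinearMap := by
  have key : ∀ {a b : Ugl k}, a ∈ stokesLattice k → b ∈ slLattice k →
      red k N a ⊗ₜ red k N b ∈ tensorSubalg ((stokesLattice k).map (red k N))
        ((slLattice k).map (red k N)) :=
    fun ha hb => tmul_mem_tensorSubalg ⟨_, ha, rfl⟩ ⟨_, hb, rfl⟩
  refine H.comul_mem_of_adjoin N fun x hx => ?_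
  rcases hx with rfl | rfl | rfl
  · rw [comul_k12, ← map_one (red k N)]
    exact add_mem (key (one_mem _) k12_mem_slLattice)
      (key k12_mem_stokesLattice (tinv_mem_slLattice 0))
  · exact H.comul_k13_mem N ⟨_, k12_mem_stokesLattice, rfl⟩ ⟨_, k13_mem_stokesLattice, rfl⟩
      ⟨_, k23_mem_stokesLattice, rfl⟩ le_rfl
  · rw [comul_k23, ← map_one (red k N)]
    exact add_mem (key (one_mem _) k23_mem_slLattice)
      (key k23_mem_stokesLattice (tinv_mem_slLattice 1))

/-- A subalgebra of `C` that is a right coideal over `slLattice` and consists of scalars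
modulo `ħ C` satisfies the divisibility conditions. -/
theorem le_harpoon {B C : Subalgebra k⟦X⟧ (Ugl k)}
    (hB : ∀ x ∈ B, ∃ c : k⟦X⟧, ∃ u ∈ C.toSubmodule, x = c • 1 + (PowerSeries.X : k⟦X⟧) • u)
    (hΔ : ∀ N, redSub k N B.toSubmodule ≤
      (Submodule.map₂ (TensorProduct.mk k⟦X⟧ (UglMod k N) (UglMod k N))
        (redSub k N B.toSubmodule) (redSub k N (slLattice k).toSubmodule)).comap
          (H.comul N).toLinearMap) : B.toSubmodule ≤ H.harpoon C := by
  intro x hx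
  refine ⟨mem_of_exists (hB x hx), (Submodule.mem_iInf _).2 fun n =>
    (Submodule.mem_iInf _).2 fun N => ?_⟩
  have h1 := H.iter_mem (H.comul_slLattice N) n (hΔ N) ⟨x, hx, rfl⟩
  have h2 := map_mem_of_map₂ (H.sub_unitCounit_mem (N := N) C.one_mem hB)
    (H.augPow_mem (N := N) (fun x hx => exists_of_mem_slLattice hx) n) h1
  rw [← pow_succ'] at h2
  exact h2

/-- `slLattice` lies in `U_ħ(sl_3)'`. -/
theorem slLattice_le : (slLattice k).toSubmodule ≤ H.slPrime :=
  H.le_harpoon (fun _ hx => exists_of_mem_slLattice hx) H.comul_slLattice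

/-- The generators `k_{i,j}`, and their products, satisfy the divisibility conditions. -/
theorem stokesLattice_le : (stokesLattice k).toSubmodule ≤ H.harpoon (Uso k) :=
  H.le_harpoon (fun _ hx => exists_of_mem_stokesLattice hx) H.comul_stokesLattice

end CoproductCounit

/-! ### Closures and sums of ordered monomials -/

section Closure

variable {k : Type u} [Field k] [CharZero k]

/-- The `ħ`-adic closure of a subalgebra. -/
def hClosure (B : Subalgebra k⟦X⟧ (Ugl k)) : Subalgebra k⟦X⟧ (Ugl k) where
  carrier := {x | ∀ N : ℕ, ∃ s ∈ B, ∃ y, x = s + (PowerSeries.X ^ N : k⟦X⟧) • y}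
  mul_mem' {a b} ha hb N := by
    obtain ⟨s, hs, y, rfl⟩ := ha N
    obtain ⟨s', hs', y', hb'⟩ := hb N
    refine ⟨s * s', mul_mem hs hs', y * b + s * y', ?_⟩
    rw [add_mul, smul_mul_assoc]
    nth_rewrite 1 [hb']
    rw [mul_add, mul_smul_comm, smul_add]
    abel
  add_mem' {a b} ha hb N := by
    obtain ⟨s, hs, y, rfl⟩ := ha N
    obtain ⟨s', hs', y', rfl⟩ := hb N
    exact ⟨s + s', add_mem hs hs', y + y', by rw [smul_add]; abel⟩
  algebraMap_mem' r N := ⟨_, algebraMap_mem B r, 0, by rw [smul_zero, add_zero]⟩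

theorem le_hClosure (B : Subalgebra k⟦X⟧ (Ugl k)) : B ≤ hClosure B := fun x hx _ =>
  ⟨x, hx, 0, by rw [smul_zero, add_zero]⟩

theorem isHClosed_hClosure (B : Subalgebra k⟦X⟧ (Ugl k)) :
    IsHClosed (k := k) (hClosure B : Set (Ugl k)) := by
  intro x hx N
  obtain ⟨s, hs, y, rfl⟩ := hx N
  obtain ⟨s', hs', y', rfl⟩ := hs N
  exact ⟨s', hs', y' + y, by rw [smul_add, add_assoc]⟩

theorem closedAdjoin_le_hClosure {S : Set (Ugl k)} {B : Subalgebra k⟦X⟧ (Ugl k)}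
    (h : S ⊆ B) : closedAdjoin k S ≤ hClosure B :=
  closedAdjoin_le (h.trans (le_hClosure B)) (isHClosed_hClosure B)

/-- Elements of `U_ħ(so_3)` are limits of combinations of ordered monomials. -/
theorem exists_sum_yMon {x : Ugl k} (hx : x ∈ Uso k) (N : ℕ) :
    ∃ (S : Finset (ℕ × ℕ × ℕ)) (c : ℕ × ℕ × ℕ → k⟦X⟧) (y : Ugl k),
      x = ∑ p ∈ S, c p • yMon k p + (PowerSeries.X ^ N : k⟦X⟧) • y := by
  have hso : ∀ {a : Ugl k}, divH (qd k) • a ∈ Algebra.adjoin k⟦X⟧ {y12 k, y13 k, y23 k} →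
      a ∈ Algebra.adjoin k⟦X⟧ {y12 k, y13 k, y23 k} := fun {a} ha => by
    have := Subalgebra.smul_mem _ ha (divH (qd k))⁻¹
    rwa [smul_smul, mul_comm, divH_qd_mul_inv, one_smul] at this
  have hle : ({K12 k, K23 k, K13 k} : Set (Ugl k)) ⊆
      Algebra.adjoin k⟦X⟧ {y12 k, y13 k, y23 k} := by
    rintro _ (rfl | rfl | rfl)
    · rw [K12_eq]
      exact Subalgebra.smul_mem _ (hso (Algebra.subset_adjoin (by simp [y12]))) _
    · rw [K23_eq]
      exact Subalgebra.smul_mem _ (hso (Algebra.subset_adjoin (by simp [y23]))) _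
    · rw [K13_eq]
      exact Subalgebra.smul_mem _ (hso (Algebra.subset_adjoin (by simp [y13]))) _
  obtain ⟨s, hs, y, rfl⟩ := closedAdjoin_le_hClosure hle hx N
  have hs' : s ∈ Submodule.span k⟦X⟧ (Set.range (yMon k)) := by
    rw [← Subalgebra.mem_toSubmodule, (reorders_y (k := k)).adjoin_le] at hs
    exact hs
  obtain ⟨c, rfl⟩ := Finsupp.mem_span_range_iff_exists_finsupp.1 hs'
  exact ⟨c.support, c, y, rfl⟩

/-- The exponents of total degree less than `N`. -/
def degLT (N : ℕ) : Finset (ℕ × ℕ × ℕ) :=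
  (Finset.range N ×ˢ Finset.range N ×ˢ Finset.range N).filter fun p => deg p < N

theorem mem_degLT {N : ℕ} {p : ℕ × ℕ × ℕ} : p ∈ degLT N ↔ deg p < N := by
  rw [degLT, Finset.mem_filter, Finset.mem_product, Finset.mem_product]
  simp only [Finset.mem_range, deg]
  omega

/-- The element `x` is the sum of the series `∑ c_p k^p` modulo `ħ^N`. -/
def ApproxSum (N : ℕ) (c : ℕ × ℕ × ℕ → k⟦X⟧) (x : Ugl k) : Prop :=
  ∃ y, x = ∑ p ∈ degLT N, c p • monomial k p + (PowerSeries.X ^ N : k⟦X⟧) • y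

variable {N : ℕ} {c c' : ℕ × ℕ × ℕ → k⟦X⟧} {x x' : Ugl k}

theorem smul_monomial_eq {p : ℕ × ℕ × ℕ} {a : k⟦X⟧}
    (h : PowerSeries.X ^ N ∣ a * PowerSeries.X ^ deg p) :
    ∃ y, a • monomial k p = (PowerSeries.X ^ N : k⟦X⟧) • y := by
  obtain ⟨b, hb⟩ := h
  exact ⟨b • yMon k p, by rw [monomial_eq, smul_smul, hb, mul_smul]⟩

theorem sum_smul_monomial_eq {S : Finset (ℕ × ℕ × ℕ)}
    (h : ∀ p ∈ S, PowerSeries.X ^ N ∣ c p * PowerSeries.X ^ deg p) :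
    ∃ y, ∑ p ∈ S, c p • monomial k p = (PowerSeries.X ^ N : k⟦X⟧) • y := by
  choose! y hy using fun p hp => smul_monomial_eq (h p hp)
  exact ⟨∑ p ∈ S, y p, by rw [Finset.smul_sum]; exact Finset.sum_congr rfl hy⟩

omit [CharZero k] in
theorem dvd_of_le_deg {p : ℕ × ℕ × ℕ} (h : N ≤ deg p) (a : k⟦X⟧) :
    PowerSeries.X ^ N ∣ a * PowerSeries.X ^ deg p :=
  (pow_dvd_pow _ h).mul_left a

theorem approxSum_iff_of_superset {S : Finset (ℕ × ℕ × ℕ)} (hS : degLT N ⊆ S) :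
    ApproxSum N c x ↔
      ∃ y, x = ∑ p ∈ S, c p • monomial k p + (PowerSeries.X ^ N : k⟦X⟧) • y := by
  classical
  obtain ⟨z, hz⟩ := sum_smul_monomial_eq (k := k) (c := c) (N := N) (S := S \ degLT N)
    fun p hp => dvd_of_le_deg (by
      have := (Finset.mem_sdiff.1 hp).2
      rw [mem_degLT] at this
      omega) _
  rw [← Finset.sum_sdiff hS, hz]
  constructor
  · rintro ⟨y, rfl⟩
    exact ⟨y - z, by rw [smul_sub]; abel⟩
  · rintro ⟨y, rfl⟩
    exact ⟨z + y, by rw [smul_add]; abel⟩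

theorem ApproxSum.mono {M : ℕ} (h : ApproxSum N c x) (hM : M ≤ N) : ApproxSum M c x := by
  have hS : degLT M ⊆ degLT N := fun p hp => by
    rw [mem_degLT] at hp ⊢
    omega
  obtain ⟨y, rfl⟩ := h
  refine (approxSum_iff_of_superset hS).2 ⟨(PowerSeries.X ^ (N - M) : k⟦X⟧) • y, ?_⟩
  rw [smul_smul, ← pow_add, Nat.add_sub_cancel' hM]

theorem ApproxSum.add (h : ApproxSum N c x) (h' : ApproxSum N c' x') :
    ApproxSum N (c + c') (x + x') := by
  obtain ⟨y, rfl⟩ := h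
  obtain ⟨y', rfl⟩ := h'
  refine ⟨y + y', ?_⟩
  simp only [Pi.add_apply, add_smul, Finset.sum_add_distrib, smul_add]
  abel

theorem ApproxSum.smul (h : ApproxSum N c x) (a : k⟦X⟧) : ApproxSum N (a • c) (a • x) := by
  obtain ⟨y, rfl⟩ := h
  refine ⟨a • y, ?_⟩
  simp only [Pi.smul_apply, smul_assoc, smul_add, Finset.smul_sum, smul_comm a]

theorem approxSum_zero_iff (H : CoproductCounit k) : (∃ y, x = (PowerSeries.X ^ N : k⟦X⟧) • y) ∧
    ApproxSum N c x → ∀ p, PowerSeries.X ^ N ∣ c p * PowerSeries.X ^ deg p := by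
  rintro ⟨⟨u, rfl⟩, y, h⟩ p
  by_cases hp : p ∈ degLT N
  · refine X_pow_dvd_of_sum_yMon H (S := degLT N) (c := fun p => c p * PowerSeries.X ^ deg p) N
      (u := u - y) ?_ p hp
    rw [smul_sub, h, add_sub_cancel_right]
    simp only [monomial_eq, smul_smul]
  · rw [mem_degLT] at hp
    exact dvd_of_le_deg (by omega) _

theorem ApproxSum.congr (h : ApproxSum N c x)
    (hc : ∀ p, PowerSeries.X ^ N ∣ (c p - c' p) * PowerSeries.X ^ deg p) : ApproxSum N c' x := by
  obtain ⟨y, rfl⟩ := h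
  obtain ⟨z, hz⟩ := sum_smul_monomial_eq (S := degLT N) (c := fun p => c p - c' p) fun p _ => hc p
  refine ⟨z + y, ?_⟩
  rw [smul_add, ← hz, ← add_assoc, ← Finset.sum_add_distrib]
  simp only [sub_smul, add_sub_cancel]

/-- The coefficients of approximate expansions are unique up to the precision that matters: the
monomial `k^p` is itself divisible by `ħ ^ deg p`. -/
theorem ApproxSum.dvd_sub (H : CoproductCounit k) (h : ApproxSum N c x) (h' : ApproxSum N c' x)
    (p : ℕ × ℕ × ℕ) : PowerSeries.X ^ N ∣ (c p - c' p) * PowerSeries.X ^ deg p := by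
  refine approxSum_zero_iff H (x := 0) (c := fun p => c p - c' p)
    ⟨⟨0, by rw [smul_zero]⟩, ?_⟩ p
  have := h.add (h'.smul (-1))
  rw [neg_one_smul k⟦X⟧ x, add_neg_cancel] at this
  refine this.congr fun p => ?_
  simp [sub_eq_add_neg]

theorem hasHSum_iff : HasHSum (k := k) (fun p => c p • monomial k p) x ↔
    ∀ N, ApproxSum N c x := by
  classical
  constructor
  · intro h N
    obtain ⟨s₀, hs⟩ := h N
    obtain ⟨y, hy⟩ := hs (s₀ ∪ degLT N) Finset.subset_union_left
    refine (approxSum_iff_of_superset (S := s₀ ∪ degLT N) Finset.subset_union_right).2 ⟨y, ?_⟩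
    rw [← hy, add_sub_cancel]
  · intro h N
    refine ⟨degLT N, fun s hs => ?_⟩
    obtain ⟨y, hy⟩ := (approxSum_iff_of_superset hs).1 (h N)
    exact ⟨y, by rw [hy, add_sub_cancel_left]⟩

theorem exists_approxSum (c : ℕ × ℕ × ℕ → k⟦X⟧) : ∃ x, ∀ N, ApproxSum N c x := by
  classical
  obtain ⟨x, hx⟩ := Ugl_series (k := k) fun n =>
    ∑ p ∈ (degLT (n + 1)).filter (fun p => deg p = n), c p • yMon k p
  refine ⟨x, fun N => ?_⟩
  obtain ⟨r, hr⟩ := hx N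
  refine ⟨r, ?_⟩
  rw [hr]
  congr 1
  rw [← Finset.sum_fiberwise_of_maps_to (s := degLT N) (t := Finset.range N) (g := deg)
    fun p hp => Finset.mem_range.2 (mem_degLT.1 hp)]
  refine Finset.sum_congr rfl fun n hn => ?_
  have hS : (degLT N).filter (fun p => deg p = n) =
      (degLT (n + 1)).filter (fun p => deg p = n) := by
    ext p
    have := Finset.mem_range.1 hn
    simp only [Finset.mem_filter, mem_degLT]
    omega
  rw [hS, Finset.smul_sum]
  refine Finset.sum_congr rfl fun p hp => ?_
  rw [monomial_eq, (Finset.mem_filter.1 hp).2, smul_comm]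

/-- Approximate expansions to all orders come from a single series, since their coefficients
converge. -/
theorem exists_coeff_of_approx (H : CoproductCounit k)
    (h : ∀ N, ∃ c : ℕ × ℕ × ℕ → k⟦X⟧, ApproxSum N c x) :
    ∃ c : ℕ × ℕ × ℕ → k⟦X⟧, ∀ N, ApproxSum N c x := by
  choose d hd using h
  refine ⟨fun p => PowerSeries.mk fun n => PowerSeries.coeff n (d (n + deg p + 1) p), fun N =>
    (hd N).congr fun p => ?_⟩
  by_cases hp : N ≤ deg p
  · exact dvd_of_le_deg hp _
  · obtain ⟨m, rfl⟩ := Nat.exists_eq_add_of_le (not_le.1 hp).le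
    rw [add_comm, pow_add]
    refine mul_dvd_mul_right (PowerSeries.X_pow_dvd_iff.2 fun n hn => ?_) _
    rw [map_sub, PowerSeries.coeff_mk, sub_eq_zero]
    have h1 := (hd (n + deg p + 1)).dvd_sub H ((hd (m + deg p)).mono (by omega)) p
    rw [show n + deg p + 1 = n + 1 + deg p by ring, pow_add,
      mul_dvd_mul_iff_right (pow_ne_zero _ PowerSeries.X_ne_zero)] at h1
    have h2 := PowerSeries.X_pow_dvd_iff.1 h1 n (Nat.lt_succ_self n)
    rw [map_sub, sub_eq_zero] at h2
    rw [show n + deg p + 1 = n + 1 + deg p by ring]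
    exact h2.symm

theorem monomial_mem (p : ℕ × ℕ × ℕ) : monomial k p ∈ stokesLattice k :=
  mul_mem (mul_mem (pow_mem k12_mem_stokesLattice _) (pow_mem k13_mem_stokesLattice _))
    (pow_mem k23_mem_stokesLattice _)

/-- Elements satisfying the divisibility conditions have approximate expansions in the `k_{i,j}`.
The error of an expansion modulo `ħ^N` satisfies the conditions as well; it is `ħ^N` times a
combination of ordered monomials in `y12`, `y13`, `y23`, and by `constantCoeff_eq_zero_of_harpoon`
only those of degree at most `N` count modulo `ħ^(N+1)`. -/
theorem exists_approx_of_mem_harpoon (H : CoproductCounit k) (hx : x ∈ H.harpoon (Uso k)) (N : ℕ) :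
    ∃ c : ℕ × ℕ × ℕ → k⟦X⟧, ApproxSum N c x := by
  classical
  induction N with
  | zero => exact ⟨0, x, by simp [degLT]⟩
  | succ N ih =>
    obtain ⟨c, y, hc⟩ := ih
    set x' := x - ∑ p ∈ degLT N, c p • monomial k p with hx'
    have hmem : x' ∈ H.harpoon (Uso k) :=
      sub_mem hx (sum_mem fun p _ => Submodule.smul_mem _ _ (H.stokesLattice_le (monomial_mem p)))
    have hxy : x' = (PowerSeries.X ^ N : k⟦X⟧) • y := by rw [hx', hc, add_sub_cancel_left]
    obtain ⟨S, a, z, hz⟩ := exists_sum_yMon hmem.1 (N + 1)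
    have hdvd := X_pow_dvd_of_sum_yMon H (S := S) (c := a) N
      (u := y - (PowerSeries.X : k⟦X⟧) • z) (by
        rw [smul_sub, ← hxy, smul_smul, ← pow_succ, hz, add_sub_cancel_right])
    choose! d hd using hdvd
    have hz' : x' = (PowerSeries.X ^ N : k⟦X⟧) • ∑ p ∈ S, d p • yMon k p +
        (PowerSeries.X ^ (N + 1) : k⟦X⟧) • z := by
      rw [hz, Finset.smul_sum]
      congr 1
      exact Finset.sum_congr rfl fun p hp => by rw [hd p hp, mul_smul]
    have hconst : ∀ p ∈ S, N < deg p → PowerSeries.constantCoeff (d p) = 0 := fun p hp hpN =>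
      constantCoeff_eq_zero_of_harpoon hmem hz' hp hpN
    -- the monomials of degree at most `N` are expressed in the rescaled generators
    have hlow : ∀ p ∈ S, ∃ w, (PowerSeries.X ^ N : k⟦X⟧) • (d p • yMon k p) =
        (if deg p < N + 1 then PowerSeries.X ^ (N - deg p) * d p else 0) • monomial k p +
          (PowerSeries.X ^ (N + 1) : k⟦X⟧) • w := by
      intro p hp
      by_cases hpN : deg p < N + 1
      · refine ⟨0, ?_⟩
        rw [if_pos hpN, smul_zero, add_zero, monomial_eq, smul_smul, smul_smul, mul_right_comm,
          ← pow_add, Nat.sub_add_cancel (by omega)]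
      · obtain ⟨e, he⟩ := PowerSeries.X_dvd_iff.2 (hconst p hp (by omega))
        exact ⟨e • yMon k p, by
          rw [if_neg hpN, zero_smul, zero_add, he, smul_smul, smul_smul, pow_succ, mul_assoc]⟩
    choose! w hw using hlow
    let b : ℕ × ℕ × ℕ → k⟦X⟧ := fun p =>
      if p ∈ S then (if deg p < N + 1 then PowerSeries.X ^ (N - deg p) * d p else 0) else 0
    have hb : ApproxSum (N + 1) b x' := by
      refine (approxSum_iff_of_superset (S := S ∪ degLT (N + 1)) Finset.subset_union_right).2
        ⟨∑ p ∈ S, w p + z, ?_⟩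
      rw [← Finset.sum_subset (Finset.subset_union_left (s₁ := S)) fun p _ hp => by
        simp only [b, if_neg hp, zero_smul], hz', Finset.smul_sum, smul_add, Finset.smul_sum,
        ← add_assoc, ← Finset.sum_add_distrib]
      congr 1
      exact Finset.sum_congr rfl fun p hp => by rw [hw p hp]; simp only [b, if_pos hp]
    let c₀ : ℕ × ℕ × ℕ → k⟦X⟧ := fun p => if p ∈ degLT N then c p else 0
    have hc₀ : ApproxSum (N + 1) c₀ (∑ p ∈ degLT N, c p • monomial k p) := by
      have hS : degLT N ⊆ degLT (N + 1) := fun p hp => by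
        rw [mem_degLT] at hp ⊢
        omega
      refine ⟨0, ?_⟩
      rw [smul_zero, add_zero, ← Finset.sum_subset hS fun p _ hp => by
        simp only [c₀, if_neg hp, zero_smul]]
      exact Finset.sum_congr rfl fun p hp => by simp only [c₀, if_pos hp]
    refine ⟨c₀ + b, ?_⟩
    have := hc₀.add hb
    rwa [hx', add_sub_cancel] at this

end Closure

/-! ### Adic completeness of products of copies of `k⟦X⟧` -/

section AdicComplete

variable {k : Type*} [Field k] {ι : Type*} {M : Type*} [AddCommGroup M] [Module k⟦X⟧ M]

theorem sub_mem_X_pow_smul_iff (e : (ι → k⟦X⟧) ≃ₗ[k⟦X⟧] M) {n : ℕ} {x y : M} :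
    x ≡ y [SMOD (Ideal.span {(PowerSeries.X : k⟦X⟧)} ^ n • ⊤ : Submodule k⟦X⟧ M)] ↔
      ∀ i, PowerSeries.X ^ n ∣ e.symm x i - e.symm y i := by
  rw [SModEq.sub_mem, Ideal.span_singleton_pow, Submodule.ideal_span_singleton_smul,
    Submodule.mem_smul_pointwise_iff_exists]
  constructor
  · rintro ⟨w, -, hw⟩ i
    exact ⟨e.symm w i, by rw [← Pi.sub_apply, ← map_sub, ← hw, map_smul]; rfl⟩
  · intro h
    choose d hd using h
    refine ⟨e d, trivial, ?_⟩
    rw [← map_smul, ← e.apply_symm_apply (x - y)]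
    congr 1
    ext1 i
    rw [map_sub]
    exact (hd i).symm

theorem isAdicComplete_of_equiv_pi (e : (ι → k⟦X⟧) ≃ₗ[k⟦X⟧] M) :
    IsAdicComplete (Ideal.span {(PowerSeries.X : k⟦X⟧)}) M where
  haus' x hx := by
    simp only [sub_mem_X_pow_smul_iff e] at hx
    rw [← e.symm.map_eq_zero_iff]
    ext i n
    have := PowerSeries.X_pow_dvd_iff.1 (hx (n + 1) i) n (Nat.lt_succ_self n)
    rwa [map_zero, Pi.zero_apply, sub_zero] at this
  prec' f hf := by
    simp only [sub_mem_X_pow_smul_iff e] at hf ⊢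
    refine ⟨e fun i => PowerSeries.mk fun n => PowerSeries.coeff n (e.symm (f (n + 1)) i),
      fun n i => PowerSeries.X_pow_dvd_iff.2 fun m hm => ?_⟩
    have := PowerSeries.X_pow_dvd_iff.1 (hf (Nat.succ_le_of_lt hm) i) m (Nat.lt_succ_self m)
    rw [map_sub, sub_eq_zero] at this
    rw [e.symm_apply_apply, map_sub, PowerSeries.coeff_mk, ← this, sub_self]

end AdicComplete

/-! ### The quantized algebra of functions on Stokes matrices -/

section StokesClosure

variable (k : Type u) [Field k] [CharZero k]

/-- The closed subalgebra generated by `k_{1,2}`, `k_{1,3}`, `k_{2,3}`. -/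
def stokesClosure : Subalgebra k⟦X⟧ (Ugl k) := hClosure (stokesLattice k)

variable {k}

theorem mem_stokesClosure_of_approxSum {c : ℕ × ℕ × ℕ → k⟦X⟧} {x : Ugl k}
    (h : ∀ N, ApproxSum N c x) : x ∈ stokesClosure k := by
  intro N
  obtain ⟨y, hy⟩ := h N
  exact ⟨_, sum_mem fun p _ => Subalgebra.smul_mem _ (monomial_mem p) _, y, hy⟩

theorem exists_coeff_of_mem_harpoon (H : CoproductCounit k) {x : Ugl k}
    (hx : x ∈ H.harpoon (Uso k)) : ∃ c : ℕ × ℕ × ℕ → k⟦X⟧, ∀ N, ApproxSum N c x :=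
  exists_coeff_of_approx H fun N => exists_approx_of_mem_harpoon H hx N

/-- The elements satisfying the divisibility conditions are the limits of polynomials in the
`k_{i,j}`. -/
theorem stokesClosure_toSubmodule (H : CoproductCounit k) :
    (stokesClosure k).toSubmodule = H.harpoon (Uso k) := by
  apply le_antisymm
  · intro x hx
    refine H.isHClosed_harpoon (isHClosed_closedAdjoin _) x fun N => ?_
    obtain ⟨s, hs, y, h⟩ := hx N
    exact ⟨s, H.stokesLattice_le hs, y, h⟩
  · intro x hx
    obtain ⟨c, hc⟩ := exists_coeff_of_mem_harpoon H hx
    exact mem_stokesClosure_of_approxSum hc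

theorem eq_of_approxSum {c : ℕ × ℕ × ℕ → k⟦X⟧} {x x' : Ugl k} (h : ∀ N, ApproxSum N c x)
    (h' : ∀ N, ApproxSum N c x') : x = x' := by
  refine Ugl_ext fun N => ?_
  obtain ⟨y, rfl⟩ := h N
  obtain ⟨y', hy'⟩ := h' N
  rw [← sub_eq_zero, ← map_sub, red_eq_zero_iff]
  nth_rewrite 1 [hy']
  exact ⟨y - y', by rw [smul_sub]; abel⟩

theorem coeff_unique (H : CoproductCounit k) {c c' : ℕ × ℕ × ℕ → k⟦X⟧} {x : Ugl k}
    (h : ∀ N, ApproxSum N c x) (h' : ∀ N, ApproxSum N c' x) : c = c' := by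
  ext p n
  have h1 := (h (n + 1 + deg p)).dvd_sub H (h' (n + 1 + deg p)) p
  rw [pow_add, mul_dvd_mul_iff_right (pow_ne_zero _ PowerSeries.X_ne_zero)] at h1
  have h2 := PowerSeries.X_pow_dvd_iff.1 h1 n (Nat.lt_succ_self n)
  rwa [map_sub, sub_eq_zero] at h2

/-- The sum of the series `∑ c_p k^p`, as a linear function of the coefficients. -/
def monomialSum : (ℕ × ℕ × ℕ → k⟦X⟧) →ₗ[k⟦X⟧] stokesClosure k where
  toFun c := ⟨(exists_approxSum c).choose,
    mem_stokesClosure_of_approxSum (exists_approxSum c).choose_spec⟩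
  map_add' c c' := Subtype.ext (eq_of_approxSum (exists_approxSum (c + c')).choose_spec
    fun N => ((exists_approxSum c).choose_spec N).add ((exists_approxSum c').choose_spec N))
  map_smul' a c := Subtype.ext (eq_of_approxSum (exists_approxSum (a • c)).choose_spec
    fun N => ((exists_approxSum c).choose_spec N).smul a)

theorem monomialSum_spec (c : ℕ × ℕ × ℕ → k⟦X⟧) (N : ℕ) :
    ApproxSum N c (monomialSum c : Ugl k) :=
  (exists_approxSum c).choose_spec N

/-- Elements of the closed subalgebra correspond to families of coefficients. -/
def monomialEquiv (H : CoproductCounit k) : (ℕ × ℕ × ℕ → k⟦X⟧) ≃ₗ[k⟦X⟧] stokesClosure k :=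
  LinearEquiv.ofBijective monomialSum ⟨fun c c' h => coeff_unique H (monomialSum_spec c)
      fun N => h ▸ monomialSum_spec c' N, fun x => by
    have hx : (x : Ugl k) ∈ H.harpoon (Uso k) := by
      rw [← stokesClosure_toSubmodule]
      exact x.2
    obtain ⟨c, hc⟩ := exists_coeff_of_mem_harpoon H hx
    exact ⟨c, Subtype.ext (eq_of_approxSum (monomialSum_spec c) hc)⟩⟩

/-- The coefficients of an element of the closed subalgebra. -/
def coeffs (H : CoproductCounit k) : stokesClosure k ≃ₗ[k⟦X⟧] (ℕ × ℕ × ℕ → k⟦X⟧) :=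
  (monomialEquiv H).symm

theorem coeffs_spec (H : CoproductCounit k) (x : stokesClosure k) (N : ℕ) :
    ApproxSum N (coeffs H x) (x : Ugl k) := by
  have h := monomialSum_spec (coeffs H x) N
  have h' : monomialSum (coeffs H x) = x := (monomialEquiv H).apply_symm_apply x
  rwa [h'] at h

theorem coeffs_eq (H : CoproductCounit k) {x : stokesClosure k} {c : ℕ × ℕ × ℕ → k⟦X⟧}
    (h : ∀ N, ApproxSum N c (x : Ugl k)) : coeffs H x = c :=
  coeff_unique H (coeffs_spec H x) h

theorem coeffs_dvd (H : CoproductCounit k) {x : stokesClosure k} {m : ℕ} {u : Ugl k}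
    (h : (x : Ugl k) = (PowerSeries.X ^ m : k⟦X⟧) • u) (p : ℕ × ℕ × ℕ) :
    PowerSeries.X ^ m ∣ coeffs H x p * PowerSeries.X ^ deg p :=
  approxSum_zero_iff H ⟨⟨u, h⟩, coeffs_spec H x m⟩ p

theorem comul_mem_of_mem_stokesClosure (H : CoproductCounit k) {x : Ugl k}
    (hx : x ∈ stokesClosure k) (N : ℕ) :
    H.comul N (red k N x) ∈ Submodule.map₂ (TensorProduct.mk k⟦X⟧ (UglMod k N) (UglMod k N))
      (redSub k N (stokesClosure k).toSubmodule) (redSub k N H.slPrime) := by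
  obtain ⟨s, hs, y, rfl⟩ := hx N
  rw [map_add, red_eq_zero_iff.2 ⟨y, rfl⟩, add_zero]
  exact Submodule.map₂_le_map₂ (Submodule.map_mono (le_hClosure (stokesLattice k)))
    (Submodule.map_mono H.slLattice_le) (H.comul_stokesLattice N ⟨s, hs, rfl⟩)

end StokesClosure

/-! ### The presentation -/

section Presented

variable {k : Type u} [Field k] [CharZero k]

theorem k12_mul_k23 : k12 k * k23 k = q k • (k23 k * k12 k) - (q k * qd k) • k13 k := by
  simp only [k12_eq, k23_eq, k13_eq, smul_mul_smul_comm, so23_mul_so12, smul_add, smul_smul]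
  rw [← mul_assoc, mul_right_comm (q k) (qd k * qd k), q_mul_inv, one_mul, mul_assoc (q k),
    add_sub_cancel_right]

theorem k23_mul_k13 : k23 k * k13 k = q k • (k13 k * k23 k) - qd k • k12 k := by
  simp only [k12_eq, k23_eq, k13_eq, smul_mul_smul_comm, so23_mul_so13, smul_sub, smul_smul]
  rw [mul_comm (q k)]

theorem k13_mul_k12 : k13 k * k12 k = q k • (k12 k * k13 k) - qd k • k23 k := by
  simp only [k12_eq, k23_eq, k13_eq, smul_mul_smul_comm, so13_mul_so12, smul_sub, smul_smul]
  rw [mul_comm (q k)]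

namespace StokesAlg

theorem x12_mul_x23 : gen k .x12 * gen k .x23 =
    q k • (gen k .x23 * gen k .x12) - (q k * qd k) • gen k .x13 := by
  have h := RingQuot.mkAlgHom_rel k⟦X⟧ (StokesRel.r1 (k := k))
  rwa [map_mul, map_sub, map_smul, map_smul, map_mul] at h

theorem x23_mul_x13 : gen k .x23 * gen k .x13 =
    q k • (gen k .x13 * gen k .x23) - qd k • gen k .x12 := by
  have h := RingQuot.mkAlgHom_rel k⟦X⟧ (StokesRel.r2 (k := k))
  rwa [map_mul, map_sub, map_smul, map_smul, map_mul] at h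

theorem x13_mul_x12 : gen k .x13 * gen k .x12 =
    q k • (gen k .x12 * gen k .x13) - qd k • gen k .x23 := by
  have h := RingQuot.mkAlgHom_rel k⟦X⟧ (StokesRel.r3 (k := k))
  rwa [map_mul, map_sub, map_smul, map_smul, map_mul] at h

/-- The homomorphism from the presented algebra given by elements satisfying the relations. -/
def lift {B : Type*} [Ring B] [Algebra k⟦X⟧ B] (v : StokesGen → B)
    (h1 : v .x12 * v .x23 = q k • (v .x23 * v .x12) - (q k * qd k) • v .x13)
    (h2 : v .x23 * v .x13 = q k • (v .x13 * v .x23) - qd k • v .x12)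
    (h3 : v .x13 * v .x12 = q k • (v .x12 * v .x13) - qd k • v .x23) :
    StokesAlg k →ₐ[k⟦X⟧] B :=
  RingQuot.liftAlgHom k⟦X⟧ ⟨FreeAlgebra.lift k⟦X⟧ v, by
    rintro _ _ (_ | _ | _) <;> simpa using by assumption⟩

theorem lift_gen {B : Type*} [Ring B] [Algebra k⟦X⟧ B] (v : StokesGen → B)
    (h1 : v .x12 * v .x23 = q k • (v .x23 * v .x12) - (q k * qd k) • v .x13)
    (h2 : v .x23 * v .x13 = q k • (v .x13 * v .x23) - qd k • v .x12)
    (h3 : v .x13 * v .x12 = q k • (v .x12 * v .x13) - qd k • v .x23) (s : StokesGen) :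
    lift v h1 h2 h3 (gen k s) = v s :=
  (RingQuot.liftAlgHom_mkAlgHom_apply _ _ _ _).trans (FreeAlgebra.lift_ι_apply v s)

theorem adjoin_range_gen : Algebra.adjoin k⟦X⟧ (Set.range (gen k)) = ⊤ := by
  have h : Set.range (gen k) =
      RingQuot.mkAlgHom k⟦X⟧ (StokesRel k) '' Set.range (FreeAlgebra.ι k⟦X⟧) := by
    rw [← Set.range_comp]
    rfl
  rw [h]
  refine (AlgHom.map_adjoin (RingQuot.mkAlgHom k⟦X⟧ (StokesRel k)) _).symm.trans ?_
  rw [FreeAlgebra.adjoin_range_ι, Algebra.map_top]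
  exact (AlgHom.range_eq_top _).2 (RingQuot.mkAlgHom_surjective _ _)

variable (k) in
/-- The ordered monomials in the generators of the presented algebra. -/
def mon (p : ℕ × ℕ × ℕ) : StokesAlg k := ordMon (gen k .x12) (gen k .x13) (gen k .x23) p

theorem reorders : Reorders k⟦X⟧ (gen k .x12) (gen k .x13) (gen k .x23) where
  zx := ⟨(q k)⁻¹, qd k, by
    have hq : (q k)⁻¹ * q k = 1 := by rw [mul_comm, q_mul_inv]
    rw [x12_mul_x23, smul_sub, smul_smul, smul_smul, ← mul_assoc, hq, one_mul, one_smul,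
      sub_add_cancel]⟩
  zy := ⟨q k, -qd k, by rw [x23_mul_x13, neg_smul, sub_eq_add_neg]⟩
  yx := ⟨q k, -qd k, by rw [x13_mul_x12, neg_smul, sub_eq_add_neg]⟩

theorem exists_sum_mon (a : StokesAlg k) :
    ∃ (S : Finset (ℕ × ℕ × ℕ)) (c : ℕ × ℕ × ℕ → k⟦X⟧), a = ∑ p ∈ S, c p • mon k p := by
  have h : Set.range (gen k) = {gen k .x12, gen k .x13, gen k .x23} := by
    ext x
    constructor
    · rintro ⟨_ | _ | _, rfl⟩ <;> simp
    · rintro (rfl | rfl | rfl) <;> exact ⟨_, rfl⟩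
  have ha : a ∈ Submodule.span k⟦X⟧ (Set.range (mon k)) := by
    have := (reorders (k := k)).adjoin_le
    rw [← h, adjoin_range_gen] at this
    exact this ▸ (trivial : a ∈ (⊤ : Submodule k⟦X⟧ (StokesAlg k)))
  obtain ⟨c, rfl⟩ := Finsupp.mem_span_range_iff_exists_finsupp.1 ha
  exact ⟨c.support, c, rfl⟩

variable (k) in
/-- The generators `k_{i,j}`. -/
def genImage : StokesGen → Ugl k
  | .x12 => k12 k
  | .x23 => k23 k
  | .x13 => k13 k

variable (k) in
/-- The homomorphism sending the generators to the `k_{i,j}`. -/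
def toUgl : StokesAlg k →ₐ[k⟦X⟧] Ugl k :=
  lift (genImage k) k12_mul_k23 k23_mul_k13 k13_mul_k12

theorem toUgl_gen (s : StokesGen) : toUgl k (gen k s) = genImage k s := lift_gen _ _ _ _ _

theorem toUgl_mon (p : ℕ × ℕ × ℕ) : toUgl k (mon k p) = monomial k p := by
  rw [mon, ordMon_map, toUgl_gen, toUgl_gen, toUgl_gen]
  rfl

theorem range_toUgl : (toUgl k).range = stokesLattice k := by
  have h : Set.range (genImage k) = {k12 k, k13 k, k23 k} := by
    ext x
    constructor
    · rintro ⟨_ | _ | _, rfl⟩ <;> simp [genImage]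
    · rintro (rfl | rfl | rfl)
      exacts [⟨.x12, rfl⟩, ⟨.x13, rfl⟩, ⟨.x23, rfl⟩]
  rw [← Algebra.map_top, ← adjoin_range_gen, AlgHom.map_adjoin, ← Set.range_comp,
    stokesLattice, ← h]
  congr 2
  funext s
  exact toUgl_gen s

theorem gen_mem_ideal (s : StokesGen) : gen k s ∈ ideal k :=
  TwoSidedIdeal.subset_span (Or.inr ⟨s, rfl⟩)

theorem algebraMap_X_mem_ideal : algebraMap k⟦X⟧ (StokesAlg k) PowerSeries.X ∈ ideal k :=
  TwoSidedIdeal.subset_span (Or.inl rfl)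

theorem mon_mem (p : ℕ × ℕ × ℕ) : mon k p ∈ ideal k ^ deg p := by
  rw [deg, Ideal.IsTwoSided.pow_add, Ideal.IsTwoSided.pow_add]
  exact Ideal.mul_mem_mul (Ideal.mul_mem_mul (Ideal.pow_mem_pow (gen_mem_ideal _) _)
    (Ideal.pow_mem_pow (gen_mem_ideal _) _)) (Ideal.pow_mem_pow (gen_mem_ideal _) _)

theorem X_pow_smul_mem {n m : ℕ} {a : StokesAlg k} (ha : a ∈ ideal k ^ n) :
    (PowerSeries.X ^ m : k⟦X⟧) • a ∈ ideal k ^ (m + n) := by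
  rw [Algebra.smul_def, map_pow, Ideal.IsTwoSided.pow_add]
  exact Ideal.mul_mem_mul (Ideal.pow_mem_pow algebraMap_X_mem_ideal _) ha

theorem toUgl_mem_hIdeal {a : StokesAlg k} (ha : a ∈ ideal k) : toUgl k a ∈ hIdeal k (Ugl k) 1 := by
  have hle : TwoSidedIdeal.span ({algebraMap k⟦X⟧ (StokesAlg k) PowerSeries.X} ∪
      Set.range (gen k)) ≤ TwoSidedIdeal.ker ((red k 1).comp (toUgl k)) := by
    refine TwoSidedIdeal.span_le.2 ?_
    rintro _ (rfl | ⟨s, rfl⟩)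
    · refine (TwoSidedIdeal.mem_ker _).2 (red_eq_zero_iff.2 ⟨1, ?_⟩)
      rw [pow_one, ← Algebra.algebraMap_eq_smul_one]
      exact (toUgl k).commutes _
    · refine (TwoSidedIdeal.mem_ker _).2 (red_eq_zero_iff.2 ?_)
      change ∃ y, toUgl k (gen k s) = _
      rw [toUgl_gen, pow_one]
      rcases s with _ | _ | _
      exacts [⟨_, k12_eq_X_smul⟩, ⟨_, k23_eq_X_smul⟩, ⟨_, k13_eq_X_smul⟩]
  exact mem_hIdeal.2
    (red_eq_zero_iff.1 ((TwoSidedIdeal.mem_ker ((red k 1).comp (toUgl k))).1 (hle ha)))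

theorem toUgl_mem_of_mem_pow (m : ℕ) : ∀ {a : StokesAlg k}, a ∈ ideal k ^ m →
    ∃ y, toUgl k a = (PowerSeries.X ^ m : k⟦X⟧) • y := by
  induction m with
  | zero => exact fun {a} _ => ⟨toUgl k a, by rw [pow_zero, one_smul]⟩
  | succ m ih =>
    intro a ha
    rw [Submodule.pow_succ] at ha
    refine Submodule.mul_induction_on ha (fun b hb c hc => ?_) fun b c hb hc => ?_
    · obtain ⟨y, hy⟩ := ih hb
      obtain ⟨z, hz⟩ := mem_hIdeal.1 (toUgl_mem_hIdeal hc)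
      exact ⟨y * z, by rw [map_mul, hy, hz, smul_mul_smul_comm, ← pow_add]⟩
    · obtain ⟨y, hy⟩ := hb
      obtain ⟨z, hz⟩ := hc
      exact ⟨y + z, by rw [map_add, hy, hz, smul_add]⟩

/-- The powers of the ideal are the preimages of the powers of `ħ`. By the independence of the
ordered monomials, the coefficient of `k^p` in an element divisible by `ħ^m` is divisible by
`ħ ^ (m - deg p)`. -/
theorem mem_pow_iff (H : CoproductCounit k) {m : ℕ} {a : StokesAlg k} :
    a ∈ ideal k ^ m ↔ ∃ y, toUgl k a = (PowerSeries.X ^ m : k⟦X⟧) • y := by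
  refine ⟨toUgl_mem_of_mem_pow m, ?_⟩
  rintro ⟨y, hy⟩
  obtain ⟨S, c, rfl⟩ := exists_sum_mon a
  have hdvd := X_pow_dvd_of_sum_yMon H (S := S) (c := fun p => c p * PowerSeries.X ^ deg p) m
    (u := y) (by
      rw [← hy, map_sum]
      exact Finset.sum_congr rfl fun p _ => by rw [map_smul, toUgl_mon, monomial_eq, smul_smul])
  refine sum_mem fun p hp => ?_
  by_cases hpm : m ≤ deg p
  · rw [Algebra.smul_def]
    exact Ideal.mul_mem_left _ _ (Ideal.pow_le_pow_right hpm (mon_mem p))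
  · obtain ⟨d, hd⟩ : PowerSeries.X ^ (m - deg p) ∣ c p := by
      have h := hdvd p hp
      rwa [← Nat.sub_add_cancel (not_le.1 hpm).le, pow_add,
        mul_dvd_mul_iff_right (pow_ne_zero _ PowerSeries.X_ne_zero)] at h
    rw [hd, mul_comm, mul_smul, Algebra.smul_def]
    refine Ideal.mul_mem_left _ _ ?_
    have h := X_pow_smul_mem (m := m - deg p) (mon_mem (k := k) p)
    rwa [Nat.sub_add_cancel (not_le.1 hpm).le] at h

end StokesAlg

variable (H : CoproductCounit k)

/-- The quotient of the presented algebra by a power of the ideal, inside `U / ħ^m U`. -/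
def quotMap (m : ℕ) : (StokesAlg k ⧸ StokesAlg.ideal k ^ m) →ₐ[k⟦X⟧] UglMod k m :=
  Ideal.Quotient.liftₐ _ ((red k m).comp (StokesAlg.toUgl k)) fun _ ha =>
    red_eq_zero_iff.2 (StokesAlg.toUgl_mem_of_mem_pow m ha)

theorem quotMap_mk (m : ℕ) (a : StokesAlg k) :
    quotMap m (Ideal.Quotient.mk _ a) = red k m (StokesAlg.toUgl k a) := rfl

theorem quotMap_injective (H : CoproductCounit k) (m : ℕ) :
    Function.Injective (quotMap (k := k) m) := by
  rw [injective_iff_map_eq_zero]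
  intro a ha
  obtain ⟨a, rfl⟩ := Ideal.Quotient.mk_surjective a
  rw [quotMap_mk, red_eq_zero_iff] at ha
  exact Ideal.Quotient.eq_zero_iff_mem.2 ((StokesAlg.mem_pow_iff H).2 ha)

theorem red_mem_range_quotMap (m : ℕ) {x : Ugl k} (hx : x ∈ stokesClosure k) :
    red k m x ∈ (quotMap (k := k) m).range := by
  obtain ⟨s, hs, y, rfl⟩ := hx m
  rw [← StokesAlg.range_toUgl] at hs
  obtain ⟨a, rfl⟩ := hs
  exact ⟨Ideal.Quotient.mk _ a, by rw [map_add, red_eq_zero_iff.2 ⟨y, rfl⟩, add_zero]; rfl⟩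

/-- The reduction of the closed subalgebra modulo `ħ^m`, in terms of the presented algebra. -/
def toQuot (m : ℕ) : stokesClosure k →ₐ[k⟦X⟧] StokesAlg k ⧸ StokesAlg.ideal k ^ m :=
  (AlgEquiv.ofInjective (quotMap m) (quotMap_injective H m)).symm.toAlgHom.comp
    (((red k m).comp (stokesClosure k).val).codRestrict (quotMap m).range
      fun x => red_mem_range_quotMap m x.2)

theorem quotMap_toQuot (m : ℕ) (x : stokesClosure k) : quotMap m (toQuot H m x) = red k m x :=
  congrArg Subtype.val ((AlgEquiv.ofInjective (quotMap m) (quotMap_injective H m)).apply_symm_apply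
    ⟨red k m x, red_mem_range_quotMap m x.2⟩)

theorem toQuot_eq_iff {m : ℕ} {x : stokesClosure k} {a : StokesAlg k} :
    toQuot H m x = Ideal.Quotient.mk _ a ↔
      ∃ y, (x : Ugl k) - StokesAlg.toUgl k a = (PowerSeries.X ^ m : k⟦X⟧) • y := by
  rw [← (quotMap_injective H m).eq_iff, quotMap_toQuot, quotMap_mk, ← sub_eq_zero, ← map_sub,
    red_eq_zero_iff]

/-- The closed subalgebra maps to the completion of the presented algebra. -/
def toCompl : stokesClosure k →ₐ[k⟦X⟧] StokesCompl k :=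
  (AlgHom.pi (toQuot H)).codRestrict
    (StokesCompl k) fun x => by
      simp only [StokesCompl, Algebra.mem_iInf]
      intro m
      change Ideal.Quotient.factorₐ k⟦X⟧
        (Ideal.pow_le_pow_right (I := StokesAlg.ideal k) m.le_succ) (toQuot H (m + 1) x) =
          toQuot H m x
      obtain ⟨a, ha⟩ := Ideal.Quotient.mk_surjective (toQuot H (m + 1) x)
      obtain ⟨y, hy⟩ := (toQuot_eq_iff H).1 ha.symm
      rw [← ha]
      refine Eq.symm ((toQuot_eq_iff H).2 ⟨(PowerSeries.X : k⟦X⟧) • y, ?_⟩)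
      rw [hy, smul_smul, pow_succ]

theorem toCompl_injective : Function.Injective (toCompl H) := by
  rw [injective_iff_map_eq_zero]
  intro x hx
  refine Subtype.ext (Ugl_eq_zero fun m => ?_)
  rw [← quotMap_toQuot H]
  have : toQuot H m x = 0 := congrFun (congrArg Subtype.val hx) m
  rw [this, map_zero]

/-- Representatives of a compatible family converge in `U_ħ(gl_3)`. -/
theorem toCompl_surjective : Function.Surjective (toCompl H) := by
  intro a
  choose b hb using fun m => Ideal.Quotient.mk_surjective (a.1 m)
  have hstep : ∀ m, ∃ y, StokesAlg.toUgl k (b (m + 1)) - StokesAlg.toUgl k (b m) =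
      (PowerSeries.X ^ m : k⟦X⟧) • y := by
    intro m
    rw [← map_sub]
    refine StokesAlg.toUgl_mem_of_mem_pow m (Ideal.Quotient.eq.1 ?_)
    have h := a.2
    simp only [StokesCompl, Algebra.mem_iInf] at h
    have hm : Ideal.Quotient.factorₐ k⟦X⟧
      (Ideal.pow_le_pow_right (I := StokesAlg.ideal k) m.le_succ) (a.1 (m + 1)) = a.1 m := h m
    rw [← hb m, ← hb (m + 1)] at hm
    exact hm
  choose w hw using hstep
  obtain ⟨x, hx⟩ := Ugl_series w
  have hx' : ∀ N, ∃ r, x + StokesAlg.toUgl k (b 0) - StokesAlg.toUgl k (b N) =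
      (PowerSeries.X ^ N : k⟦X⟧) • r := by
    intro N
    obtain ⟨r, hr⟩ := hx N
    refine ⟨r, ?_⟩
    simp only [← hw] at hr
    rw [Finset.sum_range_sub (fun m => StokesAlg.toUgl k (b m))] at hr
    rw [hr]
    abel
  have hmem : x + StokesAlg.toUgl k (b 0) ∈ stokesClosure k := fun N => by
    obtain ⟨r, hr⟩ := hx' N
    exact ⟨StokesAlg.toUgl k (b N), StokesAlg.range_toUgl (k := k) ▸ ⟨b N, rfl⟩, r, by
      rw [← hr, add_sub_cancel]⟩
  refine ⟨⟨_, hmem⟩, Subtype.ext (funext fun m => ?_)⟩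
  rw [← hb m]
  exact (toQuot_eq_iff H).2 (hx' m)

/-- The completion of the presented algebra is the closed subalgebra. -/
def complEquiv : StokesCompl k ≃ₐ[k⟦X⟧] stokesClosure k :=
  (AlgEquiv.ofBijective (toCompl H) ⟨toCompl_injective H, toCompl_surjective H⟩).symm

theorem complEquiv_gen (s : StokesGen) :
    (complEquiv H (StokesCompl.gen k s) : Ugl k) = StokesAlg.genImage k s := by
  have hmem : StokesAlg.genImage k s ∈ stokesClosure k := by
    rw [← StokesAlg.toUgl_gen]
    exact le_hClosure _ (StokesAlg.range_toUgl (k := k) ▸ ⟨_, rfl⟩)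
  have h : toCompl H ⟨_, hmem⟩ = StokesCompl.gen k s :=
    Subtype.ext (funext fun m => (toQuot_eq_iff H).2 ⟨0, by
      rw [StokesAlg.toUgl_gen, sub_self, smul_zero]⟩)
  rw [← h]
  exact congrArg Subtype.val
    ((AlgEquiv.ofBijective (toCompl H) ⟨toCompl_injective H, toCompl_surjective H⟩).symm_apply_apply
      ⟨_, hmem⟩)

theorem complEquiv_eq_zero_iff (x : StokesCompl k) (m : ℕ) :
    (x : ∀ m : ℕ, StokesAlg k ⧸ StokesAlg.ideal k ^ m) m = 0 ↔
      ∃ y : Ugl k, (complEquiv H x : Ugl k) = (PowerSeries.X ^ m : k⟦X⟧) • y := by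
  have h : toCompl H (complEquiv H x) = x :=
    (AlgEquiv.ofBijective (toCompl H)
      ⟨toCompl_injective H, toCompl_surjective H⟩).apply_symm_apply x
  have hm : (x : ∀ m : ℕ, StokesAlg k ⧸ StokesAlg.ideal k ^ m) m = toQuot H m (complEquiv H x) := by
    nth_rewrite 1 [← h]
    rfl
  rw [hm, ← (quotMap_injective H m).eq_iff, quotMap_toQuot, map_zero, red_eq_zero_iff]

end Presented

/-! ### The order filtration of formal power series -/

section OrderFiltration

variable {k : Type*} [Field k]

/-- The power series of order at least `m`. -/
def orderIdeal (k : Type*) [Field k] (m : ℕ) : Ideal (MvPowerSeries (Fin 3) k) where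
  carrier := {f | (m : ℕ∞) ≤ f.order}
  add_mem' ha hb := (le_min ha hb).trans MvPowerSeries.min_order_le_add
  zero_mem' := by simp
  smul_mem' c f hf := by
    rw [smul_eq_mul]
    exact (le_add_left hf).trans MvPowerSeries.le_order_mul

theorem mem_orderIdeal_iff {m : ℕ} {f : MvPowerSeries (Fin 3) k} :
    f ∈ orderIdeal k m ↔ ∀ d, Finsupp.degree d < m → MvPowerSeries.coeff d f = 0 :=
  ⟨fun h _ hd => MvPowerSeries.coeff_of_lt_order (lt_of_lt_of_le (Nat.cast_lt.2 hd) h),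
    fun h => MvPowerSeries.nat_le_order h⟩

theorem eq_of_sub_mem_orderIdeal {f g : MvPowerSeries (Fin 3) k}
    (h : ∀ m, f - g ∈ orderIdeal k m) : f = g := by
  refine sub_eq_zero.1 (MvPowerSeries.ext fun d => ?_)
  exact mem_orderIdeal_iff.1 (h (Finsupp.degree d + 1)) d (Nat.lt_succ_self _)

theorem pderiv_mem_orderIdeal {m : ℕ} {f : MvPowerSeries (Fin 3) k} (hf : f ∈ orderIdeal k (m + 1))
    (i : Fin 3) : MvPowerSeries.pderiv k i f ∈ orderIdeal k m := by
  refine mem_orderIdeal_iff.2 fun d hd => ?_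
  rw [MvPowerSeries.coeff_pderiv, mem_orderIdeal_iff.1 hf, zero_mul]
  rw [map_add, Finsupp.degree_single]
  omega

end OrderFiltration

/-! ### The Dubrovin–Ugaglia bracket -/

section Bracket

variable {k : Type*} [Field k] (a a' b : MvPowerSeries (Fin 3) k)

theorem stokesBracket_add_left :
    stokesBracket (a + a') b = stokesBracket a b + stokesBracket a' b := by
  simp only [stokesBracket, map_add]
  ring

theorem stokesBracket_mul_left :
    stokesBracket (a * a') b = a * stokesBracket a' b + stokesBracket a b * a' := by
  simp only [stokesBracket, Derivation.leibniz, smul_eq_mul]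
  ring

theorem stokesBracket_swap : stokesBracket b a = -stokesBracket a b := by
  simp only [stokesBracket]
  ring

theorem stokesBracket_sub_left :
    stokesBracket (a - a') b = stokesBracket a b - stokesBracket a' b := by
  simp only [stokesBracket, map_sub]
  ring

theorem stokesBracket_C_left (c : k) : stokesBracket (MvPowerSeries.C c) b = 0 := by
  have h : ∀ i, MvPowerSeries.pderiv k i (MvPowerSeries.C c : MvPowerSeries (Fin 3) k) = 0 :=
    fun i => (MvPowerSeries.pderiv k i).map_algebraMap c
  simp [stokesBracket, h]

theorem stokesBracket_mem_orderIdeal {m : ℕ} (ha : a ∈ orderIdeal k (m + 1)) :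
    stokesBracket a b ∈ orderIdeal k m := by
  have h := pderiv_mem_orderIdeal ha
  exact add_mem (add_mem
    (Ideal.mul_mem_left _ _
      (sub_mem (Ideal.mul_mem_right _ _ (h 0)) (Ideal.mul_mem_right _ _ (h 1))))
    (Ideal.mul_mem_left _ _
      (sub_mem (Ideal.mul_mem_right _ _ (h 1)) (Ideal.mul_mem_right _ _ (h 2)))))
    (Ideal.mul_mem_left _ _
      (sub_mem (Ideal.mul_mem_right _ _ (h 2)) (Ideal.mul_mem_right _ _ (h 0))))

theorem stokesBracket_X_two_zero : stokesBracket (MvPowerSeries.X 2) (MvPowerSeries.X 0) =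
    (MvPowerSeries.X 2 * MvPowerSeries.X 0 - 2 * MvPowerSeries.X 1 : MvPowerSeries (Fin 3) k) := by
  simp [stokesBracket]

theorem stokesBracket_X_zero_one : stokesBracket (MvPowerSeries.X 0) (MvPowerSeries.X 1) =
    (MvPowerSeries.X 0 * MvPowerSeries.X 1 - 2 * MvPowerSeries.X 2 : MvPowerSeries (Fin 3) k) := by
  simp [stokesBracket]

theorem stokesBracket_X_one_two : stokesBracket (MvPowerSeries.X 1) (MvPowerSeries.X 2) =
    (MvPowerSeries.X 1 * MvPowerSeries.X 2 - 2 * MvPowerSeries.X 0 : MvPowerSeries (Fin 3) k) := by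
  simp [stokesBracket]

end Bracket

/-! ### Specialization at `ħ = 0` -/

section Specialization

variable {k : Type u} [Field k] [CharZero k]

/-- The exponents of the monomial in `k_{1,2}`, `k_{1,3}`, `k_{2,3}` that specializes to the
monomial in `x`, `y`, `z` with exponents `n`. -/
def revExp (n : Fin 3 →₀ ℕ) : ℕ × ℕ × ℕ := (n 2, n 1, n 0)

theorem deg_revExp (n : Fin 3 →₀ ℕ) : deg (revExp n) = Finsupp.degree n := by
  rw [Finsupp.degree_eq_sum, Fin.sum_univ_three, deg, revExp]
  ring

/-- The inclusion of the presented algebra. -/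
def toClosure : StokesAlg k →ₐ[k⟦X⟧] stokesClosure k :=
  (StokesAlg.toUgl k).codRestrict (stokesClosure k) fun a =>
    le_hClosure _ (StokesAlg.range_toUgl (k := k) ▸ ⟨a, rfl⟩)

variable (k) in
/-- The coordinate functions of which the generators are deformations. -/
def genSymbol : StokesGen → MvPowerSeries (Fin 3) k
  | .x12 => MvPowerSeries.X 2
  | .x23 => MvPowerSeries.X 0
  | .x13 => MvPowerSeries.X 1

theorem constantCoeff_qd : PowerSeries.constantCoeff (qd k) = 0 := by
  rw [← X_mul_divH_qd, map_mul, PowerSeries.constantCoeff_X, zero_mul]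

variable (k) in
/-- At `ħ = 0` the relations say that the generators commute. -/
theorem exists_specialization : ∃ θ : StokesAlg k →+* MvPowerSeries (Fin 3) k,
    (∀ s, θ (StokesAlg.gen k s) = genSymbol k s) ∧
      ∀ (c : k⟦X⟧) a, θ (c • a) = MvPowerSeries.C (PowerSeries.constantCoeff c) * θ a := by
  let _ : Algebra k⟦X⟧ (MvPowerSeries (Fin 3) k) :=
    ((MvPowerSeries.C (σ := Fin 3)).comp (PowerSeries.constantCoeff (R := k))).toAlgebra
  have hs : ∀ (c : k⟦X⟧) (f : MvPowerSeries (Fin 3) k),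
      c • f = MvPowerSeries.C (PowerSeries.constantCoeff c) * f := fun c f => Algebra.smul_def c f
  have h1 := constantCoeff_q (k := k)
  have h2 := constantCoeff_qd (k := k)
  refine ⟨(StokesAlg.lift (genSymbol k) ?_ ?_ ?_).toRingHom, fun s => StokesAlg.lift_gen _ _ _ _ s,
    fun c a => ?_⟩
  · simp only [hs, map_mul, h1, h2, map_one, map_zero]
    ring
  · simp only [hs, h1, h2, map_one, map_zero]
    ring
  · simp only [hs, h1, h2, map_one, map_zero]
    ring
  · exact (map_smul (StokesAlg.lift (genSymbol k) _ _ _) c a).trans (hs c _)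

variable (k) in
/-- The specialization of the presented algebra. -/
def algSymbol : StokesAlg k →+* MvPowerSeries (Fin 3) k := (exists_specialization k).choose

theorem algSymbol_gen (s : StokesGen) : algSymbol k (StokesAlg.gen k s) = genSymbol k s :=
  (exists_specialization k).choose_spec.1 s

theorem algSymbol_smul (c : k⟦X⟧) (a : StokesAlg k) :
    algSymbol k (c • a) = MvPowerSeries.C (PowerSeries.constantCoeff c) * algSymbol k a :=
  (exists_specialization k).choose_spec.2 c a

variable (H : CoproductCounit k)

/-- The constant coefficients of the expansion in ordered monomials. -/
def symbolFun (x : stokesClosure k) : MvPowerSeries (Fin 3) k :=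
  fun n => PowerSeries.constantCoeff (coeffs H x (revExp n))

theorem coeff_symbolFun (x : stokesClosure k) (n : Fin 3 →₀ ℕ) :
    MvPowerSeries.coeff n (symbolFun H x) = PowerSeries.constantCoeff (coeffs H x (revExp n)) := rfl

theorem symbolFun_add (x y : stokesClosure k) :
    symbolFun H (x + y) = symbolFun H x + symbolFun H y := by
  ext n
  simp only [map_add, coeff_symbolFun, Pi.add_apply]

theorem symbolFun_smul (c : k⟦X⟧) (x : stokesClosure k) :
    symbolFun H (c • x) = MvPowerSeries.C (PowerSeries.constantCoeff c) * symbolFun H x := by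
  ext n
  simp only [MvPowerSeries.coeff_C_mul, coeff_symbolFun, map_smul, Pi.smul_apply, smul_eq_mul,
    map_mul]

theorem symbolFun_sub (x y : stokesClosure k) :
    symbolFun H (x - y) = symbolFun H x - symbolFun H y := by
  ext n
  simp only [map_sub, coeff_symbolFun, Pi.sub_apply]

/-- The monomial `k^p` is divisible by `ħ ^ deg p`, so divisibility of an element by `ħ^m` only
forces the constant coefficients at monomials of degree less than `m` to vanish. -/
theorem symbolFun_mem_orderIdeal {x : stokesClosure k} {m : ℕ}
    (h : ∀ p, PowerSeries.X ^ m ∣ coeffs H x p * PowerSeries.X ^ deg p) :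
    symbolFun H x ∈ orderIdeal k m := by
  refine mem_orderIdeal_iff.2 fun d hd => ?_
  rw [← deg_revExp] at hd
  have h1 : PowerSeries.X ^ (1 + deg (revExp d)) ∣
      coeffs H x (revExp d) * PowerSeries.X ^ deg (revExp d) :=
    (pow_dvd_pow _ (by omega)).trans (h (revExp d))
  rw [pow_add, mul_dvd_mul_iff_right (pow_ne_zero _ PowerSeries.X_ne_zero), pow_one] at h1
  exact PowerSeries.X_dvd_iff.1 h1

theorem coeffs_toClosure_mon (p : ℕ × ℕ × ℕ) :
    coeffs H (toClosure (StokesAlg.mon k p)) = Pi.single p 1 := by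
  refine coeffs_eq H fun N => ?_
  have h : (toClosure (StokesAlg.mon k p) : Ugl k) = monomial k p := StokesAlg.toUgl_mon p
  rw [h]
  refine (approxSum_iff_of_superset (S := insert p (degLT N)) (Finset.subset_insert _ _)).2
    ⟨0, ?_⟩
  rw [smul_zero, add_zero, Finset.sum_eq_single_of_mem p (Finset.mem_insert_self _ _)
    fun r _ hr => by rw [Pi.single_eq_of_ne hr, zero_smul], Pi.single_eq_same, one_smul]

theorem symbolFun_toClosure (a : StokesAlg k) : symbolFun H (toClosure a) = algSymbol k a := by
  have hmon : ∀ p, symbolFun H (toClosure (StokesAlg.mon k p)) =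
      algSymbol k (StokesAlg.mon k p) := by
    rintro ⟨a, b, c⟩
    ext n
    have h1 : algSymbol k (StokesAlg.mon k (a, b, c)) = MvPowerSeries.monomial
        (Finsupp.single 2 a + Finsupp.single 1 b + Finsupp.single 0 c) 1 := by
      simp only [StokesAlg.mon, ordMon, map_mul, map_pow, algSymbol_gen, genSymbol,
        MvPowerSeries.X_pow_eq, MvPowerSeries.monomial_mul_monomial, mul_one]
    rw [coeff_symbolFun, coeffs_toClosure_mon, h1, MvPowerSeries.coeff_monomial, Pi.single_apply]
    have h2 : revExp n = (a, b, c) ↔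
        n = Finsupp.single 2 a + Finsupp.single 1 b + Finsupp.single 0 c := by
      rw [revExp, Prod.mk.injEq, Prod.mk.injEq]
      constructor
      · rintro ⟨rfl, rfl, rfl⟩
        ext i
        fin_cases i <;> simp
      · rintro rfl
        simp
    simp only [h2]
    split_ifs <;> simp
  obtain ⟨S, c, rfl⟩ := StokesAlg.exists_sum_mon a
  have hsum : ∀ S : Finset (ℕ × ℕ × ℕ), symbolFun H (∑ p ∈ S, c p • toClosure (StokesAlg.mon k p)) =
      ∑ p ∈ S, symbolFun H (c p • toClosure (StokesAlg.mon k p)) := fun S =>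
    map_sum (AddMonoidHom.mk' (symbolFun H) (symbolFun_add H)) _ S
  simp only [map_sum, map_smul, hsum, symbolFun_smul, hmon, algSymbol_smul]

theorem exists_sub_toClosure_eq (x : stokesClosure k) (m : ℕ) :
    ∃ (a : StokesAlg k) (u : Ugl k),
      ((x - toClosure a : stokesClosure k) : Ugl k) = (PowerSeries.X ^ m : k⟦X⟧) • u := by
  obtain ⟨s, hs, u, hu⟩ := x.2 m
  rw [← StokesAlg.range_toUgl] at hs
  obtain ⟨a, rfl⟩ := hs
  refine ⟨a, u, ?_⟩
  change (x : Ugl k) - StokesAlg.toUgl k a = _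
  rw [hu]
  exact add_sub_cancel_left _ _

/-- Multiplicativity holds on polynomials in the `k_{i,j}`, where the specialization is the
homomorphism `algSymbol`, and extends by continuity for the order filtration. -/
theorem symbolFun_mul (x y : stokesClosure k) :
    symbolFun H (x * y) = symbolFun H x * symbolFun H y := by
  refine eq_of_sub_mem_orderIdeal fun m => ?_
  obtain ⟨a, u, hu⟩ := exists_sub_toClosure_eq x m
  obtain ⟨b, v, hv⟩ := exists_sub_toClosure_eq y m
  have h1 : symbolFun H x - algSymbol k a ∈ orderIdeal k m := by
    rw [← symbolFun_toClosure H, ← symbolFun_sub]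
    exact symbolFun_mem_orderIdeal H (coeffs_dvd H hu)
  have h2 : symbolFun H y - algSymbol k b ∈ orderIdeal k m := by
    rw [← symbolFun_toClosure H, ← symbolFun_sub]
    exact symbolFun_mem_orderIdeal H (coeffs_dvd H hv)
  have h3 : symbolFun H (x * y) - algSymbol k a * algSymbol k b ∈ orderIdeal k m := by
    rw [← map_mul, ← symbolFun_toClosure H, ← symbolFun_sub]
    refine symbolFun_mem_orderIdeal H (coeffs_dvd H (u := u * y + toClosure a * v) ?_)
    rw [map_mul, show x * y - toClosure a * toClosure b =
      (x - toClosure a) * y + toClosure a * (y - toClosure b) by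
        rw [sub_mul, mul_sub, sub_add_sub_cancel], smul_add,
      ← smul_mul_assoc, ← hu, ← mul_smul_comm, ← hv]
    rfl
  have : symbolFun H (x * y) - symbolFun H x * symbolFun H y =
      (symbolFun H (x * y) - algSymbol k a * algSymbol k b) -
        (symbolFun H x - algSymbol k a) * symbolFun H y -
        algSymbol k a * (symbolFun H y - algSymbol k b) := by ring
  rw [this]
  exact sub_mem (sub_mem h3 (Ideal.mul_mem_right _ _ h1)) (Ideal.mul_mem_left _ _ h2)

/-- The specialization at `ħ = 0`. -/
def symbol : stokesClosure k →+* MvPowerSeries (Fin 3) k where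
  toFun := symbolFun H
  map_one' := by rw [← map_one (toClosure (k := k)), symbolFun_toClosure, map_one]
  map_mul' := symbolFun_mul H
  map_zero' := by
    ext n
    simp only [coeff_symbolFun, map_zero, Pi.zero_apply]
  map_add' := symbolFun_add H

theorem symbol_surjective : Function.Surjective (symbol H) := by
  intro f
  refine ⟨(coeffs H).symm fun p => PowerSeries.C (MvPowerSeries.coeff
    (Finsupp.single 2 p.1 + Finsupp.single 1 p.2.1 + Finsupp.single 0 p.2.2) f), ?_⟩
  ext n
  change PowerSeries.constantCoeff (coeffs H _ (revExp n)) = _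
  rw [LinearEquiv.apply_symm_apply, PowerSeries.constantCoeff_C]
  congr 2
  ext i
  fin_cases i <;> simp [revExp]

theorem symbol_eq_zero_iff (x : stokesClosure k) :
    symbol H x = 0 ↔ ∃ y : stokesClosure k, x = (PowerSeries.X : k⟦X⟧) • y := by
  constructor
  · intro h
    have h0 : ∀ p, PowerSeries.X ∣ coeffs H x p := fun ⟨a, b, c⟩ => PowerSeries.X_dvd_iff.2 (by
      have := congrArg (MvPowerSeries.coeff
        (Finsupp.single 2 a + Finsupp.single 1 b + Finsupp.single 0 c)) h
      change PowerSeries.constantCoeff (coeffs H x (revExp _)) = _ at this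
      simpa [revExp] using this)
    choose d hd using h0
    refine ⟨(coeffs H).symm d, (coeffs H).injective ?_⟩
    rw [map_smul, LinearEquiv.apply_symm_apply]
    exact funext hd
  · rintro ⟨y, rfl⟩
    refine (symbolFun_smul H _ y).trans ?_
    rw [PowerSeries.constantCoeff_X, map_zero, zero_mul]

theorem symbol_smul (c : k⟦X⟧) (x : stokesClosure k) :
    symbol H (c • x) = PowerSeries.constantCoeff c • symbol H x := by
  rw [MvPowerSeries.smul_eq_C_mul]
  exact symbolFun_smul H c x

theorem symbol_toClosure (a : StokesAlg k) : symbol H (toClosure a) = algSymbol k a :=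
  symbolFun_toClosure H a

theorem symbol_of_eq {x : stokesClosure k} {s : StokesGen}
    (h : (x : Ugl k) = StokesAlg.genImage k s) : symbol H x = genSymbol k s := by
  have : x = toClosure (StokesAlg.gen k s) := Subtype.ext (h.trans (StokesAlg.toUgl_gen s).symm)
  rw [this, symbol_toClosure, algSymbol_gen]

/-! ### The Poisson bracket -/

theorem X_smul_injective (H : CoproductCounit k) {x y : stokesClosure k}
    (h : (PowerSeries.X : k⟦X⟧) • x = (PowerSeries.X : k⟦X⟧) • y) : x = y := by
  refine (coeffs H).injective (funext fun p => ?_)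
  have := congrFun (congrArg (coeffs H) h) p
  rw [map_smul, map_smul] at this
  exact mul_left_cancel₀ PowerSeries.X_ne_zero this

theorem exists_commutator (H : CoproductCounit k) (x y : stokesClosure k) :
    ∃ z : stokesClosure k, x * y - y * x = (PowerSeries.X : k⟦X⟧) • z := by
  rw [← symbol_eq_zero_iff H, map_sub, map_mul, map_mul, mul_comm, sub_self]

/-- The commutator divided by `ħ`; the quotient is unique by `commutatorDiv_eq`. -/
def commutatorDiv (x y : stokesClosure k) : stokesClosure k := (exists_commutator H x y).choose

theorem X_smul_commutatorDiv (x y : stokesClosure k) :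
    (PowerSeries.X : k⟦X⟧) • commutatorDiv H x y = x * y - y * x :=
  (exists_commutator H x y).choose_spec.symm

theorem commutatorDiv_eq {x y z : stokesClosure k}
    (h : x * y - y * x = (PowerSeries.X : k⟦X⟧) • z) : commutatorDiv H x y = z :=
  X_smul_injective H ((X_smul_commutatorDiv H x y).trans h)

theorem commutatorDiv_add_left (x x' y : stokesClosure k) :
    commutatorDiv H (x + x') y = commutatorDiv H x y + commutatorDiv H x' y :=
  commutatorDiv_eq H (by
    rw [smul_add, X_smul_commutatorDiv, X_smul_commutatorDiv, add_mul, mul_add]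
    abel)

theorem commutatorDiv_mul_left (x x' y : stokesClosure k) :
    commutatorDiv H (x * x') y = x * commutatorDiv H x' y + commutatorDiv H x y * x' :=
  commutatorDiv_eq H (by
    rw [smul_add, ← mul_smul_comm, ← smul_mul_assoc, X_smul_commutatorDiv, X_smul_commutatorDiv,
      mul_sub, sub_mul, ← mul_assoc, ← mul_assoc, ← mul_assoc, sub_add_sub_cancel])

theorem commutatorDiv_swap (x y : stokesClosure k) :
    commutatorDiv H y x = -commutatorDiv H x y :=
  commutatorDiv_eq H (by rw [smul_neg, X_smul_commutatorDiv, neg_sub])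

theorem commutatorDiv_algebraMap_left (c : k⟦X⟧) (y : stokesClosure k) :
    commutatorDiv H (algebraMap k⟦X⟧ _ c) y = 0 :=
  commutatorDiv_eq H (by rw [smul_zero, Algebra.commutes, sub_self])

theorem commutatorDiv_self (x : stokesClosure k) : commutatorDiv H x x = 0 :=
  commutatorDiv_eq H (by rw [smul_zero, sub_self])

theorem symbol_commutatorDiv_mem {x : stokesClosure k} {m : ℕ} {u : Ugl k}
    (hx : (x : Ugl k) = (PowerSeries.X ^ (m + 1) : k⟦X⟧) • u) (y : stokesClosure k) :
    symbol H (commutatorDiv H x y) ∈ orderIdeal k m := by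
  refine symbolFun_mem_orderIdeal H fun p => ?_
  have h : (((PowerSeries.X : k⟦X⟧) • commutatorDiv H x y : stokesClosure k) : Ugl k) =
      (PowerSeries.X ^ (m + 1) : k⟦X⟧) • (u * y - y * u) := by
    rw [X_smul_commutatorDiv, smul_sub, ← smul_mul_assoc, ← mul_smul_comm, ← hx]
    rfl
  have hp := coeffs_dvd H h p
  rw [map_smul, Pi.smul_apply, smul_eq_mul, mul_assoc, pow_succ',
    mul_dvd_mul_iff_left PowerSeries.X_ne_zero] at hp
  exact hp

theorem constantCoeff_divH_q_sub_one :
    PowerSeries.constantCoeff (divH (q k - 1)) = 1 := by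
  rw [← PowerSeries.coeff_zero_eq_constantCoeff_apply, divH, PowerSeries.coeff_mk, map_sub, coeff_q]
  simp [PowerSeries.coeff_one]

theorem q_eq_one_add : q k = 1 + PowerSeries.X * divH (q k - 1) := by
  rw [X_mul_divH _ (by simp [constantCoeff_q]), add_sub_cancel]

/-- A `q`-commutation relation determines the bracket of the symbols. -/
theorem symbol_commutatorDiv_of_relation {x y z : stokesClosure k} {c : k⟦X⟧}
    (h : x * y = q k • (y * x) - (c * qd k) • z) : symbol H (commutatorDiv H x y) =
      symbol H x * symbol H y - MvPowerSeries.C (PowerSeries.constantCoeff c) * 2 * symbol H z := by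
  have h1 : commutatorDiv H x y = divH (q k - 1) • (y * x) - (c * divH (qd k)) • z := by
    refine commutatorDiv_eq H ?_
    have hc : c * qd k = PowerSeries.X * (c * divH (qd k)) := by
      rw [mul_left_comm, X_mul_divH_qd]
    have hq : q k • (y * x) = y * x + (PowerSeries.X * divH (q k - 1)) • (y * x) := by
      nth_rewrite 1 [q_eq_one_add]
      rw [add_smul, one_smul]
    rw [h, hc, hq, smul_sub, smul_smul, smul_smul, sub_right_comm, add_sub_cancel_left]
  rw [h1, map_sub, symbol_smul, symbol_smul, constantCoeff_divH_q_sub_one, one_smul, map_mul,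
    map_mul, constantCoeff_divH_qd, MvPowerSeries.smul_eq_C_mul, map_mul, map_ofNat, mul_comm]

theorem bracket_gen (s s' : StokesGen) :
    symbol H (commutatorDiv H (toClosure (StokesAlg.gen k s)) (toClosure (StokesAlg.gen k s'))) =
      stokesBracket (genSymbol k s) (genSymbol k s') := by
  have hsymb : ∀ s, symbol H (toClosure (StokesAlg.gen k s)) = genSymbol k s := fun s => by
    rw [symbol_toClosure, algSymbol_gen]
  have h1 : symbol H (commutatorDiv H (toClosure (StokesAlg.gen k .x12))
      (toClosure (StokesAlg.gen k .x23))) =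
      stokesBracket (genSymbol k .x12) (genSymbol k .x23) := by
    have h := congrArg toClosure (StokesAlg.x12_mul_x23 (k := k))
    rw [map_sub, map_smul, map_smul, map_mul, map_mul] at h
    rw [symbol_commutatorDiv_of_relation H h, hsymb, hsymb, hsymb, constantCoeff_q,
      map_one, one_mul]
    exact stokesBracket_X_two_zero.symm
  have h2 : symbol H (commutatorDiv H (toClosure (StokesAlg.gen k .x23))
      (toClosure (StokesAlg.gen k .x13))) =
      stokesBracket (genSymbol k .x23) (genSymbol k .x13) := by
    have h := congrArg toClosure (StokesAlg.x23_mul_x13 (k := k))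
    rw [map_sub, map_smul, map_smul, map_mul, map_mul, ← one_mul (qd k)] at h
    rw [symbol_commutatorDiv_of_relation H h, hsymb, hsymb, hsymb, map_one, map_one, one_mul]
    exact stokesBracket_X_zero_one.symm
  have h3 : symbol H (commutatorDiv H (toClosure (StokesAlg.gen k .x13))
      (toClosure (StokesAlg.gen k .x12))) =
      stokesBracket (genSymbol k .x13) (genSymbol k .x12) := by
    have h := congrArg toClosure (StokesAlg.x13_mul_x12 (k := k))
    rw [map_sub, map_smul, map_smul, map_mul, map_mul, ← one_mul (qd k)] at h
    rw [symbol_commutatorDiv_of_relation H h, hsymb, hsymb, hsymb, map_one, map_one, one_mul]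
    exact stokesBracket_X_one_two.symm
  have hself : ∀ a : MvPowerSeries (Fin 3) k, stokesBracket a a = 0 := fun a => by
    simp only [stokesBracket]
    ring
  have hswap : ∀ {x y : stokesClosure k} {a b : MvPowerSeries (Fin 3) k},
      symbol H (commutatorDiv H x y) = stokesBracket a b →
      symbol H (commutatorDiv H y x) = stokesBracket b a := fun {x y a b} h => by
    rw [commutatorDiv_swap, map_neg, h, stokesBracket_swap a b]
  rcases s with _ | _ | _ <;> rcases s' with _ | _ | _
  all_goals first
    | rw [commutatorDiv_self, map_zero, hself]
    | assumption
    | exact hswap (by assumption)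

theorem bracket_of_gen {y : stokesClosure k} {b : MvPowerSeries (Fin 3) k}
    (h : ∀ s, symbol H (commutatorDiv H (toClosure (StokesAlg.gen k s)) y) =
      stokesBracket (genSymbol k s) b) (a : StokesAlg k) :
    symbol H (commutatorDiv H (toClosure a) y) = stokesBracket (algSymbol k a) b := by
  have ha : a ∈ Algebra.adjoin k⟦X⟧ (Set.range (StokesAlg.gen k)) := by
    rw [StokesAlg.adjoin_range_gen]
    trivial
  induction ha using Algebra.adjoin_induction with
  | mem a ha =>
    obtain ⟨s, rfl⟩ := ha
    rw [h, algSymbol_gen]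
  | algebraMap c =>
    have hc : algSymbol k (algebraMap k⟦X⟧ _ c) =
        MvPowerSeries.C (PowerSeries.constantCoeff c) := by
      rw [Algebra.algebraMap_eq_smul_one, algSymbol_smul, map_one, mul_one]
    rw [AlgHom.commutes, commutatorDiv_algebraMap_left, map_zero, hc, stokesBracket_C_left]
  | add a a' _ _ ha ha' =>
    rw [map_add, commutatorDiv_add_left, map_add, ha, ha', map_add, stokesBracket_add_left]
  | mul a a' _ _ ha ha' =>
    rw [map_mul, commutatorDiv_mul_left, map_add, map_mul, map_mul, ha, ha', symbol_toClosure,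
      symbol_toClosure, map_mul, stokesBracket_mul_left]

theorem bracket_toClosure (a b : StokesAlg k) :
    symbol H (commutatorDiv H (toClosure a) (toClosure b)) =
      stokesBracket (algSymbol k a) (algSymbol k b) := by
  refine bracket_of_gen H (fun s => ?_) a
  rw [commutatorDiv_swap, map_neg, stokesBracket_swap]
  refine congrArg Neg.neg (bracket_of_gen H (fun s' => ?_) b)
  exact bracket_gen H s' s

/-- The commutator divided by `ħ` specializes to the Dubrovin–Ugaglia bracket. -/
theorem symbol_commutatorDiv (x y : stokesClosure k) :
    symbol H (commutatorDiv H x y) = stokesBracket (symbol H x) (symbol H y) := by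
  refine eq_of_sub_mem_orderIdeal fun m => ?_
  -- by continuity it suffices to consider elements of the presented algebra
  obtain ⟨a, u, hu⟩ := exists_sub_toClosure_eq x (m + 1)
  obtain ⟨b, v, hv⟩ := exists_sub_toClosure_eq y (m + 1)
  have h1 : ∀ {x : stokesClosure k} {a u}, ((x - toClosure a : stokesClosure k) : Ugl k) =
      (PowerSeries.X ^ (m + 1) : k⟦X⟧) • u → symbol H x - algSymbol k a ∈ orderIdeal k (m + 1) :=
    fun {x a u} hu => by
      rw [← symbol_toClosure H, ← map_sub]
      exact symbolFun_mem_orderIdeal H (coeffs_dvd H hu)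
  -- the error made by replacing the first argument
  have h2 : ∀ {x : stokesClosure k} {a u} (y : stokesClosure k),
      ((x - toClosure a : stokesClosure k) : Ugl k) = (PowerSeries.X ^ (m + 1) : k⟦X⟧) • u →
      (symbol H (commutatorDiv H x y) - stokesBracket (symbol H x) (symbol H y)) -
        (symbol H (commutatorDiv H (toClosure a) y) -
          stokesBracket (algSymbol k a) (symbol H y)) ∈ orderIdeal k m := by
    intro x a u y hu
    have e1 : commutatorDiv H x y = commutatorDiv H (x - toClosure a) y +
        commutatorDiv H (toClosure a) y := by
      rw [← commutatorDiv_add_left, sub_add_cancel]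
    have e2 := stokesBracket_sub_left (symbol H x) (algSymbol k a) (symbol H y)
    have e3 : (symbol H (commutatorDiv H x y) - stokesBracket (symbol H x) (symbol H y)) -
        (symbol H (commutatorDiv H (toClosure a) y) -
          stokesBracket (algSymbol k a) (symbol H y)) =
        symbol H (commutatorDiv H (x - toClosure a) y) -
          stokesBracket (symbol H x - algSymbol k a) (symbol H y) := by
      rw [e1, e2, map_add]
      ring
    rw [e3]
    exact sub_mem (symbol_commutatorDiv_mem H hu y) (stokesBracket_mem_orderIdeal _ _ (h1 hu))
  have h3 := h2 y hu
  have h4 := h2 (toClosure a) hv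
  rw [symbol_toClosure, bracket_toClosure, sub_self, sub_zero, commutatorDiv_swap, map_neg,
    stokesBracket_swap, neg_sub_neg, ← neg_sub] at h4
  have h5 := add_mem h3 (neg_mem_iff.1 h4)
  rwa [sub_add_cancel] at h5

end Specialization

end QuantumStokes

end

theorem theorem6p10 (k : Type*) [Field k] [CharZero k] :
    -- the coproduct and the counit of `U_ħ(gl_3)` exist and are unique
    Nonempty (Unique (CoproductCounit k)) ∧
    ∀ H : CoproductCounit k,
    -- `F` is `U_ħ(so_3)^↰`, which is a unital subalgebra
    ∃ F : Subalgebra k⟦X⟧ (Ugl k), F.toSubmodule = H.harpoon (Uso k) ∧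
      -- it is `ħ`-adically complete
      IsAdicComplete (Ideal.span {(PowerSeries.X : k⟦X⟧)}) F ∧
      -- it is the topological algebra with the three generators and the three relations
      (∃ Φ : StokesCompl k ≃ₐ[k⟦X⟧] F,
        (Φ (StokesCompl.gen k .x12) : Ugl k) = k12 k ∧
        (Φ (StokesCompl.gen k .x23) : Ugl k) = k23 k ∧
        (Φ (StokesCompl.gen k .x13) : Ugl k) = k13 k ∧
        ∀ (x : StokesCompl k) (m : ℕ),
          (x : ∀ m : ℕ, StokesAlg k ⧸ StokesAlg.ideal k ^ m) m = 0 ↔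
            ∃ y : Ugl k, (Φ x : Ugl k) = (PowerSeries.X ^ m : k⟦X⟧) • y) ∧
      -- the coproduct of the generators
      (∀ N : ℕ, H.comul N (red k N (k12 k)) =
        1 ⊗ₜ red k N (k12 k) + red k N (k12 k) ⊗ₜ red k N (tinv k 0)) ∧
      (∀ N : ℕ, H.comul N (red k N (k23 k)) =
        1 ⊗ₜ red k N (k23 k) + red k N (k23 k) ⊗ₜ red k N (tinv k 1)) ∧
      (∀ N : ℕ, H.comul N (red k N (k13 k)) =
        1 ⊗ₜ red k N (k13 k) + red k N (k13 k) ⊗ₜ red k N (tinv k 0 * tinv k 1)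
          + ((q k)⁻¹ * qd k) • (red k N (k12 k) ⊗ₜ red k N (f k 1 * tinv k 0))
          - qd k • (red k N (k23 k) ⊗ₜ red k N (tinv k 0 * tinv k 1 * e k 0))) ∧
      -- `F` is a right coideal of `U_ħ(sl_3)'`
      (∀ x ∈ F, ∀ N : ℕ, H.comul N (red k N x) ∈
        Submodule.map₂ (TensorProduct.mk k⟦X⟧ (UglMod k N) (UglMod k N))
          (redSub k N F.toSubmodule) (redSub k N H.slPrime)) ∧
      -- the ordered monomials are a topological basis
      (∀ c : ℕ × ℕ × ℕ → k⟦X⟧, ∃ x ∈ F, HasHSum (k := k) (fun p => c p • monomial k p) x) ∧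
      (∀ x ∈ F, ∃! c : ℕ × ℕ × ℕ → k⟦X⟧, HasHSum (k := k) (fun p => c p • monomial k p) x) ∧
      -- the specialization at `ħ = 0` is the Poisson algebra of formal functions on Stokes matrices
      ∃ σ : F →+* MvPowerSeries (Fin 3) k,
        Function.Surjective σ ∧
        (∀ x : F, σ x = 0 ↔ ∃ y : F, x = (PowerSeries.X : k⟦X⟧) • y) ∧
        (∀ (c : k⟦X⟧) (x : F), σ (c • x) = PowerSeries.constantCoeff c • σ x) ∧
        (∀ x : F, (x : Ugl k) = k12 k → σ x = MvPowerSeries.X 2) ∧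
        (∀ x : F, (x : Ugl k) = k13 k → σ x = MvPowerSeries.X 1) ∧
        (∀ x : F, (x : Ugl k) = k23 k → σ x = MvPowerSeries.X 0) ∧
        ∀ a b c : F, a * b - b * a = (PowerSeries.X : k⟦X⟧) • c →
          σ c = stokesBracket (σ a) (σ b) := by
  refine ⟨⟨⟨inferInstance, fun _ => coproductCounit_ext _ _⟩⟩, fun H => ?_⟩
  refine ⟨stokesClosure k, stokesClosure_toSubmodule H,
    isAdicComplete_of_equiv_pi (monomialEquiv H),
    ⟨complEquiv H, complEquiv_gen H _, complEquiv_gen H _, complEquiv_gen H _,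
      complEquiv_eq_zero_iff H⟩,
    H.comul_k12, H.comul_k23, H.comul_k13,
    fun x hx N => comul_mem_of_mem_stokesClosure H hx N, fun c => ?_, fun x hx => ?_,
    symbol H, symbol_surjective H, symbol_eq_zero_iff H, symbol_smul H,
    fun x h => symbol_of_eq H (s := .x12) h, fun x h => symbol_of_eq H (s := .x13) h,
    fun x h => symbol_of_eq H (s := .x23) h, fun a b c h => ?_⟩
  · obtain ⟨x, hx⟩ := exists_approxSum c
    exact ⟨x, mem_stokesClosure_of_approxSum hx, hasHSum_iff.2 hx⟩
  · exact ⟨coeffs H ⟨x, hx⟩, hasHSum_iff.2 (coeffs_spec H ⟨x, hx⟩),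
      fun c hc => coeff_unique H (hasHSum_iff.1 hc) (coeffs_spec H ⟨x, hx⟩)⟩
  · rw [← symbol_commutatorDiv, commutatorDiv_eq H h]
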